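/- **Theorem 1 (Convergence of global occupancy states).** Fix $\lambda>0$ and an integer $d\ge 2$. For $N\ge 1$ let $G_N$ be a simple undirected graph on $[N]=\{1,\dots,N\}$, let $\xi^N_{ij}=1$ if $i,j$ are adjacent and $0$ otherwise, and let $D^N_i$ be the degree of $i$. Assume that (i) $\min_{i\in[N]}D_i^N\to\infty$ and (ii) $\max_{i\in[N]}\Big|\sum_{j\ne i}\xi^N_{ji}/D^N_j-1\Big|\to0$ as $N\to\infty$. Let $X^N(t)=(X^N_i(t))_{i\in[N]}$ be the queue lengths of the following JSQ($d$) system. Each vertex is a server with its own infinite-buffer queue; tasks arrive at the servers as independent Poisson processes of rate $\lambda$ and have independent unit-mean exponential service times. A task arriving at server $j$ with $D^N_j\ge d-1$ joins the shortest queue among $j$ and $d-1$ neighbours of $j$ chosen uniformly at random, ties being broken uniformly at random; tasks arriving at a server $j$ with $D_j^N<d-1$ are assigned among $j$ and its neighbours by an arbitrary rule depending on the current queue lengths. Precisely, for each $N$, $X^N$ is an $\mathbb N_0^N$-valued càdlàg process, adapted to a filtration, such that almost surely, for all $t\ge0$ and $i\in[N]$, $$X^N_i(t)=X^N_i(0)-\int_{[0,t]}\mathbf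 1_{\{X^N_i(s-)>0\}}\,\mathcal N_i(ds)+\int_{[0,t]\times\mathbb R_+}\mathbf 1_{\{0\le y\le C^N_i(s-)\}}\,\bar{\mathcal N}_i(ds\,dy),$$ where the $\mathcal N_i$ are rate-$1$ Poisson processes and the $\bar{\mathcal N}_i$ are Poisson random measures on $[0,\infty)\times\mathbb R_+$ with intensity $\lambda\,ds\,dy$, all mutually independent, adapted to the filtration and with increments after time $t$ independent of the $\sigma$-field of time $t$ (in particular independent of $X^N(0)$), and $C^N_i(t)=\sum_{j\in[N]}p^N_{ji}(X^N(t))$. Here, if $D_j^N\ge d-1$, $p^N_{ji}(x)$ is the probability that a task arriving at $j$ when the queue lengths are $x$ is assigned to $i$ under the scheme just described; if $D_j^N<d-1$, then $p^N_{ji}(x)$ is an arbitrary function of $x$ with values in $[0,D_i^N+1]$ when $i=j$ or $i$ is a neighbour of $j$, and $p^N_{ji}(x)=0$ otherwise. Let $S=\{q=(q_i)_{i\ge0}\in[0,1]^{\mathbb N_0}: q_0=1,\ q_i\ge q_{i+1}\ \forall i,\ \sum_iq_i<\infty\}$ with the $\ell_1$ metric, and let $q^N(t)=(q^N_j(t))_{j\ge0}\in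 S$ with $q^N_j(t)=\frac1N\#\{i\in[N]:X^N_i(t)\ge j\}$. Suppose that for each $N$ the initial queue lengths $X^N_i(0)$, $i\in[N]$, are i.i.d. with $P(X^N_i(0)\ge j)=q^\infty_j$, $j=1,2,\dots$, for some $q^\infty\in S$ not depending on $N$. Then the system of equations $$\frac{dq_i(t)}{dt}=\lambda\big[(q_{i-1}(t))^d-(q_i(t))^d\big]-\big(q_i(t)-q_{i+1}(t)\big),\quad i=1,2,\dots,\ t\ge0,\qquad q(0)=q^\infty,$$ has a unique $S$-valued solution $q(\cdot)$, it is continuous in $S$, and for every $T\in[0,\infty)$ the processes $q^N(\cdot)$, as random elements of $D([0,T],S)$ with the Skorokhod $J_1$ topology, converge weakly to the deterministic path $q(\cdot)$ as $N\to\infty$. -/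

import Mathlib

open MeasureTheory ProbabilityTheory Filter Topology Set
open scoped NNReal ENNReal

namespace JSQ

noncomputable section

/-! ### Càdlàg paths and the Skorokhod `J₁` topology on a compact interval -/

/-- A right-continuous function with left limits. -/
def IsCadlag {I E : Type*} [LinearOrder I] [TopologicalSpace I] [TopologicalSpace E]
    (f : I → E) : Prop :=
  ∀ t, ContinuousWithinAt f (Ici t) t ∧ ∃ l, Tendsto f (𝓝[<] t) (𝓝 l)

theorem IsCadlag.comp {I E F : Type*} [LinearOrder I] [TopologicalSpace I] [TopologicalSpace E]
    [TopologicalSpace F] {f : I → E} (hf : IsCadlag f) {g : E → F} (hg : Continuous g) :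
    IsCadlag (g ∘ f) := fun t =>
  ⟨hg.continuousAt.comp_continuousWithinAt (hf t).1,
    let ⟨l, hl⟩ := (hf t).2; ⟨g l, (hg.tendsto l).comp hl⟩⟩

theorem IsCadlag.restrict {E : Type*} [TopologicalSpace E] {f : ℝ≥0 → E} (hf : IsCadlag f)
    (T : ℝ≥0) : IsCadlag (fun t : Icc (0 : ℝ≥0) T => f t) := fun t => by
  refine ⟨?_, ?_⟩
  · exact (hf t).1.comp continuous_subtype_val.continuousWithinAt fun s hs => hs
  · obtain ⟨l, hl⟩ := (hf t).2
    refine ⟨l, hl.comp (tendsto_nhdsWithin_iff.2 ⟨?_, ?_⟩)⟩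
    · exact continuous_subtype_val.continuousAt.tendsto.mono_left nhdsWithin_le_nhds
    · exact eventually_nhdsWithin_of_forall fun s hs => hs

theorem isCadlag_of_continuous {I E : Type*} [LinearOrder I] [TopologicalSpace I]
    [TopologicalSpace E] {f : I → E} (hf : Continuous f) : IsCadlag f := fun t =>
  ⟨hf.continuousWithinAt, f t, hf.continuousAt.tendsto.mono_left nhdsWithin_le_nhds⟩

/-- The space `D([0,T], E)` of càdlàg paths. -/
def SkorokhodSpace (T : ℝ≥0) (E : Type*) [TopologicalSpace E] : Type _ :=
  {f : Icc (0 : ℝ≥0) T → E // IsCadlag f}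

/-- The Skorokhod `J₁` distance: the infimum of `max (sup |φ t - t|) (sup d(x t, y (φ t)))` over all
increasing bijections `φ` of `[0,T]`. -/
def skorokhodEDist {T : ℝ≥0} {E : Type*} [PseudoEMetricSpace E] (x y : SkorokhodSpace T E) :
    ℝ≥0∞ :=
  ⨅ φ : Icc (0 : ℝ≥0) T ≃o Icc (0 : ℝ≥0) T,
    max (⨆ t, edist (φ t) t) (⨆ t, edist (x.1 t) (y.1 (φ t)))

instance {T : ℝ≥0} {E : Type*} [PseudoEMetricSpace E] :
    PseudoEMetricSpace (SkorokhodSpace T E) where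
  edist := skorokhodEDist
  edist_self x := by
    refine le_antisymm (iInf_le_of_le (OrderIso.refl _) ?_) zero_le
    simp
  edist_comm := by
    have key : ∀ x y : SkorokhodSpace T E, skorokhodEDist x y ≤ skorokhodEDist y x := by
      intro x y
      refine le_iInf fun φ => iInf_le_of_le φ.symm (max_le_max ?_ ?_)
      · refine iSup_le fun t => le_iSup_of_le (φ.symm t) ?_
        simp [edist_comm]
      · refine iSup_le fun t => le_iSup_of_le (φ.symm t) ?_
        simp [edist_comm]
    exact fun x y => le_antisymm (key x y) (key y x)
  edist_triangle x y z := by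
    unfold skorokhodEDist
    refine ENNReal.le_iInf_add_iInf fun φ ψ => iInf_le_of_le (φ.trans ψ) (max_le ?_ ?_)
    · refine iSup_le fun t => (edist_triangle _ (φ t) _).trans ?_
      rw [add_comm]
      exact add_le_add ((le_iSup (fun t => edist (φ t) t) t).trans (le_max_left _ _))
        ((le_iSup (fun t => edist (ψ t) t) (φ t)).trans (le_max_left _ _))
    · refine iSup_le fun t => (edist_triangle _ (y.1 (φ t)) _).trans ?_
      exact add_le_add
        ((le_iSup (fun t => edist (x.1 t) (y.1 (φ t))) t).trans (le_max_right _ _))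
        ((le_iSup (fun t => edist (y.1 t) (z.1 (ψ t))) (φ t)).trans (le_max_right _ _))

instance {T : ℝ≥0} {E : Type*} [PseudoEMetricSpace E] : MeasurableSpace (SkorokhodSpace T E) :=
  borel _

instance {T : ℝ≥0} {E : Type*} [PseudoEMetricSpace E] : BorelSpace (SkorokhodSpace T E) :=
  ⟨rfl⟩

/-! ### The occupancy space and the limiting equation -/

/-- The space `S` of nonincreasing summable sequences in `[0,1]` with `q 0 = 1`, with the `ℓ¹`
metric. -/
abbrev OccupancySpace : Type :=
  {q : lp (fun _ : ℕ => ℝ) 1 // q 0 = 1 ∧ (∀ i, q (i + 1) ≤ q i) ∧ ∀ i, q i ∈ Icc (0 : ℝ) 1}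

/-- `q` solves `q_i' = lam (q_{i-1}^d - q_i^d) - (q_i - q_{i+1})`, `i ≥ 1`, on `[0,∞)` (with the
one-sided derivative at `0`), with `q(0) = q₀`. -/
def IsSupermarketSolution (lam : ℝ≥0) (d : ℕ) (q₀ : OccupancySpace) (q : ℝ≥0 → OccupancySpace) :
    Prop :=
  q 0 = q₀ ∧ ∀ (t : ℝ≥0) (i : ℕ),
    HasDerivWithinAt (fun s : ℝ => (q s.toNNReal).1 (i + 1))
      (lam * ((q t).1 i ^ d - (q t).1 (i + 1) ^ d) - ((q t).1 (i + 1) - (q t).1 (i + 2)))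
      (Ici 0) t

/-- The occupancy state of a queue-length vector `x`: entry `j` is the fraction of servers with
queue length at least `j`. -/
def occupancy {V : Type*} [Fintype V] [Nonempty V] (x : V → ℕ) : OccupancySpace :=
  ⟨⟨fun j => ((Finset.univ.filter fun i => j ≤ x i).card : ℝ) / Fintype.card V, by
      refine memℓp_gen (summable_of_ne_finset_zero
        (s := Finset.range (Finset.univ.sup x + 1)) fun j hj => ?_)
      have h : (Finset.univ.filter fun i => j ≤ x i) = ∅ := by
        refine Finset.filter_eq_empty_iff.2 fun i _ hi => ?_
        have := Finset.le_sup (f := x) (Finset.mem_univ i)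
        simp only [Finset.mem_range] at hj
        omega
      simp [h]⟩, by
    have hV : (0 : ℝ) < Fintype.card V := by exact_mod_cast Fintype.card_pos
    refine ⟨?_, fun j => ?_, fun j => ⟨?_, ?_⟩⟩
    · simp [hV.ne']
    · refine div_le_div_of_nonneg_right (Nat.cast_le.2 (Finset.card_le_card ?_)) hV.le
      intro i hi
      simp only [Finset.mem_filter, Finset.mem_univ, true_and] at hi ⊢
      omega
    · change (0 : ℝ) ≤ _ / _
      positivity
    · change _ / _ ≤ (1 : ℝ)
      rw [div_le_one hV]
      exact_mod_cast Finset.card_le_univ _⟩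

/-- The occupancy process on `[0,T]` of a càdlàg queue-length path, as an element of
`D([0,T], S)`. -/
def occupancyPath {V : Type*} [Fintype V] [Nonempty V] (T : ℝ≥0) (x : ℝ≥0 → V → ℕ)
    (hx : IsCadlag x) : SkorokhodSpace T OccupancySpace :=
  ⟨fun t => occupancy (x t),
    (hx.restrict T).comp (continuous_of_discreteTopology (f := occupancy (V := V)))⟩

/-- A continuous path on `[0,∞)`, restricted to `[0,T]`, as an element of `D([0,T], E)`. -/
def continuousPath {E : Type*} [TopologicalSpace E] (T : ℝ≥0) (q : C(ℝ≥0, E)) :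
    SkorokhodSpace T E :=
  ⟨fun t => q t, isCadlag_of_continuous (q.continuous.comp continuous_subtype_val)⟩

/-! ### Poisson random measures -/

/-- Lebesgue measure on `[0,∞)`. -/
def lebesgue : Measure ℝ≥0 := (volume : Measure ℝ).comap fun t : ℝ≥0 => (t : ℝ)

/-- `M` is a Poisson random measure with intensity `ν`: it is integer-valued, independent on
disjoint sets, and `M B` has the Poisson law of mean `ν B` whenever `ν B < ∞`. -/
structure IsPoissonRandomMeasure {Ω E : Type*} [MeasurableSpace Ω] [MeasurableSpace E]
    (M : Ω → Measure E) (ν : Measure E) (μ : Measure Ω) : Prop where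
  measurable : Measurable M
  integer_valued : ∀ ω B, MeasurableSet B → ∃ k : ℕ∞, M ω B = (k : ℝ≥0∞)
  map_eq : ∀ B, MeasurableSet B → ν B ≠ ∞ →
    μ.map (fun ω => M ω B) =
      (poissonMeasure (ν B).toNNReal).map (fun k : ℕ => (k : ℝ≥0∞))
  indep : ∀ B : ℕ → Set E, (∀ k, MeasurableSet (B k)) → Pairwise (Function.onFun Disjoint B) →
    iIndepFun (fun k ω => M ω (B k)) μ

/-! ### The JSQ(d) policy on a graph -/

section Policy

variable {V : Type*} [Fintype V] [DecidableEq V]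

/-- The probability that a task goes to server `i` when the set `P` of servers is probed and the
queue lengths are `x`: the shortest probed queue is chosen, ties being broken uniformly. -/
def winProb (P : Finset V) (x : V → ℕ) (i : V) : ℝ :=
  if i ∈ P ∧ ∀ k ∈ P, x i ≤ x k then 1 / ((P.filter fun k => x k = x i).card : ℝ) else 0

/-- The mean number of tasks sent to server `i` per task arriving at server `j`, when the queue
lengths are `x`. If `j` has at least `d - 1` neighbours then `j` and a uniformly random set of
`d - 1` neighbours of `j` are probed; otherwise an arbitrary rule is used among `j` and its
neighbours. -/
def assignProb (G : SimpleGraph V) [DecidableRel G.Adj] (d : ℕ)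
    (rule : V → V → (V → ℕ) → ℝ) (j i : V) (x : V → ℕ) : ℝ :=
  if d - 1 ≤ G.degree j then
    (∑ A ∈ (G.neighborFinset j).powersetCard (d - 1), winProb (insert j A) x i) /
      ((G.degree j).choose (d - 1) : ℝ)
  else if i = j ∨ G.Adj j i then rule j i x else 0

/-- The total arrival rate at server `i`, relative to `lam`, when the queue lengths are `x`. -/
def arrivalIntensity (G : SimpleGraph V) [DecidableRel G.Adj] (d : ℕ)
    (rule : V → V → (V → ℕ) → ℝ) (i : V) (x : V → ℕ) : ℝ :=
  ∑ j, assignProb G d rule j i x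

/-- `X` is the queue-length process of the JSQ(`d`) policy on `G` with arrival rate `lam`: the
càdlàg `ℱ`-adapted solution of
`X_i(t) = X_i(0) - ∫_{[0,t]} 1{X_i(s-) > 0} D_i(ds) + ∫_{[0,t]×ℝ₊} 1{y ≤ C_i(s-)} A_i(ds dy)`
driven by independent Poisson processes `D_i` of rate `1` and independent Poisson random measures
`A_i` with intensity `lam ds dy`, relative to the filtration `ℱ` (the noise up to time `t` is
`ℱ t`-measurable, the noise after time `t` is independent of `ℱ t`; in particular `X(0)` is
independent of the noise). -/
structure IsJSQProcess (G : SimpleGraph V) [DecidableRel G.Adj] (lam : ℝ≥0) (d : ℕ)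
    (rule : V → V → (V → ℕ) → ℝ) {Ω : Type*} [mΩ : MeasurableSpace Ω] (μ : Measure Ω)
    (ℱ : Filtration ℝ≥0 mΩ) (D : V → Ω → Measure ℝ≥0) (A : V → Ω → Measure (ℝ≥0 × ℝ≥0))
    (X : ℝ≥0 → Ω → V → ℕ) : Prop where
  departures : ∀ i, IsPoissonRandomMeasure (D i) lebesgue μ
  arrivals : ∀ i, IsPoissonRandomMeasure (A i) (lam • lebesgue.prod lebesgue) μ
  indep_departures : iIndepFun D μ
  indep_arrivals : iIndepFun A μ
  indep_departures_arrivals : IndepFun (fun ω i => D i ω) (fun ω i => A i ω) μ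
  adapted_departures : ∀ t i, Measurable[ℱ t] fun ω => (D i ω).restrict (Iic t)
  adapted_arrivals : ∀ t i, Measurable[ℱ t] fun ω => (A i ω).restrict (Iic t ×ˢ univ)
  indep_future : ∀ t, Indep (ℱ t)
    (MeasurableSpace.comap
      (fun ω => (fun i => (D i ω).restrict (Ioi t), fun i => (A i ω).restrict (Ioi t ×ˢ univ)))
      (inferInstance : MeasurableSpace ((V → Measure ℝ≥0) × (V → Measure (ℝ≥0 × ℝ≥0))))) μ
  adapted : ∀ t, Measurable[ℱ t] (X t)
  cadlag : ∀ ω, IsCadlag fun t => X t ω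
  evolution : ∀ᵐ ω ∂μ, ∀ t i,
    (X t ω i : ℝ) = X 0 ω i
      - (D i ω).real {s | s ≤ t ∧ 0 < Function.leftLim (fun r => X r ω) s i}
      + (A i ω).real {p | p.1 ≤ t ∧
          (p.2 : ℝ) ≤ arrivalIntensity G d rule i (Function.leftLim (fun r => X r ω) p.1)}

end Policy

end

end JSQ

/-! The arrival rate at a server depends on the other queues only through averages over
neighbourhoods. The proof therefore controls all weighted fractions `tailMass w m (X t)` at once. A
weight `w` is spread (`IsSpreadWeight`) if it is nonnegative, has total mass close to 1 and a small
sum of squares. The claim is that `E |tailMass w m (X t) - q_m(t)|` is small uniformly in `m` and in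
spread `w`. Large degrees and near-regularity make the neighbourhood weights `outWeight` and
`inWeight` spread, and also the uniform weight `1/N`, whose tail masses are the occupancy state. No
independence between servers is needed at positive times.

Three estimates close the argument. At time 0 and for the compensated Poisson noise, independence
bounds the variance by a multiple of the sum of the `w i ^ 2`. For the drift, an auxiliary uniform
mark for breaking ties turns the winning probability into an integral of products
(`winProb_eq_integral`). Sampling without replacement from a large neighbourhood is almost sampling
with replacement (`abs_subsetAvg_sub_pow_le`), so the intensity differs from its mean-field value
only by errors of neighbourhood averages, that is, by errors of other spread weights. The identity
`sub_mul_limitIntensity` then produces the difference of `d`-th powers in the limit equation. Hence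
the worst error over spread weights obeys a Gronwall inequality whose rate `growthRate` does not
depend on the graph.

Stochastic calculus is replaced by a time grid of mesh `h`. In each cell the queue lengths are
frozen at the left end; this is exact unless the cell contains two driving points, which costs order
`(N h)^2` per cell and `N^2 h` in total. It disappears as `h → 0` with the graph fixed.

Convergence in `ℓ¹` at a fixed time follows by truncation, since a queue is at most its initial
length plus a Poisson number of arrivals. A second, fixed grid makes the convergence uniform on
`[0,T]`, because the path moves in a cell by at most the number of driving points divided by `N`.
Uniform distance dominates the Skorokhod distance, and convergence in probability to a constant path
gives weak convergence. The limit equation is solved by a monotone Picard iteration, and uniqueness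
is an iterated Lipschitz estimate. Measurability of the random path in the Skorokhod space comes
from approximation by step paths. -/

namespace JSQ

/-! ### Sampling without replacement -/

section Sampling

set_option linter.unusedSectionVars false

variable {α : Type*} [DecidableEq α]

/-- Serves twice: to draw a random subset one point at a time, and to condition a probed set on
containing a given server. -/
theorem sum_powersetCard_succ_filter_mem {M : Type*} [AddCommMonoid M] (S : Finset α) {i : α}
    (hi : i ∈ S) (r : ℕ) (g : Finset α → M) :
    ∑ A ∈ (S.powersetCard (r + 1)).filter (fun A => i ∈ A), g A
      = ∑ A ∈ (S.erase i).powersetCard r, g (insert i A) := by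
  have hS : insert i (S.erase i) = S := Finset.insert_erase hi
  conv_lhs => rw [← hS]
  rw [Finset.powersetCard_succ_insert (Finset.notMem_erase i S), Finset.filter_union,
    Finset.filter_eq_empty_iff.2, Finset.empty_union, Finset.filter_true_of_mem,
    Finset.sum_image]
  · intro A hA B hB h
    have hA' : i ∉ A := fun h' => by
      simpa using (Finset.mem_powersetCard.1 hA).1 h'
    have hB' : i ∉ B := fun h' => by
      simpa using (Finset.mem_powersetCard.1 hB).1 h'
    rw [← Finset.erase_insert hA', ← Finset.erase_insert hB', h]
  · intro A hA
    obtain ⟨B, -, rfl⟩ := Finset.mem_image.1 hA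
    exact Finset.mem_insert_self _ _
  · intro A hA h'
    simpa using (Finset.mem_powersetCard.1 hA).1 h'

/-- The average over the `r`-element subsets of `S` of the product of `f`. -/
noncomputable def subsetAvg (r : ℕ) (S : Finset α) (f : α → ℝ) : ℝ :=
  (∑ A ∈ S.powersetCard r, ∏ k ∈ A, f k) / (S.card.choose r : ℝ)

theorem subsetAvg_nonneg (r : ℕ) (S : Finset α) {f : α → ℝ} (hf : ∀ k, 0 ≤ f k) :
    0 ≤ subsetAvg r S f :=
  div_nonneg (Finset.sum_nonneg fun _ _ => Finset.prod_nonneg fun k _ => hf k) (Nat.cast_nonneg _)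

theorem subsetAvg_le_one (r : ℕ) (S : Finset α) {f : α → ℝ} (hf : ∀ k, 0 ≤ f k)
    (hf1 : ∀ k, f k ≤ 1) : subsetAvg r S f ≤ 1 := by
  refine div_le_one_of_le₀ ?_ (Nat.cast_nonneg _)
  refine (Finset.sum_le_card_nsmul _ _ 1 fun A _ =>
    Finset.prod_le_one (fun k _ => hf k) fun k _ => hf1 k).trans ?_
  simp

/-- Double counting of pairs `k ∈ A`: a random subset of size `r + 1` is a uniform first point
followed by a random subset of size `r` of the rest. -/
theorem subsetAvg_succ {r : ℕ} {S : Finset α} (hr : r < S.card) (f : α → ℝ) :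
    subsetAvg (r + 1) S f = (∑ k ∈ S, f k * subsetAvg r (S.erase k) f) / S.card := by
  obtain ⟨n, hn⟩ : ∃ n, S.card = n + 1 := ⟨S.card - 1, by omega⟩
  have hrn : r ≤ n := by omega
  have key : ((r : ℝ) + 1) * ∑ A ∈ S.powersetCard (r + 1), ∏ k ∈ A, f k
      = ∑ k ∈ S, f k * ∑ A ∈ (S.erase k).powersetCard r, ∏ j ∈ A, f j := by
    have h1 : ((r : ℝ) + 1) * ∑ A ∈ S.powersetCard (r + 1), ∏ k ∈ A, f k
        = ∑ A ∈ S.powersetCard (r + 1), ∑ k ∈ S, if k ∈ A then ∏ j ∈ A, f j else 0 := by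
      rw [Finset.mul_sum]
      refine Finset.sum_congr rfl fun A hA => ?_
      obtain ⟨hAS, hc⟩ := Finset.mem_powersetCard.1 hA
      rw [← Finset.sum_filter, Finset.filter_mem_eq_inter, Finset.inter_eq_right.2 hAS,
        Finset.sum_const, hc]
      simp
    rw [h1, Finset.sum_comm]
    refine Finset.sum_congr rfl fun k hk => ?_
    rw [← Finset.sum_filter, sum_powersetCard_succ_filter_mem S hk, Finset.mul_sum]
    refine Finset.sum_congr rfl fun A hA => ?_
    rw [Finset.prod_insert]
    intro h'
    simpa using (Finset.mem_powersetCard.1 hA).1 h'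
  have hch : ((n + 1 : ℕ) : ℝ) * (n.choose r : ℝ) = ((n + 1).choose (r + 1) : ℝ) * (r + 1) := by
    exact_mod_cast Nat.add_one_mul_choose_eq n r
  have hpos : (0 : ℝ) < n.choose r := by exact_mod_cast Nat.choose_pos hrn
  have hpos' : (0 : ℝ) < (n + 1).choose (r + 1) := by
    exact_mod_cast Nat.choose_pos (by omega)
  have h2 : ∑ k ∈ S, f k * subsetAvg r (S.erase k) f
      = (∑ k ∈ S, f k * ∑ A ∈ (S.erase k).powersetCard r, ∏ j ∈ A, f j) / (n.choose r : ℝ) := by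
    rw [Finset.sum_div]
    refine Finset.sum_congr rfl fun k hk => ?_
    rw [subsetAvg, Finset.card_erase_of_mem hk, hn, Nat.add_sub_cancel, mul_div_assoc]
  rw [h2, ← key, subsetAvg, hn, div_div, mul_comm (n.choose r : ℝ), hch]
  field_simp

theorem abs_pow_sub_pow_le {a b : ℝ} (ha : 0 ≤ a) (ha1 : a ≤ 1) (hb : 0 ≤ b) (hb1 : b ≤ 1)
    (r : ℕ) : |a ^ r - b ^ r| ≤ r * |a - b| := by
  induction r with
  | zero => simp
  | succ r ih =>
    have h : a ^ (r + 1) - b ^ (r + 1) = a * (a ^ r - b ^ r) + (a - b) * b ^ r := by ring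
    rw [h]
    refine (abs_add_le _ _).trans ?_
    rw [abs_mul, abs_mul, abs_of_nonneg ha, abs_of_nonneg (pow_nonneg hb r)]
    have h1 : a * |a ^ r - b ^ r| ≤ 1 * (r * |a - b|) :=
      mul_le_mul ha1 ih (abs_nonneg _) zero_le_one
    have h2 : |a - b| * b ^ r ≤ |a - b| * 1 :=
      mul_le_mul_of_nonneg_left (pow_le_one₀ hb hb1) (abs_nonneg _)
    push_cast
    linarith

theorem avg_mem_Icc (S : Finset α) {f : α → ℝ} (hf : ∀ k, 0 ≤ f k) (hf1 : ∀ k, f k ≤ 1) :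
    0 ≤ (∑ k ∈ S, f k) / S.card ∧ (∑ k ∈ S, f k) / S.card ≤ 1 :=
  ⟨div_nonneg (Finset.sum_nonneg fun k _ => hf k) (Nat.cast_nonneg _),
    div_le_one_of_le₀ ((Finset.sum_le_card_nsmul _ _ 1 fun k _ => hf1 k).trans (by simp))
      (Nat.cast_nonneg _)⟩

theorem abs_avg_erase_sub_avg_le {S : Finset α} (hS : 2 ≤ S.card) (i : α) {f : α → ℝ}
    (hf : ∀ k, 0 ≤ f k) (hf1 : ∀ k, f k ≤ 1) :
    |(∑ k ∈ S.erase i, f k) / (S.erase i).card - (∑ k ∈ S, f k) / S.card| ≤ 1 / S.card := by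
  by_cases hi : i ∈ S
  · obtain ⟨n, hn⟩ : ∃ n, S.card = n + 1 := ⟨S.card - 1, by omega⟩
    have hn1 : 1 ≤ n := by omega
    have hn0 : (0 : ℝ) < n := by exact_mod_cast hn1
    have hsum : ∑ k ∈ S, f k = ∑ k ∈ S.erase i, f k + f i := (Finset.sum_erase_add S f hi).symm
    have hle : ∑ k ∈ S.erase i, f k ≤ n := by
      refine (Finset.sum_le_card_nsmul _ _ 1 fun k _ => hf1 k).trans ?_
      rw [Finset.card_erase_of_mem hi, hn]
      simp
    have hge : 0 ≤ ∑ k ∈ S.erase i, f k := Finset.sum_nonneg fun k _ => hf k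
    rw [hsum, Finset.card_erase_of_mem hi, hn, Nat.add_sub_cancel]
    set s := ∑ k ∈ S.erase i, f k
    have h : s / (n : ℝ) - (s + f i) / ((n + 1 : ℕ) : ℝ)
        = (s - n * f i) / (n * (n + 1)) := by
      push_cast
      field_simp
      ring
    rw [h, abs_div, abs_of_pos (by positivity : (0 : ℝ) < n * (n + 1)),
      div_le_div_iff₀ (by positivity) (by positivity)]
    have h1 : |s - n * f i| ≤ n := by
      have := mul_le_mul_of_nonneg_left (hf1 i) hn0.le
      have := mul_nonneg hn0.le (hf i)
      rw [abs_le]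
      constructor <;> linarith
    push_cast
    nlinarith
  · rw [Finset.erase_eq_of_notMem hi]
    simp

/-- Induction through `subsetAvg_succ`: removing the first drawn point shifts the mean of `f` by at
most `1 / S.card`, hence its `r`-th power by `r / S.card`. The denominator is unchanged when `r` and
the size of `S` both drop by one, so the numerators simply add up. -/
theorem abs_subsetAvg_sub_pow_le (r : ℕ) : ∀ (S : Finset α), r ≤ S.card → ∀ {f : α → ℝ},
    (∀ k, 0 ≤ f k) → (∀ k, f k ≤ 1) →
    |subsetAvg r S f - ((∑ k ∈ S, f k) / S.card) ^ r| ≤ r * (r - 1) / (S.card - r + 1) := by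
  induction r with
  | zero => intro S _ f _ _; simp [subsetAvg]
  | succ r ih =>
    intro S hS f hf hf1
    obtain ⟨n, hn⟩ : ∃ n, S.card = n + 1 := ⟨S.card - 1, by omega⟩
    have hrn : (r : ℝ) ≤ n := by exact_mod_cast (by omega : r ≤ n)
    have hc : (0 : ℝ) < S.card := by rw [hn]; positivity
    rcases Nat.eq_zero_or_pos r with rfl | hr
    · simp [subsetAvg, Finset.powersetCard_one]
    have hr1 : (1 : ℝ) ≤ r := by exact_mod_cast hr
    obtain ⟨ha0, ha1⟩ := avg_mem_Icc S hf hf1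
    set a := (∑ k ∈ S, f k) / S.card with ha
    have hrw : subsetAvg (r + 1) S f - a ^ (r + 1)
        = (∑ k ∈ S, f k * (subsetAvg r (S.erase k) f - a ^ r)) / S.card := by
      rw [subsetAvg_succ (by omega), pow_succ']
      simp only [mul_sub, Finset.sum_sub_distrib, ← Finset.sum_mul, sub_div]
      rw [ha]
      ring
    have hden : (0 : ℝ) < (n : ℝ) - r + 1 := by linarith
    have hterm : ∀ k ∈ S, |f k * (subsetAvg r (S.erase k) f - a ^ r)|
        ≤ (r + 1) * r / (n - r + 1) := by
      intro k hk
      rw [abs_mul, abs_of_nonneg (hf k)]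
      have hck : (S.erase k).card = n := by rw [Finset.card_erase_of_mem hk, hn]; rfl
      obtain ⟨hb0, hb1⟩ := avg_mem_Icc (S.erase k) hf hf1
      have h1 := ih (S.erase k) (by omega) hf hf1
      have h2 := abs_pow_sub_pow_le hb0 hb1 ha0 ha1 r
      have h3 := abs_avg_erase_sub_avg_le (by omega) k hf hf1 (S := S)
      have h4 : (r : ℝ) * (1 / S.card) ≤ r * (1 / (n - r + 1)) := by
        refine mul_le_mul_of_nonneg_left (one_div_le_one_div_of_le hden ?_) (by positivity)
        rw [hn]; push_cast; linarith
      rw [hck] at h1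
      have h5 : |subsetAvg r (S.erase k) f - a ^ r| ≤ (r + 1) * r / (n - r + 1) := by
        calc _ ≤ _ := abs_sub_le _ (((∑ k ∈ S.erase k, f k) / (n : ℝ)) ^ r) _
          _ ≤ r * (r - 1) / (n - r + 1) + r * (1 / (n - r + 1)) := by
            refine add_le_add h1 ?_
            rw [hck] at h2 h3
            exact h2.trans ((mul_le_mul_of_nonneg_left h3 (by positivity)).trans h4)
          _ = r * r / (n - r + 1) := by ring
          _ ≤ _ := by gcongr; linarith
      calc f k * |subsetAvg r (S.erase k) f - a ^ r|
          ≤ 1 * ((r + 1) * r / (n - r + 1)) :=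
            mul_le_mul (hf1 k) h5 (abs_nonneg _) zero_le_one
        _ = _ := one_mul _
    rw [hrw, abs_div, abs_of_pos hc, div_le_iff₀ hc]
    refine (Finset.abs_sum_le_sum_abs _ _).trans ((Finset.sum_le_card_nsmul _ _ _ hterm).trans ?_)
    rw [nsmul_eq_mul, hn]
    push_cast
    apply le_of_eq
    have : (n : ℝ) + 1 - (r + 1) + 1 = n - r + 1 := by ring
    rw [this]
    ring

/-- Sampling without replacement from `S` or from `S` minus one point, compared with a product. -/
theorem abs_subsetAvg_erase_sub_pow_le {r : ℕ} {S : Finset α} (hS : 2 * (r + 1) ≤ S.card) (i : α)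
    {f : α → ℝ} (hf : ∀ k, 0 ≤ f k) (hf1 : ∀ k, f k ≤ 1) {c : ℝ} (hc : 0 ≤ c) (hc1 : c ≤ 1) :
    |subsetAvg r (S.erase i) f - c ^ r|
      ≤ r * |(∑ k ∈ S, f k) / S.card - c| + 3 * r ^ 2 / S.card := by
  have hcard : S.card - 1 ≤ (S.erase i).card := Finset.pred_card_le_card_erase
  have hcard' : (S.card : ℝ) - 1 ≤ (S.erase i).card := by
    have : S.card ≤ (S.erase i).card + 1 := by omega
    have : (S.card : ℝ) ≤ (S.erase i).card + 1 := by exact_mod_cast this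
    linarith
  have hS' : 2 * ((r : ℝ) + 1) ≤ S.card := by exact_mod_cast hS
  have hc0 : (0 : ℝ) < S.card := by
    have : (0 : ℝ) ≤ r := Nat.cast_nonneg r
    linarith
  obtain ⟨hb0, hb1⟩ := avg_mem_Icc (S.erase i) hf hf1
  have h1 := abs_subsetAvg_sub_pow_le r (S.erase i) (by omega) hf hf1
  have h2 := abs_pow_sub_pow_le hb0 hb1 hc hc1 r
  have h3 := abs_avg_erase_sub_avg_le (by omega) i hf hf1 (S := S)
  rcases Nat.eq_zero_or_pos r with rfl | hr
  · simp [subsetAvg]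
  have hr1 : (1 : ℝ) ≤ r := by exact_mod_cast hr
  -- The size hypothesis keeps the denominator above half the size of `S`, whether or not `i` lies
  -- in `S`.
  have h4 : (r : ℝ) * (r - 1) / ((S.erase i).card - r + 1) ≤ 2 * r * (r - 1) / S.card := by
    rw [div_le_div_iff₀ (by linarith) hc0]
    have : (0 : ℝ) ≤ r * (r - 1) := mul_nonneg (by linarith) (by linarith)
    nlinarith
  have h5 := abs_sub_le ((∑ k ∈ S.erase i, f k) / ((S.erase i).card : ℝ))
    ((∑ k ∈ S, f k) / (S.card : ℝ)) c
  have h6 := abs_sub_le (subsetAvg r (S.erase i) f)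
    (((∑ k ∈ S.erase i, f k) / ((S.erase i).card : ℝ)) ^ r) (c ^ r)
  have h7 : (r : ℝ) * |(∑ k ∈ S.erase i, f k) / ((S.erase i).card : ℝ) - c|
      ≤ r * (1 / S.card + |(∑ k ∈ S, f k) / S.card - c|) :=
    mul_le_mul_of_nonneg_left (by linarith) (by linarith)
  have h8 : 2 * r * (r - 1) / S.card + r * (1 / S.card) ≤ 3 * (r : ℝ) ^ 2 / S.card := by
    rw [mul_one_div, ← add_div]
    gcongr
    nlinarith
  linarith

end Sampling

end JSQ

namespace JSQ

/-! ### The arrival intensity in terms of local averages -/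

section Intensity

set_option linter.unusedSectionVars false

/-- The factor contributed by a competitor of queue length `y` to the event that a server of queue
length `m` wins, when ties are broken by independent uniform marks and `u` is the winning mark. -/
noncomputable def tieWeight (m : ℕ) (u : ℝ) (y : ℕ) : ℝ :=
  (1 - u) * (if m + 1 ≤ y then 1 else 0) + u * (if m ≤ y then 1 else 0)

theorem tieWeight_eq (m : ℕ) (u : ℝ) (y : ℕ) :
    tieWeight m u y = if m < y then 1 else if y = m then u else 0 := by
  unfold tieWeight
  rcases lt_trichotomy m y with h | h | h
  · simp [h, h.le, Nat.succ_le_of_lt h]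
  · simp [h]
  · simp [h.not_ge, h.ne, h.le.not_gt, show ¬ m + 1 ≤ y by omega]

theorem tieWeight_nonneg {m : ℕ} {u : ℝ} (hu : u ∈ Icc (0 : ℝ) 1) (y : ℕ) :
    0 ≤ tieWeight m u y := by
  rw [tieWeight_eq]
  split_ifs <;> linarith [hu.1, hu.2]

theorem tieWeight_le_one {m : ℕ} {u : ℝ} (hu : u ∈ Icc (0 : ℝ) 1) (y : ℕ) :
    tieWeight m u y ≤ 1 := by
  rw [tieWeight_eq]
  split_ifs <;> linarith [hu.1, hu.2]

theorem continuous_tieWeight (m y : ℕ) : Continuous fun u => tieWeight m u y := by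
  unfold tieWeight
  fun_prop

theorem continuous_subsetAvg {α : Type*} (r : ℕ) (S : Finset α) (m : ℕ) (x : α → ℕ) :
    Continuous fun u => subsetAvg r S fun k => tieWeight m u (x k) :=
  (continuous_finsetSum _ fun _ _ => continuous_finsetProd _ fun k _ =>
    continuous_tieWeight m (x k)).div_const _

variable {V : Type*} [Fintype V]

/-- The weighted fraction of servers with queue length at least `m`. -/
noncomputable def tailMass (w : V → ℝ) (m : ℕ) (x : V → ℕ) : ℝ :=
  ∑ i, w i * (if m ≤ x i then 1 else 0)

theorem sum_mul_tieWeight (w : V → ℝ) (m : ℕ) (u : ℝ) (x : V → ℕ) :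
    ∑ i, w i * tieWeight m u (x i) = (1 - u) * tailMass w (m + 1) x + u * tailMass w m x := by
  simp only [tailMass, tieWeight, Finset.mul_sum, ← Finset.sum_add_distrib]
  exact Finset.sum_congr rfl fun i _ => by ring

theorem abs_sum_mul_tieWeight_sub_le (w : V → ℝ) (m : ℕ) {u : ℝ} (hu : u ∈ Icc (0 : ℝ) 1)
    (x : V → ℕ) (a b : ℝ) :
    |∑ i, w i * tieWeight m u (x i) - ((1 - u) * b + u * a)|
      ≤ |tailMass w m x - a| + |tailMass w (m + 1) x - b| := by
  rw [sum_mul_tieWeight]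
  have h : (1 - u) * tailMass w (m + 1) x + u * tailMass w m x - ((1 - u) * b + u * a)
      = u * (tailMass w m x - a) + (1 - u) * (tailMass w (m + 1) x - b) := by ring
  rw [h]
  refine (abs_add_le _ _).trans ?_
  rw [abs_mul, abs_mul, abs_of_nonneg hu.1, abs_of_nonneg (sub_nonneg.2 hu.2)]
  exact add_le_add (mul_le_of_le_one_left (abs_nonneg _) hu.2)
    (mul_le_of_le_one_left (abs_nonneg _) (by linarith [hu.1]))

variable [DecidableEq V]

/-- If `i` ties with `c` competitors, all of them lose against its mark `u` with probability `u ^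
c`, and the integral of `u ^ c` is `1 / (c + 1)`. The gain is that the integrand is a product over
competitors, to which the sampling estimates apply. -/
theorem winProb_eq_integral {P : Finset V} {i : V} (hi : i ∈ P) (x : V → ℕ) :
    winProb P x i = ∫ u in (0 : ℝ)..1, ∏ k ∈ P.erase i, tieWeight (x i) u (x k) := by
  unfold winProb
  by_cases h : ∀ k ∈ P, x i ≤ x k
  · rw [if_pos ⟨hi, h⟩]
    have hprod : ∀ u : ℝ, ∏ k ∈ P.erase i, tieWeight (x i) u (x k)
        = u ^ ((P.erase i).filter fun k => x k = x i).card := by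
      intro u
      rw [← Finset.prod_const, Finset.prod_filter]
      refine Finset.prod_congr rfl fun k hk => ?_
      have hk' := h k (Finset.mem_of_mem_erase hk)
      rw [tieWeight_eq]
      rcases hk'.lt_or_eq with h1 | h1
      · simp [h1, h1.ne']
      · simp [h1]
    simp_rw [hprod]
    have hcard : (P.filter fun k => x k = x i).card
        = ((P.erase i).filter fun k => x k = x i).card + 1 := by
      rw [Finset.filter_erase, Finset.card_erase_add_one]
      simp [hi]
    rw [hcard, integral_pow]
    simp
  · rw [if_neg fun h' => h h'.2]
    push Not at h
    obtain ⟨k, hk, hlt⟩ := h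
    have hki : k ∈ P.erase i := Finset.mem_erase.2 ⟨fun h' => by simp [h'] at hlt, hk⟩
    have hprod : ∀ u : ℝ, ∏ k ∈ P.erase i, tieWeight (x i) u (x k) = 0 := by
      intro u
      refine Finset.prod_eq_zero hki ?_
      rw [tieWeight_eq, if_neg (by omega), if_neg (by omega)]
    simp [hprod]

variable (G : SimpleGraph V) [DecidableRel G.Adj]

/-- Erasing `i`, which is not its own neighbour, changes nothing; it gives this term the form
handled by `abs_subsetAvg_erase_sub_pow_le`. -/
theorem assignProb_self {e : ℕ} {rule : V → V → (V → ℕ) → ℝ} {i : V} (hi : e + 1 ≤ G.degree i)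
    (x : V → ℕ) :
    assignProb G (e + 2) rule i i x = ∫ u in (0 : ℝ)..1,
      subsetAvg (e + 1) ((G.neighborFinset i).erase i) fun k => tieWeight (x i) u (x k) := by
  have hni : i ∉ G.neighborFinset i := by simp
  simp only [assignProb, subsetAvg, show e + 2 - 1 = e + 1 by omega, if_pos hi,
    Finset.erase_eq_of_notMem hni, G.card_neighborFinset_eq_degree]
  rw [intervalIntegral.integral_div, intervalIntegral.integral_finsetSum]
  · congr 1
    refine Finset.sum_congr rfl fun A hA => ?_
    have hiA : i ∉ A := fun h => hni ((Finset.mem_powersetCard.1 hA).1 h)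
    rw [winProb_eq_integral (Finset.mem_insert_self _ _), Finset.erase_insert hiA]
  · intro A _
    exact (continuous_finsetProd _ fun k _ =>
      continuous_tieWeight (x i) (x k)).intervalIntegrable _ _

/-- With `d = e + 2`, a task at `j` probes `e + 1` neighbours and hits `i` with probability `(e + 1)
/ deg j`. The other `e` probes are then uniform among the remaining neighbours, and `j` itself is
one more competitor. -/
theorem assignProb_of_adj {e : ℕ} {rule : V → V → (V → ℕ) → ℝ} {i j : V}
    (hj : e + 1 ≤ G.degree j) (hij : G.Adj i j) (x : V → ℕ) :
    assignProb G (e + 2) rule j i x = ∫ u in (0 : ℝ)..1,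
      (e + 1) / G.degree j * (tieWeight (x i) u (x j) *
        subsetAvg e ((G.neighborFinset j).erase i) fun k => tieWeight (x i) u (x k)) := by
  have hi : i ∈ G.neighborFinset j := by simpa using hij.symm
  have hne : i ≠ j := hij.ne
  obtain ⟨n, hn⟩ : ∃ n, G.degree j = n + 1 := ⟨G.degree j - 1, by omega⟩
  have hzero : ∀ A ∈ (G.neighborFinset j).powersetCard (e + 1), winProb (insert j A) x i ≠ 0 →
      i ∈ A := by
    intro A _ h
    by_contra hiA
    refine h (if_neg fun h' => ?_)
    rcases Finset.mem_insert.1 h'.1 with h1 | h1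
    exacts [hne h1, hiA h1]
  simp only [assignProb, subsetAvg, show e + 2 - 1 = e + 1 by omega, if_pos hj]
  rw [← Finset.sum_filter_of_ne hzero, sum_powersetCard_succ_filter_mem _ hi,
    Finset.card_erase_of_mem hi, G.card_neighborFinset_eq_degree, hn, Nat.add_sub_cancel,
    intervalIntegral.integral_const_mul]
  have hch : ((n + 1 : ℕ) : ℝ) * (n.choose e : ℝ) = ((n + 1).choose (e + 1) : ℝ) * (e + 1) := by
    exact_mod_cast Nat.add_one_mul_choose_eq n e
  have hpos : (0 : ℝ) < n.choose e := by exact_mod_cast Nat.choose_pos (by omega)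
  have hpos' : (0 : ℝ) < (n + 1).choose (e + 1) := by
    exact_mod_cast Nat.choose_pos (by omega)
  have hint : ∫ u in (0 : ℝ)..1, tieWeight (x i) u (x j) *
        ((∑ A ∈ ((G.neighborFinset j).erase i).powersetCard e, ∏ k ∈ A,
          tieWeight (x i) u (x k)) / (n.choose e : ℝ))
      = (∑ A ∈ ((G.neighborFinset j).erase i).powersetCard e,
          winProb (insert j (insert i A)) x i) / (n.choose e : ℝ) := by
    simp_rw [← mul_div_assoc, Finset.mul_sum]
    rw [intervalIntegral.integral_div, intervalIntegral.integral_finsetSum]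
    · congr 1
      refine Finset.sum_congr rfl fun A hA => ?_
      have hAs := (Finset.mem_powersetCard.1 hA).1
      have hiA : i ∉ A := fun h => by simpa using hAs h
      have hjA : j ∉ A := fun h => by simpa using hAs h
      rw [winProb_eq_integral (by simp)]
      refine intervalIntegral.integral_congr fun u _ => ?_
      have : (insert j (insert i A)).erase i = insert j A := by
        rw [Finset.insert_comm, Finset.erase_insert]
        simp [hiA, hne]
      simp only [this]
      rw [Finset.prod_insert hjA]
    · intro A _
      exact ((continuous_tieWeight _ _).mul (continuous_finsetProd _ fun k _ =>
        continuous_tieWeight (x i) (x k))).intervalIntegrable _ _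
  rw [hint]
  field_simp
  rw [mul_assoc, hch]
  ring

theorem assignProb_of_not_adj {e : ℕ} {rule : V → V → (V → ℕ) → ℝ} {i j : V}
    (hj : e + 1 ≤ G.degree j) (hij : ¬ G.Adj i j) (hne : i ≠ j) (x : V → ℕ) :
    assignProb G (e + 2) rule j i x = 0 := by
  simp only [assignProb, show e + 2 - 1 = e + 1 by omega, if_pos hj]
  rw [Finset.sum_eq_zero, zero_div]
  intro A hA
  refine if_neg fun h' => ?_
  rcases Finset.mem_insert.1 h'.1 with h1 | h1
  · exact hne h1
  · have := (Finset.mem_powersetCard.1 hA).1 h1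
    rw [SimpleGraph.mem_neighborFinset] at this
    exact hij this.symm

/-- The integrand in the representation of the arrival intensity as an integral over the tie-breaking
mark. -/
noncomputable def intensityIntegrand (e : ℕ) (i : V) (x : V → ℕ) (u : ℝ) : ℝ :=
  (subsetAvg (e + 1) ((G.neighborFinset i).erase i) fun k => tieWeight (x i) u (x k)) +
    ∑ j, if G.Adj j i then (e + 1) / (G.degree j : ℝ) * (tieWeight (x i) u (x j) *
      subsetAvg e ((G.neighborFinset j).erase i) fun k => tieWeight (x i) u (x k)) else 0

theorem continuous_intensityIntegrand (e : ℕ) (i : V) (x : V → ℕ) :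
    Continuous (intensityIntegrand G e i x) := by
  refine (continuous_subsetAvg _ _ _ _).add (continuous_finsetSum _ fun j _ => ?_)
  split_ifs
  · exact ((continuous_tieWeight _ _).mul (continuous_subsetAvg _ _ _ _)).const_mul _
  · exact continuous_const

theorem arrivalIntensity_eq_integral {e : ℕ} {rule : V → V → (V → ℕ) → ℝ}
    (hG : ∀ j, e + 1 ≤ G.degree j) (i : V) (x : V → ℕ) :
    arrivalIntensity G (e + 2) rule i x = ∫ u in (0 : ℝ)..1, intensityIntegrand G e i x u := by
  unfold intensityIntegrand arrivalIntensity
  have hterm : ∀ j, Continuous fun u => if G.Adj j i then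
      (e + 1) / (G.degree j : ℝ) * (tieWeight (x i) u (x j) *
      subsetAvg e ((G.neighborFinset j).erase i) fun k => tieWeight (x i) u (x k)) else 0 := by
    intro j
    split_ifs
    · exact ((continuous_tieWeight _ _).mul (continuous_subsetAvg _ _ _ _)).const_mul _
    · exact continuous_const
  rw [intervalIntegral.integral_add ((continuous_subsetAvg _ _ _ _).intervalIntegrable _ _)
    ((continuous_finsetSum _ fun j _ => hterm j).intervalIntegrable _ _),
    intervalIntegral.integral_finsetSum fun j _ => (hterm j).intervalIntegrable _ _,
    ← assignProb_self G (rule := rule) (hG i), ← Finset.add_sum_erase _ _ (Finset.mem_univ i),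
    ← Finset.add_sum_erase _ (fun j => ∫ u in (0 : ℝ)..1, _) (Finset.mem_univ i)]
  simp only [SimpleGraph.irrefl, if_false, intervalIntegral.integral_zero, zero_add]
  congr 1
  refine Finset.sum_congr rfl fun j hj => ?_
  have hne : i ≠ j := (Finset.ne_of_mem_erase hj).symm
  by_cases h : G.Adj j i
  · simp only [if_pos h]
    exact assignProb_of_adj G (hG j) h.symm x
  · simp only [if_neg h, intervalIntegral.integral_zero]
    exact assignProb_of_not_adj G (hG j) (fun h' => h h'.symm) hne x

theorem intensityIntegrand_mem_Icc (e : ℕ) (i : V) (x : V → ℕ) {u : ℝ} (hu : u ∈ Icc (0 : ℝ) 1) :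
    intensityIntegrand G e i x u ∈ Icc 0
      (1 + (e + 1) * ∑ j, if G.Adj j i then 1 / (G.degree j : ℝ) else 0) := by
  have h0 : ∀ k, 0 ≤ tieWeight (x i) u (x k) := fun k => tieWeight_nonneg hu _
  have h1 : ∀ k, tieWeight (x i) u (x k) ≤ 1 := fun k => tieWeight_le_one hu _
  unfold intensityIntegrand
  constructor
  · refine add_nonneg (subsetAvg_nonneg _ _ h0) (Finset.sum_nonneg fun j _ => ?_)
    split_ifs
    · exact mul_nonneg (by positivity) (mul_nonneg (h0 j) (subsetAvg_nonneg _ _ h0))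
    · exact le_rfl
  · refine add_le_add (subsetAvg_le_one _ _ h0 h1) ?_
    rw [Finset.mul_sum]
    refine Finset.sum_le_sum fun j _ => ?_
    split_ifs
    · rw [mul_one_div]
      exact mul_le_of_le_one_right (by positivity)
        (mul_le_one₀ (h1 j) (subsetAvg_nonneg _ _ h0) (subsetAvg_le_one _ _ h0 h1))
    · simp

/-- A bound uniform in the state: only arrival points below this level can ever be used. -/
theorem arrivalIntensity_mem_Icc {e : ℕ} {rule : V → V → (V → ℕ) → ℝ}
    (hG : ∀ j, e + 1 ≤ G.degree j) (i : V) (x : V → ℕ) :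
    arrivalIntensity G (e + 2) rule i x ∈ Icc 0
      (1 + (e + 1) * ∑ j, if G.Adj j i then 1 / (G.degree j : ℝ) else 0) := by
  rw [arrivalIntensity_eq_integral G hG]
  constructor
  · exact intervalIntegral.integral_nonneg zero_le_one fun u hu =>
      (intensityIntegrand_mem_Icc G e i x hu).1
  · have := intervalIntegral.integral_mono_on (μ := volume) zero_le_one
      ((continuous_intensityIntegrand G e i x).intervalIntegrable _ _)
      (continuous_const.intervalIntegrable _ _)
      fun u hu => (intensityIntegrand_mem_Icc G e i x hu).2
    simpa using this

/-- Weights averaging over the neighbours of `i`. -/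
noncomputable def outWeight (i j : V) : ℝ := if G.Adj i j then 1 / (G.degree i : ℝ) else 0

/-- Weights over the neighbours `j` of `i`, each with the reciprocal of its own degree. -/
noncomputable def inWeight (i j : V) : ℝ := if G.Adj j i then 1 / (G.degree j : ℝ) else 0

/-- The deviation of the weighted fractions at levels `m` and `m + 1` from `a` and `b`. -/
noncomputable def tailErr (w : V → ℝ) (m : ℕ) (a b : ℝ) (x : V → ℕ) : ℝ :=
  |tailMass w m x - a| + |tailMass w (m + 1) x - b|

theorem tailErr_nonneg (w : V → ℝ) (m : ℕ) (a b : ℝ) (x : V → ℕ) : 0 ≤ tailErr w m a b x := by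
  unfold tailErr; positivity

theorem sum_neighborFinset_div (f : V → ℝ) (i : V) :
    (∑ k ∈ G.neighborFinset i, f k) / (G.neighborFinset i).card = ∑ k, outWeight G i k * f k := by
  rw [SimpleGraph.card_neighborFinset_eq_degree, Finset.sum_div]
  simp only [outWeight, ite_mul, zero_mul]
  rw [← Finset.sum_filter, SimpleGraph.neighborFinset_eq_filter]
  exact Finset.sum_congr rfl fun k _ => by ring

/-- The arrival intensity that a server of queue length `m` would see in the mean-field limit, when
the fractions of queues of length at least `m` and `m + 1` are `a` and `b`. -/
noncomputable def limitIntensity (e : ℕ) (a b : ℝ) : ℝ :=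
  ∫ u in (0 : ℝ)..1, (e + 2 : ℝ) * ((1 - u) * b + u * a) ^ (e + 1)

/-- The fundamental theorem of calculus along the segment from `b` to `a`. Here `a - b` is the
fraction of queues of length exactly `m`, and `limitIntensity` is the rate that each of them sees.
-/
theorem sub_mul_limitIntensity (e : ℕ) (a b : ℝ) :
    (a - b) * limitIntensity e a b = a ^ (e + 2) - b ^ (e + 2) := by
  unfold limitIntensity
  rw [← intervalIntegral.integral_const_mul]
  have hderiv : ∀ u ∈ uIcc (0 : ℝ) 1, HasDerivAt (fun u : ℝ => ((1 - u) * b + u * a) ^ (e + 2))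
      ((a - b) * ((e + 2 : ℝ) * ((1 - u) * b + u * a) ^ (e + 1))) u := by
    intro u _
    have h1 : HasDerivAt (fun u : ℝ => (1 - u) * b + u * a) (a - b) u := by
      have := (((hasDerivAt_id u).const_sub 1).mul_const b).add ((hasDerivAt_id u).mul_const a)
      convert! this using 1
      ring
    convert! h1.pow (e + 2) using 1
    push_cast [show e + 2 - 1 = e + 1 by omega]
    ring
  rw [intervalIntegral.integral_eq_sub_of_hasDerivAt hderiv
    ((by fun_prop : Continuous fun u : ℝ => (a - b) * ((e + 2 : ℝ) *
      ((1 - u) * b + u * a) ^ (e + 1))).intervalIntegrable _ _)]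
  simp

theorem convexComb_mem_Icc {a b u : ℝ} (ha : a ∈ Icc (0 : ℝ) 1) (hb : b ∈ Icc (0 : ℝ) 1)
    (hu : u ∈ Icc (0 : ℝ) 1) : (1 - u) * b + u * a ∈ Icc (0 : ℝ) 1 :=
  (convex_Icc (0 : ℝ) 1) hb ha (sub_nonneg.2 hu.2) hu.1 (by ring)

theorem abs_limitIntensity_le (e : ℕ) {a b : ℝ} (ha : a ∈ Icc (0 : ℝ) 1) (hb : b ∈ Icc (0 : ℝ) 1) :
    |limitIntensity e a b| ≤ e + 2 := by
  have := intervalIntegral.norm_integral_le_of_norm_le_const (a := 0) (b := 1) (C := (e + 2 : ℝ))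
    (f := fun u => (e + 2 : ℝ) * ((1 - u) * b + u * a) ^ (e + 1)) fun u hu => by
      rw [uIoc_of_le zero_le_one] at hu
      obtain ⟨h0, h1⟩ := convexComb_mem_Icc ha hb ⟨hu.1.le, hu.2⟩
      rw [Real.norm_of_nonneg (by positivity)]
      exact mul_le_of_le_one_right (by positivity) (pow_le_one₀ h0 h1)
  simpa [limitIntensity] using this

/-- A deterministic estimate, valid for each state and each mark `u`. The error involves the
neighbours of `i` and, through the probes made by a neighbour `j`, the neighbours of `j`; this is
why weights other than the uniform one must be followed. -/
theorem abs_arrivalIntensity_sub_limitIntensity_le {e : ℕ} {rule : V → V → (V → ℕ) → ℝ} {δ : ℝ}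
    (hδ : 0 < δ) (hG : ∀ j, 2 * (e + 2) ≤ G.degree j) (hGδ : ∀ j, δ ≤ G.degree j) (i : V)
    (hin : ∑ j, inWeight G i j ≤ 2) (x : V → ℕ) {m : ℕ} (hm : x i = m) {a b : ℝ}
    (ha : a ∈ Icc (0 : ℝ) 1) (hb : b ∈ Icc (0 : ℝ) 1) :
    |arrivalIntensity G (e + 2) rule i x - limitIntensity e a b|
      ≤ (e + 1) * (tailErr (outWeight G i) m a b x + tailErr (inWeight G i) m a b x)
        + (e + 1) ^ 2 * ∑ j, inWeight G i j * tailErr (outWeight G j) m a b x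
        + 9 * (e + 1) ^ 3 / δ := by
  subst hm
  rw [arrivalIntensity_eq_integral G (fun j => by have := hG j; omega), limitIntensity,
    ← intervalIntegral.integral_sub
      ((continuous_intensityIntegrand G e i x).intervalIntegrable _ _)
      ((by fun_prop : Continuous fun u : ℝ => (e + 2 : ℝ) *
        ((1 - u) * b + u * a) ^ (e + 1)).intervalIntegrable _ _), ← Real.norm_eq_abs]
  refine (intervalIntegral.norm_integral_le_of_norm_le_const (a := 0) (b := 1) fun u hu => ?_).trans
    (by rw [sub_zero, abs_one, mul_one])
  rw [uIoc_of_le zero_le_one] at hu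
  have hu' : u ∈ Icc (0 : ℝ) 1 := ⟨hu.1.le, hu.2⟩
  have hφ := convexComb_mem_Icc ha hb hu'
  have hdev := fun w : V → ℝ => abs_sum_mul_tieWeight_sub_le w (x i) hu' x a b
  set φ := (1 - u) * b + u * a
  have h0 : ∀ k, 0 ≤ tieWeight (x i) u (x k) := fun k => tieWeight_nonneg hu' _
  have h1 : ∀ k, tieWeight (x i) u (x k) ≤ 1 := fun k => tieWeight_le_one hu' _
  have hsamp : ∀ r ≤ e + 1, ∀ j, |(subsetAvg r ((G.neighborFinset j).erase i)
      fun k => tieWeight (x i) u (x k)) - φ ^ r|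
      ≤ (e + 1) * tailErr (outWeight G j) (x i) a b x + 3 * (e + 1) ^ 2 / δ := by
    intro r hr j
    have hr' : (r : ℝ) ≤ e + 1 := by exact_mod_cast hr
    have hcard := hG j
    have h2 := abs_subsetAvg_erase_sub_pow_le (r := r) (S := G.neighborFinset j)
      (by rw [G.card_neighborFinset_eq_degree]; omega) i h0 h1 hφ.1 hφ.2
    rw [sum_neighborFinset_div] at h2
    refine h2.trans (add_le_add (mul_le_mul hr' (hdev _) (abs_nonneg _) (by positivity)) ?_)
    rw [G.card_neighborFinset_eq_degree]
    have := hGδ j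
    gcongr
  -- The main terms are `φ ^ (e + 1)` from tasks arriving at `i` and `(e + 1) * φ * φ ^ e` from
  -- tasks arriving at its neighbours, where one factor `φ` is the competitor `j` and `φ ^ e` its
  -- other probes.
  have hsplit : intensityIntegrand G e i x u - (e + 2 : ℝ) * φ ^ (e + 1)
      = ((subsetAvg (e + 1) ((G.neighborFinset i).erase i) fun k => tieWeight (x i) u (x k))
          - φ ^ (e + 1))
        + (e + 1) * (∑ j, inWeight G i j * tieWeight (x i) u (x j) - φ) * φ ^ e
        + (e + 1) * ∑ j, inWeight G i j * (tieWeight (x i) u (x j) *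
          ((subsetAvg e ((G.neighborFinset j).erase i) fun k => tieWeight (x i) u (x k))
            - φ ^ e)) := by
    have : intensityIntegrand G e i x u
        = (subsetAvg (e + 1) ((G.neighborFinset i).erase i) fun k => tieWeight (x i) u (x k))
          + (e + 1) * ∑ j, inWeight G i j * (tieWeight (x i) u (x j) *
            subsetAvg e ((G.neighborFinset j).erase i) fun k => tieWeight (x i) u (x k)) := by
      unfold intensityIntegrand inWeight
      rw [Finset.mul_sum]
      congr 1
      refine Finset.sum_congr rfl fun j _ => ?_
      split_ifs <;> ring
    rw [this]
    simp only [mul_sub, Finset.sum_sub_distrib, ← mul_assoc, ← Finset.sum_mul]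
    ring
  have hw0 : ∀ j, 0 ≤ inWeight G i j := by
    intro j
    unfold inWeight
    split_ifs <;> positivity
  have hA := hsamp (e + 1) le_rfl i
  have hB : |(e + 1) * (∑ j, inWeight G i j * tieWeight (x i) u (x j) - φ) * φ ^ e|
      ≤ (e + 1) * tailErr (inWeight G i) (x i) a b x := by
    rw [abs_mul, abs_mul, abs_of_nonneg (by positivity : (0 : ℝ) ≤ e + 1),
      abs_of_nonneg (pow_nonneg hφ.1 e)]
    have h2 : (e + 1 : ℝ) * |∑ j, inWeight G i j * tieWeight (x i) u (x j) - φ|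
        ≤ (e + 1) * tailErr (inWeight G i) (x i) a b x :=
      mul_le_mul_of_nonneg_left (hdev _) (by positivity)
    exact (mul_le_of_le_one_right (by positivity) (pow_le_one₀ hφ.1 hφ.2)).trans h2
  -- The sampling error is multiplied by the total in-weight, at most 2: the constant 9 is 3 from
  -- the probes at `i` and 6 from those at its neighbours.
  have hC : |∑ j, inWeight G i j * (tieWeight (x i) u (x j) *
          ((subsetAvg e ((G.neighborFinset j).erase i) fun k => tieWeight (x i) u (x k))
            - φ ^ e))|
      ≤ (e + 1) * ∑ j, inWeight G i j * tailErr (outWeight G j) (x i) a b x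
        + 2 * (3 * (e + 1) ^ 2 / δ) := by
    calc _ ≤ ∑ j, inWeight G i j * ((e + 1) * tailErr (outWeight G j) (x i) a b x
            + 3 * (e + 1) ^ 2 / δ) := by
          refine (Finset.abs_sum_le_sum_abs _ _).trans (Finset.sum_le_sum fun j _ => ?_)
          rw [abs_mul, abs_of_nonneg (hw0 j), abs_mul, abs_of_nonneg (h0 j)]
          refine mul_le_mul_of_nonneg_left ?_ (hw0 j)
          exact (mul_le_of_le_one_left (abs_nonneg _) (h1 j)).trans (hsamp e (by omega) j)
      _ = (e + 1) * ∑ j, inWeight G i j * tailErr (outWeight G j) (x i) a b x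
          + (∑ j, inWeight G i j) * (3 * (e + 1) ^ 2 / δ) := by
          rw [Finset.mul_sum, Finset.sum_mul, ← Finset.sum_add_distrib]
          exact Finset.sum_congr rfl fun j _ => by ring
      _ ≤ _ := by gcongr
  have hD : |(e + 1 : ℝ) * ∑ j, inWeight G i j * (tieWeight (x i) u (x j) *
          ((subsetAvg e ((G.neighborFinset j).erase i) fun k => tieWeight (x i) u (x k))
            - φ ^ e))|
      ≤ (e + 1) * ((e + 1) * ∑ j, inWeight G i j * tailErr (outWeight G j) (x i) a b x
        + 2 * (3 * (e + 1) ^ 2 / δ)) := by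
    rw [abs_mul, abs_of_nonneg (by positivity : (0 : ℝ) ≤ e + 1)]
    gcongr
  rw [Real.norm_eq_abs, hsplit]
  refine (abs_add_le _ _).trans ((add_le_add ((abs_add_le _ _).trans (add_le_add hA hB)) hD).trans ?_)
  have hfin : 3 * (e + 1 : ℝ) ^ 2 / δ ≤ 3 * (e + 1) ^ 3 / δ := by
    gcongr 3 * ?_ / δ
    exact pow_le_pow_right₀ (by linarith [(Nat.cast_nonneg e : (0 : ℝ) ≤ e)]) (by norm_num)
  have hfin2 : (e + 1 : ℝ) * (2 * (3 * (e + 1) ^ 2 / δ)) = 6 * (e + 1) ^ 3 / δ := by ring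
  have hfin3 : 9 * (e + 1 : ℝ) ^ 3 / δ = 3 * (e + 1) ^ 3 / δ + 6 * (e + 1) ^ 3 / δ := by ring
  rw [hfin3, ← hfin2]
  nlinarith

end Intensity

end JSQ

namespace JSQ

/-! ### The limiting equation -/

section LimitEquation

/-- The rate of change of the entry `i + 1` in the supermarket equation. -/
def meanField (lam : ℝ) (d : ℕ) (v : ℕ → ℝ) (i : ℕ) : ℝ :=
  lam * (v i ^ d - v (i + 1) ^ d) - (v (i + 1) - v (i + 2))

theorem abs_meanField_sub_le {lam : ℝ} (hlam : 0 ≤ lam) (d : ℕ) {v w : ℕ → ℝ}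
    (hv : ∀ i, v i ∈ Icc (0 : ℝ) 1) (hw : ∀ i, w i ∈ Icc (0 : ℝ) 1) {ε : ℝ}
    (h : ∀ i, |v i - w i| ≤ ε) (i : ℕ) :
    |meanField lam d v i - meanField lam d w i| ≤ (2 * lam * d + 2) * ε := by
  have hp : ∀ j, |v j ^ d - w j ^ d| ≤ d * ε := fun j =>
    (abs_pow_sub_pow_le (hv j).1 (hv j).2 (hw j).1 (hw j).2 d).trans
      (mul_le_mul_of_nonneg_left (h j) (Nat.cast_nonneg d))
  have hs : meanField lam d v i - meanField lam d w i
      = lam * ((v i ^ d - w i ^ d) - (v (i + 1) ^ d - w (i + 1) ^ d))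
        - ((v (i + 1) - w (i + 1)) - (v (i + 2) - w (i + 2))) := by
    unfold meanField; ring
  rw [hs]
  refine (abs_sub _ _).trans ?_
  rw [abs_mul, abs_of_nonneg hlam]
  have h1 := mul_le_mul_of_nonneg_left ((abs_sub (v i ^ d - w i ^ d)
    (v (i + 1) ^ d - w (i + 1) ^ d)).trans (add_le_add (hp i) (hp (i + 1)))) hlam
  have h2 := (abs_sub (v (i + 1) - w (i + 1)) (v (i + 2) - w (i + 2))).trans
    (add_le_add (h (i + 1)) (h (i + 2)))
  linarith

/-- Monotonicity fixes the signs of the arrival and the departure part, so both sums telescope and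
the bound does not depend on `m`. -/
theorem sum_abs_meanField_le {lam : ℝ} (hlam : 0 ≤ lam) (d : ℕ) {v : ℕ → ℝ}
    (hv : ∀ i, v i ∈ Icc (0 : ℝ) 1) (hanti : ∀ i, v (i + 1) ≤ v i) (m : ℕ) :
    ∑ i ∈ Finset.range m, |meanField lam d v i| ≤ lam + 1 := by
  have hterm : ∀ i, |meanField lam d v i|
      ≤ lam * (v i ^ d - v (i + 1) ^ d) + (v (i + 1) - v (i + 2)) := by
    intro i
    have h1 : 0 ≤ lam * (v i ^ d - v (i + 1) ^ d) :=
      mul_nonneg hlam (sub_nonneg.2 (pow_le_pow_left₀ (hv _).1 (hanti i) d))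
    have h2 : 0 ≤ v (i + 1) - v (i + 2) := sub_nonneg.2 (hanti (i + 1))
    unfold meanField
    rw [abs_le]
    constructor <;> linarith
  refine (Finset.sum_le_sum fun i _ => hterm i).trans ?_
  rw [Finset.sum_add_distrib, ← Finset.mul_sum, Finset.sum_range_sub' (fun i => v i ^ d),
    Finset.sum_range_sub' (fun i => v (i + 1))]
  have h1 : v 0 ^ d ≤ 1 := pow_le_one₀ (hv 0).1 (hv 0).2
  have h2 : 0 ≤ v m ^ d := pow_nonneg (hv m).1 d
  have h3 : lam * (v 0 ^ d - v m ^ d) ≤ lam * 1 := mul_le_mul_of_nonneg_left (by linarith) hlam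
  linarith [(hv (0 + 1)).2, (hv (m + 1)).1]

/-- A solution of the supermarket equation, as a family of real functions. -/
structure IsMeanFieldFlow (lam : ℝ) (d : ℕ) (u : ℝ → ℕ → ℝ) : Prop where
  zero : ∀ t, 0 ≤ t → u t 0 = 1
  mem : ∀ t, 0 ≤ t → ∀ i, u t i ∈ Icc (0 : ℝ) 1
  anti : ∀ t, 0 ≤ t → ∀ i, u t (i + 1) ≤ u t i
  deriv : ∀ t, 0 ≤ t → ∀ i,
    HasDerivWithinAt (fun s => u s (i + 1)) (meanField lam d (u t) i) (Ici 0) t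

/-- Testing against the fixed signs of the increments reduces the claim to the mean value inequality
for one real function; coordinatewise estimates would grow with `m`. -/
theorem IsMeanFieldFlow.sum_abs_sub_le {lam : ℝ} (hlam : 0 ≤ lam) {d : ℕ} {u : ℝ → ℕ → ℝ}
    (hu : IsMeanFieldFlow lam d u) {s t : ℝ} (hs : 0 ≤ s) (ht : 0 ≤ t) (m : ℕ) :
    ∑ i ∈ Finset.range m, |u t (i + 1) - u s (i + 1)| ≤ (lam + 1) * |t - s| := by
  set σ : ℕ → ℝ := fun i => SignType.sign (u t (i + 1) - u s (i + 1)) with hσ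
  have hσ1 : ∀ i, |σ i| ≤ 1 := by
    intro i
    simp only [hσ]
    rcases SignType.trichotomy (SignType.sign (u t (i + 1) - u s (i + 1))) with h | h | h <;>
      simp [h]
  have h := Convex.norm_image_sub_le_of_norm_hasDerivWithin_le (s := Ici (0 : ℝ))
    (f := fun r => ∑ i ∈ Finset.range m, σ i * u r (i + 1))
    (f' := fun r => ∑ i ∈ Finset.range m, σ i * meanField lam d (u r) i) (C := lam + 1)
    (fun r hr => HasDerivWithinAt.fun_sum fun i _ => (hu.deriv r hr i).const_mul (σ i))
    (fun r hr => by
      refine (Finset.abs_sum_le_sum_abs _ _).trans (le_trans (Finset.sum_le_sum fun i _ => ?_)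
        (sum_abs_meanField_le hlam d (hu.mem r hr) (hu.anti r hr) m))
      rw [abs_mul]
      exact mul_le_of_le_one_left (abs_nonneg _) (hσ1 i))
    (convex_Ici 0) hs ht
  rw [← Finset.sum_sub_distrib] at h
  refine le_trans (le_of_eq ?_) ((le_abs_self _).trans h)
  refine Finset.sum_congr rfl fun i _ => ?_
  rw [← mul_sub, hσ]
  exact (sign_mul_self _).symm

theorem IsMeanFieldFlow.abs_sub_le {lam : ℝ} (hlam : 0 ≤ lam) {d : ℕ} {u : ℝ → ℕ → ℝ}
    (hu : IsMeanFieldFlow lam d u) {s t : ℝ} (hs : 0 ≤ s) (ht : 0 ≤ t) (i : ℕ) :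
    |u t i - u s i| ≤ (lam + 1) * |t - s| := by
  cases i with
  | zero => rw [hu.zero t ht, hu.zero s hs]; simp; positivity
  | succ i =>
    exact (Finset.single_le_sum (f := fun i => |u t (i + 1) - u s (i + 1)|)
      (fun _ _ => abs_nonneg _) (Finset.self_mem_range_succ i)).trans
      (hu.sum_abs_sub_le hlam hs ht (i + 1))

/-- The error of one step of the Euler scheme. -/
theorem IsMeanFieldFlow.abs_euler_le {lam : ℝ} (hlam : 0 ≤ lam) {d : ℕ} {u : ℝ → ℕ → ℝ}
    (hu : IsMeanFieldFlow lam d u) {t h : ℝ} (ht : 0 ≤ t) (hh : 0 ≤ h) (i : ℕ) :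
    |u (t + h) (i + 1) - u t (i + 1) - h * meanField lam d (u t) i|
      ≤ (2 * lam * d + 2) * (lam + 1) * h ^ 2 := by
  have hsub : Icc t (t + h) ⊆ Ici 0 := fun r hr => ht.trans hr.1
  have key := Convex.norm_image_sub_le_of_norm_hasDerivWithin_le (s := Icc t (t + h))
    (f := fun r => u r (i + 1) - r * meanField lam d (u t) i)
    (f' := fun r => meanField lam d (u r) i - 1 * meanField lam d (u t) i)
    (C := (2 * lam * d + 2) * ((lam + 1) * h))
    (fun r hr => ((hu.deriv r (hsub hr) i).mono hsub).sub
      ((hasDerivWithinAt_id r _).mul_const _))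
    (fun r hr => by
      rw [one_mul]
      refine abs_meanField_sub_le hlam d (hu.mem r (hsub hr)) (hu.mem t ht) (fun j => ?_) i
      refine (hu.abs_sub_le hlam ht (hsub hr) j).trans ?_
      gcongr
      rw [abs_of_nonneg (by linarith [hr.1])]
      linarith [hr.2])
    (convex_Icc _ _) (left_mem_Icc.2 (by linarith)) (right_mem_Icc.2 (by linarith))
  rw [add_sub_cancel_left, Real.norm_of_nonneg hh, Real.norm_eq_abs] at key
  calc _ = |u (t + h) (i + 1) - (t + h) * meanField lam d (u t) i
        - (u t (i + 1) - t * meanField lam d (u t) i)| := by ring_nf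
    _ ≤ _ := key
    _ = _ := by ring

/-- Starting from the trivial bound 1, the Lipschitz estimate is integrated `n` times in each
coordinate. This avoids differentiating a supremum over infinitely many coordinates. -/
theorem IsMeanFieldFlow.eq {lam : ℝ} (hlam : 0 ≤ lam) {d : ℕ} {u v : ℝ → ℕ → ℝ}
    (hu : IsMeanFieldFlow lam d u) (hv : IsMeanFieldFlow lam d v) (h0 : u 0 = v 0) {t : ℝ}
    (ht : 0 ≤ t) (i : ℕ) : u t i = v t i := by
  set L := 2 * lam * d + 2 with hL
  have hLpos : 0 ≤ L := by positivity
  have key : ∀ n : ℕ, ∀ t, 0 ≤ t → ∀ i, |u t i - v t i| ≤ (L * t) ^ n / n.factorial := by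
    intro n
    induction n with
    | zero =>
      intro t ht i
      have h1 := hu.mem t ht i
      have h2 := hv.mem t ht i
      simp only [pow_zero, Nat.factorial_zero, Nat.cast_one, div_one]
      rw [abs_le]
      constructor <;> linarith [h1.1, h1.2, h2.1, h2.2]
    | succ n ih =>
      intro t ht i
      cases i with
      | zero =>
        rw [hu.zero t ht, hv.zero t ht]
        simp only [sub_self, abs_zero]
        positivity
      | succ i =>
        have hsub : ∀ r, 0 ≤ r → Ici r ⊆ Ici (0 : ℝ) := fun r hr => Ici_subset_Ici.2 hr
        have hd : ∀ r, 0 ≤ r → HasDerivWithinAt (fun s => u s (i + 1) - v s (i + 1))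
            (meanField lam d (u r) i - meanField lam d (v r) i) (Ici 0) r := fun r hr =>
          (hu.deriv r hr i).sub (hv.deriv r hr i)
        have := image_norm_le_of_norm_deriv_right_le_deriv_boundary (a := 0) (b := t)
          (f := fun s => u s (i + 1) - v s (i + 1))
          (B := fun r => (L * r) ^ (n + 1) / (n + 1).factorial)
          (B' := fun r => L * ((L * r) ^ n / n.factorial))
          (fun r hr => ((hd r hr.1).continuousWithinAt).mono Icc_subset_Ici_self)
          (fun r hr => (hd r hr.1).mono (hsub r hr.1))
          (by simp [h0])
          (fun r => by
            have := (((hasDerivAt_id r).const_mul L).pow (n + 1)).div_const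
              ((n + 1).factorial : ℝ)
            convert! this using 1
            rw [Nat.factorial_succ]
            push_cast
            field_simp
            simp)
          (fun r hr => abs_meanField_sub_le hlam d (hu.mem r hr.1) (hv.mem r hr.1)
            (ih r hr.1) i)
          (right_mem_Icc.2 ht)
        exact this
  have hlim := FloorSemiring.tendsto_pow_div_factorial_atTop (L * t)
  have : |u t i - v t i| ≤ 0 := ge_of_tendsto' hlim fun n => key n t ht i
  exact sub_eq_zero.1 (abs_nonpos_iff.1 this)

end LimitEquation

end JSQ

namespace JSQ

/-! ### Existence of the limit flow by a monotone Picard iteration -/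

section Existence

/-- The mean-field rate made monotone by an integrating factor. -/
def cooperativeRate (lam : ℝ) (d : ℕ) (v : ℕ → ℝ) (i : ℕ) : ℝ :=
  (lam * d + 1) * v (i + 1) + meanField lam d v i

/-- The added multiple of `v (i + 1)` outweighs the two decreasing terms, because `x ^ d` is
`d`-Lipschitz on `[0,1]`. All other dependence on `v` is already increasing. -/
theorem cooperativeRate_mono {lam : ℝ} (hlam : 0 ≤ lam) (d : ℕ) {v w : ℕ → ℝ}
    (hv : ∀ i, v i ∈ Icc (0 : ℝ) 1) (hw : ∀ i, w i ∈ Icc (0 : ℝ) 1) (h : ∀ i, v i ≤ w i) (i : ℕ) :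
    cooperativeRate lam d v i ≤ cooperativeRate lam d w i := by
  have h1 : v i ^ d ≤ w i ^ d := pow_le_pow_left₀ (hv i).1 (h i) d
  have h2 : w (i + 1) ^ d - v (i + 1) ^ d ≤ d * (w (i + 1) - v (i + 1)) := by
    have := abs_pow_sub_pow_le (hw (i + 1)).1 (hw (i + 1)).2 (hv (i + 1)).1 (hv (i + 1)).2 d
    rw [abs_of_nonneg (sub_nonneg.2 (h (i + 1)))] at this
    exact (le_abs_self _).trans this
  have h3 := h (i + 2)
  have h4 := mul_le_mul_of_nonneg_left h1 hlam
  have h5 := mul_le_mul_of_nonneg_left h2 hlam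
  unfold cooperativeRate meanField
  linarith

/-- Comparison with the constant sequences 0 and 1. -/
theorem cooperativeRate_mem_Icc {lam : ℝ} (hlam : 0 ≤ lam) {d : ℕ} (hd : d ≠ 0) {v : ℕ → ℝ}
    (hv : ∀ i, v i ∈ Icc (0 : ℝ) 1) (i : ℕ) :
    cooperativeRate lam d v i ∈ Icc 0 (lam * d + 1) := by
  constructor
  · have := cooperativeRate_mono hlam d (v := fun _ => 0) (fun _ => by simp) hv
      (fun i => (hv i).1) i
    simpa [cooperativeRate, meanField, hd] using this
  · have := cooperativeRate_mono hlam d (w := fun _ => 1) hv (fun _ => by simp)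
      (fun i => (hv i).2) i
    simpa [cooperativeRate, meanField] using this

theorem continuous_cooperativeRate (lam : ℝ) (d i : ℕ) :
    Continuous fun v : ℕ → ℝ => cooperativeRate lam d v i := by
  unfold cooperativeRate meanField
  fun_prop

/-- One Picard step for the mild form of the supermarket equation. -/
noncomputable def picardStep (lam : ℝ) (d : ℕ) (a : ℕ → ℝ) (u : ℝ → ℕ → ℝ) (t : ℝ) : ℕ → ℝ
  | 0 => 1
  | i + 1 => Real.exp (-((lam * d + 1) * max t 0)) *
      (a (i + 1) + ∫ s in (0 : ℝ)..(max t 0), Real.exp ((lam * d + 1) * s) *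
        cooperativeRate lam d (u s) i)

/-- Measurable families with values in nonincreasing `[0,1]`-valued sequences starting at `1`. -/
structure IsTailFamily (u : ℝ → ℕ → ℝ) : Prop where
  meas : Measurable u
  zero : ∀ t, u t 0 = 1
  mem : ∀ t i, u t i ∈ Icc (0 : ℝ) 1
  anti : ∀ t i, u t (i + 1) ≤ u t i

theorem IsTailFamily.intervalIntegrable {lam : ℝ} (hlam : 0 ≤ lam) {d : ℕ} (hd : d ≠ 0)
    {u : ℝ → ℕ → ℝ} (hu : IsTailFamily u) (i : ℕ) (a b : ℝ) :
    IntervalIntegrable (fun s => Real.exp ((lam * d + 1) * s) * cooperativeRate lam d (u s) i)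
      volume a b := by
  refine IntervalIntegrable.mono_fun (μ := volume)
    ((by fun_prop : Continuous fun s : ℝ => Real.exp ((lam * d + 1) * s) *
      (lam * d + 1)).intervalIntegrable _ _) ?_ ?_
  · exact (((by fun_prop : Continuous fun s : ℝ => Real.exp ((lam * d + 1) * s)).measurable).mul
      ((continuous_cooperativeRate lam d i).measurable.comp hu.meas)).aestronglyMeasurable
  · refine Eventually.of_forall fun s => ?_
    obtain ⟨h0, h1⟩ := cooperativeRate_mem_Icc hlam hd (hu.mem s) i
    beta_reduce
    rw [Real.norm_of_nonneg (by positivity), Real.norm_of_nonneg (by positivity)]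
    gcongr

theorem exp_mul_integral_exp (c t : ℝ) :
    Real.exp (-(c * t)) * (1 + ∫ s in (0 : ℝ)..t, Real.exp (c * s) * c) = 1 := by
  have h : ∫ s in (0 : ℝ)..t, Real.exp (c * s) * c = Real.exp (c * t) - 1 := by
    rw [intervalIntegral.integral_eq_sub_of_hasDerivAt (f := fun s => Real.exp (c * s))
      (fun s _ => by simpa using ((hasDerivAt_id s).const_mul c).exp)
      ((by fun_prop : Continuous fun s : ℝ => Real.exp (c * s) * c).intervalIntegrable _ _)]
    simp
  rw [h, add_sub_cancel, ← Real.exp_add, neg_add_cancel, Real.exp_zero]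

/-- The upper bound 1 holds because the constant 1 is a fixed point (`exp_mul_integral_exp`).
Monotonicity in the index compares the family with its own shift by one. Truncating time by `max t
0` keeps the bounds true for every real `t`. -/
theorem IsTailFamily.picardStep {lam : ℝ} (hlam : 0 ≤ lam) {d : ℕ} (hd : d ≠ 0) {a : ℕ → ℝ}
    (ha : ∀ i, a i ∈ Icc (0 : ℝ) 1) (ha' : ∀ i, a (i + 1) ≤ a i) {u : ℝ → ℕ → ℝ}
    (hu : IsTailFamily u) : IsTailFamily (picardStep lam d a u) := by
  have hmem : ∀ t i, JSQ.picardStep lam d a u t i ∈ Icc (0 : ℝ) 1 := by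
    intro t i
    cases i with
    | zero => simp [JSQ.picardStep]
    | succ i =>
      have h0 := intervalIntegral.integral_nonneg (μ := volume) (a := 0) (b := max t 0)
        (f := fun s => Real.exp ((lam * d + 1) * s) * cooperativeRate lam d (u s) i)
        (le_max_right t 0)
        fun s _ => mul_nonneg (Real.exp_nonneg _) (cooperativeRate_mem_Icc hlam hd (hu.mem s) i).1
      have h1 := intervalIntegral.integral_mono_on (μ := volume) (le_max_right t 0)
        (hu.intervalIntegrable hlam hd i 0 (max t 0))
        ((by fun_prop : Continuous fun s : ℝ => Real.exp ((lam * d + 1) * s) *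
          (lam * d + 1)).intervalIntegrable _ _)
        fun s _ => mul_le_mul_of_nonneg_left (cooperativeRate_mem_Icc hlam hd (hu.mem s) i).2
          (Real.exp_nonneg _)
      refine ⟨mul_nonneg (Real.exp_nonneg _) (add_nonneg (ha _).1 h0), ?_⟩
      refine le_trans ?_ (exp_mul_integral_exp (lam * d + 1) (max t 0)).le
      exact mul_le_mul_of_nonneg_left (add_le_add (ha _).2 h1) (Real.exp_nonneg _)
  refine ⟨measurable_pi_iff.2 fun i => ?_, fun t => rfl, hmem, fun t i => ?_⟩
  · cases i with
    | zero => exact measurable_const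
    | succ i =>
      have hcont := intervalIntegral.continuous_primitive
        (fun a b => hu.intervalIntegrable hlam hd i a b) 0
      have : Continuous fun t => JSQ.picardStep lam d a u t (i + 1) := by
        refine Continuous.mul (by fun_prop) (continuous_const.add ?_)
        exact hcont.comp (continuous_id.max continuous_const)
      exact this.measurable
  · cases i with
    | zero => exact (hmem t 1).2
    | succ i =>
      refine mul_le_mul_of_nonneg_left (add_le_add (ha' _) ?_) (Real.exp_nonneg _)
      refine intervalIntegral.integral_mono_on (le_max_right t 0)
        (hu.intervalIntegrable hlam hd (i + 1) 0 (max t 0))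
        (hu.intervalIntegrable hlam hd i 0 (max t 0)) fun s _ => ?_
      exact mul_le_mul_of_nonneg_left (cooperativeRate_mono hlam d (v := fun i => u s (i + 1))
        (fun i => hu.mem s (i + 1)) (hu.mem s) (hu.anti s) i) (Real.exp_nonneg _)

theorem picardStep_mono {lam : ℝ} (hlam : 0 ≤ lam) {d : ℕ} (hd : d ≠ 0) (a : ℕ → ℝ)
    {u v : ℝ → ℕ → ℝ} (hu : IsTailFamily u) (hv : IsTailFamily v) (h : ∀ t i, u t i ≤ v t i)
    (t : ℝ) (i : ℕ) : picardStep lam d a u t i ≤ picardStep lam d a v t i := by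
  cases i with
  | zero => exact le_rfl
  | succ i =>
    refine mul_le_mul_of_nonneg_left (add_le_add le_rfl ?_) (Real.exp_nonneg _)
    refine intervalIntegral.integral_mono_on (le_max_right t 0)
      (hu.intervalIntegrable hlam hd i 0 (max t 0))
      (hv.intervalIntegrable hlam hd i 0 (max t 0)) fun s _ => ?_
    exact mul_le_mul_of_nonneg_left (cooperativeRate_mono hlam d (hu.mem s) (hv.mem s) (h s) i)
      (Real.exp_nonneg _)

/-- The Picard iterates, starting from the smallest admissible family. -/
noncomputable def picardIter (lam : ℝ) (d : ℕ) (a : ℕ → ℝ) : ℕ → ℝ → ℕ → ℝ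
  | 0 => fun _ i => if i = 0 then 1 else 0
  | n + 1 => picardStep lam d a (picardIter lam d a n)

/-- A nonincreasing fixed point of the Picard step. -/
theorem exists_picardStep_fixedPoint {lam : ℝ} (hlam : 0 ≤ lam) {d : ℕ} (hd : d ≠ 0) {a : ℕ → ℝ}
    (ha : ∀ i, a i ∈ Icc (0 : ℝ) 1) (ha' : ∀ i, a (i + 1) ≤ a i) :
    ∃ u, IsTailFamily u ∧ picardStep lam d a u = u := by
  set U := picardIter lam d a with hU
  have hfam : ∀ n, IsTailFamily (U n) := by
    intro n
    induction n with
    | zero =>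
      refine ⟨measurable_const, fun t => by simp [hU, picardIter], fun t i => ?_, fun t i => ?_⟩
      · simp only [hU, picardIter]; split_ifs <;> simp
      · simp only [hU, picardIter]; split_ifs <;> simp_all
    | succ n ih => exact ih.picardStep hlam hd ha ha'
  have hstep : ∀ n t i, U n t i ≤ U (n + 1) t i := by
    intro n
    induction n with
    | zero =>
      intro t i
      cases i with
      | zero => rw [(hfam 1).zero]; simp [hU, picardIter]
      | succ i => simpa [hU, picardIter] using ((hfam 1).mem t (i + 1)).1
    | succ n ih => exact picardStep_mono hlam hd a (hfam n) (hfam (n + 1)) ih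
  have hmono : ∀ t i, Monotone fun n => U n t i := fun t i =>
    monotone_nat_of_le_succ fun n => hstep n t i
  have hbdd : ∀ t i, BddAbove (range fun n => U n t i) := fun t i =>
    ⟨1, by rintro _ ⟨n, rfl⟩; exact ((hfam n).mem t i).2⟩
  -- The iterates increase and stay below 1, so they converge pointwise without any contraction
  -- estimate.
  set u : ℝ → ℕ → ℝ := fun t i => ⨆ n, U n t i with hu
  have hlim : ∀ t i, Tendsto (fun n => U n t i) atTop (𝓝 (u t i)) := fun t i =>
    tendsto_atTop_ciSup (hmono t i) (hbdd t i)
  have hufam : IsTailFamily u := by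
    refine ⟨?_, fun t => ?_, fun t i => ?_, fun t i => ?_⟩
    · exact measurable_of_tendsto_metrizable (fun n => (hfam n).meas)
        (tendsto_pi_nhds.2 fun t => tendsto_pi_nhds.2 fun i => hlim t i)
    · simp [hu, (hfam _).zero t]
    · exact isClosed_Icc.mem_of_tendsto (hlim t i) (Eventually.of_forall fun n => (hfam n).mem t i)
    · exact le_of_tendsto_of_tendsto' (hlim t (i + 1)) (hlim t i) fun n => (hfam n).anti t i
  refine ⟨u, hufam, ?_⟩
  funext t i
  have h1 : Tendsto (fun n => U (n + 1) t i) atTop (𝓝 (u t i)) :=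
    (hlim t i).comp (tendsto_add_atTop_nat 1)
  refine tendsto_nhds_unique ?_ h1
  cases i with
  | zero => exact tendsto_const_nhds
  | succ i =>
    refine Tendsto.const_mul _ (Tendsto.const_add _ ?_)
    refine intervalIntegral.tendsto_integral_filter_of_dominated_convergence
      (fun s => Real.exp ((lam * d + 1) * s) * (lam * d + 1)) ?_ ?_ ?_ ?_
    · exact Eventually.of_forall fun n => ((by fun_prop : Continuous fun s : ℝ =>
        Real.exp ((lam * d + 1) * s)).measurable.mul ((continuous_cooperativeRate lam d
          i).measurable.comp (hfam n).meas)).aestronglyMeasurable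
    · refine Eventually.of_forall fun n => Eventually.of_forall fun s _ => ?_
      obtain ⟨h0, h1⟩ := cooperativeRate_mem_Icc hlam hd ((hfam n).mem s) i
      rw [Real.norm_of_nonneg (by positivity)]
      gcongr
    · exact (by fun_prop : Continuous fun s : ℝ => Real.exp ((lam * d + 1) * s) *
        (lam * d + 1)).intervalIntegrable _ _
    · refine Eventually.of_forall fun s _ => Tendsto.const_mul _ ?_
      exact ((continuous_cooperativeRate lam d i).tendsto (u s)).comp
        (tendsto_pi_nhds.2 fun j => hlim s j)

/-- The fixed point is first seen to be continuous in time, as a primitive of a bounded function.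
Then the integrand is continuous, and differentiating the mild equation cancels the integrating
factor. -/
theorem exists_isMeanFieldFlow {lam : ℝ} (hlam : 0 ≤ lam) {d : ℕ} (hd : d ≠ 0) {a : ℕ → ℝ}
    (ha : ∀ i, a i ∈ Icc (0 : ℝ) 1) (ha0 : a 0 = 1) (ha' : ∀ i, a (i + 1) ≤ a i) :
    ∃ u, IsMeanFieldFlow lam d u ∧ u 0 = a := by
  obtain ⟨u, hu, hfix⟩ := exists_picardStep_fixedPoint hlam hd ha ha'
  have hi : ∀ t i, u t (i + 1) = Real.exp (-((lam * d + 1) * max t 0)) *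
      (a (i + 1) + ∫ s in (0 : ℝ)..(max t 0), Real.exp ((lam * d + 1) * s) *
        cooperativeRate lam d (u s) i) := fun t i => by
    conv_lhs => rw [← hfix]
    rfl
  have hcont : Continuous u := by
    refine continuous_pi fun i => ?_
    cases i with
    | zero => simpa only [hu.zero] using continuous_const
    | succ i =>
      simp_rw [hi]
      refine Continuous.mul (by fun_prop) (continuous_const.add ?_)
      exact (intervalIntegral.continuous_primitive
        (fun a b => hu.intervalIntegrable hlam hd i a b) 0).comp (continuous_id.max continuous_const)
  refine ⟨u, ⟨fun t _ => hu.zero t, fun t _ => hu.mem t, fun t _ => hu.anti t, ?_⟩, ?_⟩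
  · intro t ht i
    have hint : Continuous fun s => Real.exp ((lam * d + 1) * s) * cooperativeRate lam d (u s) i :=
      (by fun_prop : Continuous fun s : ℝ => Real.exp ((lam * d + 1) * s)).mul
        ((continuous_cooperativeRate lam d i).comp hcont)
    have h1 : HasDerivAt (fun t => Real.exp (-((lam * d + 1) * t)) *
        (a (i + 1) + ∫ s in (0 : ℝ)..t, Real.exp ((lam * d + 1) * s) *
          cooperativeRate lam d (u s) i)) (meanField lam d (u t) i) t := by
      have h2 := (((hasDerivAt_id t).const_mul (lam * d + 1)).neg.exp).mul
        ((hint.integral_hasStrictDerivAt 0 t).hasDerivAt.const_add (a (i + 1)))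
      convert! h2 using 1
      have h3 := hi t i
      rw [max_eq_left ht] at h3
      have h4 : Real.exp (-((lam * d + 1) * t)) * Real.exp ((lam * d + 1) * t) = 1 := by
        rw [← Real.exp_add, neg_add_cancel, Real.exp_zero]
      simp only [id, Pi.neg_apply, mul_one]
      rw [← mul_assoc (Real.exp _) (Real.exp _), h4, one_mul]
      have h5 : cooperativeRate lam d (u t) i
        = (lam * d + 1) * u t (i + 1) + meanField lam d (u t) i := rfl
      rw [h5, h3]
      ring
    refine h1.hasDerivWithinAt.congr (fun s hs => ?_) ?_
    · rw [hi, max_eq_left hs]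
    · rw [hi, max_eq_left ht]
  · funext i
    cases i with
    | zero => rw [hu.zero, ha0]
    | succ i => rw [hi]; simp

/-! ### Passage to the occupancy space -/

theorem lp_one_norm_eq_tsum (x : lp (fun _ : ℕ => ℝ) 1) : ‖x‖ = ∑' i, |x i| := by
  have := lp.norm_eq_tsum_rpow (p := 1) (by simp) x
  simpa using this

theorem lp_one_summable_abs (x : lp (fun _ : ℕ => ℝ) 1) : Summable fun i => |x i| := by
  have := (lp.memℓp x).summable (p := 1) (by simp)
  simpa using this

theorem OccupancySpace.dist_eq_tsum (p q : OccupancySpace) : dist p q = ∑' i, |p.1 i - q.1 i| := by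
  rw [Subtype.dist_eq, dist_eq_norm, lp_one_norm_eq_tsum]
  rfl

theorem OccupancySpace.summable_abs_sub (p q : OccupancySpace) :
    Summable fun i => |p.1 i - q.1 i| := lp_one_summable_abs (p.1 - q.1)

/-- Entry `0` equals 1 in both states and does not contribute. -/
theorem OccupancySpace.dist_le {p q : OccupancySpace} {C : ℝ}
    (h : ∀ m, ∑ i ∈ Finset.range m, |p.1 (i + 1) - q.1 (i + 1)| ≤ C) : dist p q ≤ C := by
  rw [OccupancySpace.dist_eq_tsum]
  refine Real.tsum_le_of_sum_range_le (fun i => abs_nonneg _) fun m => ?_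
  cases m with
  | zero => simpa using h 0
  | succ m =>
    rw [Finset.sum_range_succ', p.2.1, q.2.1]
    simpa using h m

theorem IsSupermarketSolution.isMeanFieldFlow {lam : ℝ≥0} {d : ℕ} {q₀ : OccupancySpace}
    {q : ℝ≥0 → OccupancySpace} (hq : IsSupermarketSolution lam d q₀ q) :
    IsMeanFieldFlow lam d fun t i => (q t.toNNReal).1 i where
  zero t _ := (q _).2.1
  mem t _ := (q _).2.2.2
  anti t _ := (q _).2.2.1
  deriv t ht i := by
    have := hq.2 t.toNNReal i
    rwa [Real.coe_toNNReal t ht] at this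

theorem IsSupermarketSolution.dist_le {lam : ℝ≥0} {d : ℕ} {q₀ : OccupancySpace}
    {q : ℝ≥0 → OccupancySpace} (hq : IsSupermarketSolution lam d q₀ q) (s t : ℝ≥0) :
    dist (q s) (q t) ≤ (lam + 1) * dist s t := by
  refine OccupancySpace.dist_le fun m => ?_
  have := hq.isMeanFieldFlow.sum_abs_sub_le lam.coe_nonneg t.coe_nonneg s.coe_nonneg m
  simpa [NNReal.dist_eq] using this

theorem IsSupermarketSolution.eq {lam : ℝ≥0} {d : ℕ} {q₀ : OccupancySpace}
    {p q : ℝ≥0 → OccupancySpace} (hp : IsSupermarketSolution lam d q₀ p)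
    (hq : IsSupermarketSolution lam d q₀ q) : p = q := by
  funext t
  refine Subtype.ext (lp.ext (funext fun i => ?_))
  have := hp.isMeanFieldFlow.eq lam.coe_nonneg hq.isMeanFieldFlow
    (by funext i; simp [hp.1, hq.1]) t.coe_nonneg i
  simpa using this

/-- The `ℓ¹` speed bound propagates summability from time 0 to time `t`, and also gives continuity
in `ℓ¹`. -/
theorem exists_isSupermarketSolution (lam : ℝ≥0) {d : ℕ} (hd : d ≠ 0) (q₀ : OccupancySpace) :
    ∃ q : C(ℝ≥0, OccupancySpace), IsSupermarketSolution lam d q₀ q := by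
  obtain ⟨u, hu, hu0⟩ := exists_isMeanFieldFlow lam.coe_nonneg hd q₀.2.2.2 q₀.2.1 q₀.2.2.1
  have hsum : ∀ t : ℝ≥0, Summable fun i => u t i := by
    intro t
    have h0 : Summable fun i => u 0 (i + 1) := by
      rw [hu0]
      exact (summable_nat_add_iff 1).2 (lp_one_summable_abs q₀.1).of_abs
    rw [← summable_nat_add_iff 1]
    refine summable_of_sum_range_le (c := ∑' i, u 0 (i + 1) + (lam + 1) * |(t : ℝ) - 0|)
      (fun i => (hu.mem t t.coe_nonneg _).1) fun m => ?_
    have h1 := hu.sum_abs_sub_le lam.coe_nonneg le_rfl t.coe_nonneg m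
    have h2 := h0.sum_le_tsum (Finset.range m) fun i _ => (hu.mem 0 le_rfl _).1
    refine le_trans ?_ (add_le_add h2 h1)
    rw [← Finset.sum_add_distrib]
    refine Finset.sum_le_sum fun i _ => ?_
    have := le_abs_self (u t (i + 1) - u 0 (i + 1))
    linarith
  have hmem : ∀ t : ℝ≥0, Memℓp (fun i => u t i) 1 := by
    intro t
    refine memℓp_gen ?_
    simpa using (hsum t).abs
  let q : ℝ≥0 → OccupancySpace := fun t =>
    ⟨⟨fun i => u t i, hmem t⟩, hu.zero t t.coe_nonneg, hu.anti t t.coe_nonneg, hu.mem t t.coe_nonneg⟩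
  have hsol : IsSupermarketSolution lam d q₀ q := by
    refine ⟨Subtype.ext (lp.ext (funext fun i => congrFun hu0 i)), fun t i => ?_⟩
    refine (hu.deriv t t.coe_nonneg i).congr (fun s hs => ?_) ?_
    · change u s.toNNReal (i + 1) = _
      rw [Real.coe_toNNReal s hs]
    · change u (t : ℝ).toNNReal (i + 1) = _
      rw [Real.toNNReal_coe]
  refine ⟨⟨q, ?_⟩, hsol⟩
  exact (LipschitzWith.of_dist_le_mul (K := lam + 1) fun s t => by
    simpa using hsol.dist_le s t).continuous

end Existence

end JSQ

namespace JSQ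

/-! ### Poisson random measures: moments -/

section PoissonMoments

theorem hasSum_poisson_mul_self (r : ℝ≥0) :
    HasSum (fun n : ℕ => Real.exp (-r) * (r : ℝ) ^ n / n.factorial * n) r := by
  rw [← hasSum_nat_add_iff' 1]
  have := (hasSum_one_poissonMeasure r).mul_left (r : ℝ)
  convert! this using 1
  · funext n
    rw [Nat.factorial_succ]
    push_cast
    field_simp
    ring
  · simp

theorem hasSum_poisson_mul_sq (r : ℝ≥0) :
    HasSum (fun n : ℕ => Real.exp (-r) * (r : ℝ) ^ n / n.factorial * (n : ℝ) ^ 2)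
      ((r : ℝ) ^ 2 + r) := by
  rw [← hasSum_nat_add_iff' 1]
  have := ((hasSum_poisson_mul_self r).add (hasSum_one_poissonMeasure r)).mul_left (r : ℝ)
  convert! this using 1
  · funext n
    rw [Nat.factorial_succ]
    push_cast
    field_simp
    ring
  · simp
    ring

variable {Ω E : Type*} [MeasurableSpace Ω] [MeasurableSpace E] {M : Ω → Measure E} {ν : Measure E}
  {μ : Measure Ω}

theorem IsPoissonRandomMeasure.measurable_apply (hM : IsPoissonRandomMeasure M ν μ) {B : Set E}
    (hB : MeasurableSet B) : Measurable fun ω => M ω B :=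
  (Measure.measurable_coe hB).comp hM.measurable

theorem IsPoissonRandomMeasure.measurable_real (hM : IsPoissonRandomMeasure M ν μ) {B : Set E}
    (hB : MeasurableSet B) : Measurable fun ω => (M ω).real B :=
  (hM.measurable_apply hB).ennreal_toReal

/-- Holds for every `ω`, because `Measure.real` reads an infinite mass as `0`. -/
theorem IsPoissonRandomMeasure.exists_real_eq (hM : IsPoissonRandomMeasure M ν μ) (ω : Ω)
    {B : Set E} (hB : MeasurableSet B) : ∃ k : ℕ, (M ω).real B = k := by
  obtain ⟨k, hk⟩ := hM.integer_valued ω B hB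
  rw [Measure.real, hk]
  cases k with
  | top => exact ⟨0, by simp⟩
  | coe k => exact ⟨k, by simp⟩

theorem IsPoissonRandomMeasure.ae_ne_top (hM : IsPoissonRandomMeasure M ν μ) {B : Set E}
    (hB : MeasurableSet B) {r : ℝ≥0} (hr : ν B = r) : ∀ᵐ ω ∂μ, M ω B ≠ ∞ := by
  have h := hM.map_eq B hB (by simp [hr])
  have h1 : ∀ᵐ x ∂(μ.map fun ω => M ω B), x ≠ ∞ := by
    rw [h]
    refine (ae_map_iff (p := fun x : ℝ≥0∞ => x ≠ ∞) Measurable.of_discrete.aemeasurable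
      (measurableSet_singleton (∞ : ℝ≥0∞)).compl).2 ?_
    exact Eventually.of_forall fun n => ENNReal.natCast_ne_top n
  exact ae_of_ae_map (hM.measurable_apply hB).aemeasurable h1

/-- The law of a count is given on `ℝ≥0∞`; since it is an image of a law on `ℕ`, passing through
`toReal` loses nothing. -/
theorem IsPoissonRandomMeasure.integrable_comp_real (hM : IsPoissonRandomMeasure M ν μ) {B : Set E}
    (hB : MeasurableSet B) {r : ℝ≥0} (hr : ν B = r) {f : ℝ → ℝ} (hf : Measurable f) {a : ℝ}
    (h0 : ∀ n : ℕ, 0 ≤ f n)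
    (ha : HasSum (fun n : ℕ => Real.exp (-r) * (r : ℝ) ^ n / n.factorial * f n) a) :
    Integrable (fun ω => f ((M ω).real B)) μ ∧ ∫ ω, f ((M ω).real B) ∂μ = a := by
  have h := hM.map_eq B hB (by simp [hr])
  rw [hr, ENNReal.toNNReal_coe] at h
  have hg : Measurable fun x : ℝ≥0∞ => f x.toReal := hf.comp ENNReal.measurable_toReal
  have hint : Integrable (fun n : ℕ => f n) (poissonMeasure r) := by
    rw [integrable_poissonMeasure_iff]
    simpa only [Real.norm_of_nonneg (h0 _)] using ha.summable
  constructor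
  · have : Integrable (fun x : ℝ≥0∞ => f x.toReal) (μ.map fun ω => M ω B) := by
      rw [h, integrable_map_measure hg.aestronglyMeasurable (by fun_prop)]
      simpa [Function.comp_def] using hint
    exact this.comp_measurable (hM.measurable_apply hB)
  · have h1 : ∫ ω, f ((M ω).real B) ∂μ = ∫ x, f x.toReal ∂(μ.map fun ω => M ω B) :=
      (integral_map (hM.measurable_apply hB).aemeasurable hg.aestronglyMeasurable).symm
    rw [h1, h, integral_map (by fun_prop) hg.aestronglyMeasurable]
    simp only [ENNReal.toReal_natCast]
    rw [integral_poissonMeasure' hint]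
    exact ha.tsum_eq

theorem IsPoissonRandomMeasure.integral_real (hM : IsPoissonRandomMeasure M ν μ) {B : Set E}
    (hB : MeasurableSet B) {r : ℝ≥0} (hr : ν B = r) : ∫ ω, (M ω).real B ∂μ = r :=
  (hM.integrable_comp_real hB hr measurable_id (fun n => Nat.cast_nonneg n)
    (hasSum_poisson_mul_self r)).2

theorem IsPoissonRandomMeasure.integral_real_sq (hM : IsPoissonRandomMeasure M ν μ) {B : Set E}
    (hB : MeasurableSet B) {r : ℝ≥0} (hr : ν B = r) :
    ∫ ω, (M ω).real B ^ 2 ∂μ = (r : ℝ) ^ 2 + r :=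
  (hM.integrable_comp_real hB hr (f := fun x => x ^ 2) (by fun_prop) (fun n => by positivity)
    (hasSum_poisson_mul_sq r)).2

theorem IsPoissonRandomMeasure.memLp_real (hM : IsPoissonRandomMeasure M ν μ) {B : Set E}
    (hB : MeasurableSet B) {r : ℝ≥0} (hr : ν B = r) : MemLp (fun ω => (M ω).real B) 2 μ :=
  (memLp_two_iff_integrable_sq (hM.measurable_real hB).aestronglyMeasurable).2
    (hM.integrable_comp_real hB hr (f := fun x => x ^ 2) (by fun_prop) (fun n => by positivity)
      (hasSum_poisson_mul_sq r)).1

theorem IsPoissonRandomMeasure.variance_real [IsProbabilityMeasure μ]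
    (hM : IsPoissonRandomMeasure M ν μ) {B : Set E} (hB : MeasurableSet B) {r : ℝ≥0}
    (hr : ν B = r) : variance (fun ω => (M ω).real B) μ = r := by
  rw [variance_eq_sub (hM.memLp_real hB hr)]
  have := hM.integral_real_sq hB hr
  simp only [Pi.pow_apply]
  rw [this, hM.integral_real hB hr]
  ring

end PoissonMoments

/-! ### Lebesgue measure on the half-line and the intensity of boxes -/

section Lebesgue

theorem measurableEmbedding_coe_nnreal : MeasurableEmbedding fun t : ℝ≥0 => (t : ℝ) :=
  MeasurableEmbedding.subtype_coe measurableSet_Ici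

theorem lebesgue_apply (s : Set ℝ≥0) : lebesgue s = volume ((fun t : ℝ≥0 => (t : ℝ)) '' s) :=
  measurableEmbedding_coe_nnreal.comap_apply _ _

theorem lebesgue_Ioc (s t : ℝ≥0) : lebesgue (Ioc s t) = (t - s : ℝ≥0) := by
  have h : (fun t : ℝ≥0 => (t : ℝ)) '' Ioc s t = Ioc (s : ℝ) t := by
    ext x
    constructor
    · rintro ⟨y, hy, rfl⟩
      exact ⟨by exact_mod_cast hy.1, by exact_mod_cast hy.2⟩
    · intro hx
      lift x to ℝ≥0 using s.coe_nonneg.trans hx.1.le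
      exact ⟨x, ⟨by exact_mod_cast hx.1, by exact_mod_cast hx.2⟩, rfl⟩
  rw [lebesgue_apply, h, Real.volume_Ioc, ← ENNReal.ofReal_coe_nnreal, NNReal.coe_sub_def,
    ENNReal.ofReal_max, ENNReal.ofReal_zero, max_eq_left (by positivity)]

theorem lebesgue_Iic (c : ℝ≥0) : lebesgue (Iic c) = c := by
  have h : (fun t : ℝ≥0 => (t : ℝ)) '' Iic c = Icc (0 : ℝ) c := by
    ext x
    constructor
    · rintro ⟨y, hy, rfl⟩
      exact ⟨y.coe_nonneg, by exact_mod_cast hy⟩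
    · intro hx
      lift x to ℝ≥0 using hx.1
      exact ⟨x, by exact_mod_cast hx.2, rfl⟩
  rw [lebesgue_apply, h, Real.volume_Icc, sub_zero, ENNReal.ofReal_coe_nnreal]

instance : SFinite lebesgue := by
  have : IsFiniteMeasureOnCompacts lebesgue :=
    IsFiniteMeasureOnCompacts.comap' volume NNReal.continuous_coe measurableEmbedding_coe_nnreal
  infer_instance

theorem intensity_Ioc_prod_Iic (lam s t c : ℝ≥0) :
    (lam • lebesgue.prod lebesgue) (Ioc s t ×ˢ Iic c) = (lam * (t - s) * c : ℝ≥0) := by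
  rw [Measure.smul_apply, Measure.prod_prod, lebesgue_Ioc, lebesgue_Iic, ENNReal.smul_def]
  push_cast
  rw [smul_eq_mul, mul_assoc]

theorem intensity_Iic_prod_Iic (lam t c : ℝ≥0) :
    (lam • lebesgue.prod lebesgue) (Iic t ×ˢ Iic c) = (lam * t * c : ℝ≥0) := by
  rw [Measure.smul_apply, Measure.prod_prod, lebesgue_Iic, lebesgue_Iic, ENNReal.smul_def]
  push_cast
  rw [smul_eq_mul, mul_assoc]

end Lebesgue

end JSQ

namespace JSQ

/-! ### Paths driven by point measures -/

section Path

variable {V : Type*}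

/-- The path `x` solves the queueing equation driven by the departure points `Dm` and the arrival
points `Am`, with arrival intensities `C` bounded by `K`. -/
structure IsDrivenPath (C : V → (V → ℕ) → ℝ) (K : ℝ≥0) (Dm : V → Measure ℝ≥0)
    (Am : V → Measure (ℝ≥0 × ℝ≥0)) (x : ℝ≥0 → V → ℕ) : Prop where
  nonneg : ∀ i y, 0 ≤ C i y
  le_bound : ∀ i y, C i y ≤ K
  cadlag : IsCadlag x
  departures_ne_top : ∀ t i, Dm i (Iic t) ≠ ∞
  arrivals_ne_top : ∀ t i, Am i (Iic t ×ˢ Iic K) ≠ ∞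
  departures_nat : ∀ i B, MeasurableSet B → ∃ k : ℕ, (Dm i).real B = k
  arrivals_nat : ∀ i B, MeasurableSet B → ∃ k : ℕ, (Am i).real B = k
  evolution : ∀ t i, (x t i : ℝ) = x 0 i
      - (Dm i).real {s | s ≤ t ∧ 0 < Function.leftLim x s i}
      + (Am i).real {p | p.1 ≤ t ∧ (p.2 : ℝ) ≤ C i (Function.leftLim x p.1)}

variable {C : V → (V → ℕ) → ℝ} {K : ℝ≥0} {Dm : V → Measure ℝ≥0} {Am : V → Measure (ℝ≥0 × ℝ≥0)}
  {x : ℝ≥0 → V → ℕ}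

/-- The sets defined through left limits need not be shown measurable: they are cut by the
measurable condition that time is at most `s`, and finiteness of the total mass does the rest. -/
theorem IsDrivenPath.increment (h : IsDrivenPath C K Dm Am x) {s t : ℝ≥0} (hst : s ≤ t) (i : V) :
    (x t i : ℝ) = x s i
      - (Dm i).real {r | r ∈ Ioc s t ∧ 0 < Function.leftLim x r i}
      + (Am i).real {p | p.1 ∈ Ioc s t ∧ (p.2 : ℝ) ≤ C i (Function.leftLim x p.1)} := by
  have h1 : (Dm i).real {r | r ≤ t ∧ 0 < Function.leftLim x r i}
      = (Dm i).real {r | r ≤ s ∧ 0 < Function.leftLim x r i}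
        + (Dm i).real {r | r ∈ Ioc s t ∧ 0 < Function.leftLim x r i} := by
    rw [← measureReal_inter_add_sdiff (s := {r | r ≤ t ∧ 0 < Function.leftLim x r i})
      (t := Iic s) measurableSet_Iic
      ((measure_mono fun r hr => hr.1).trans_lt (h.departures_ne_top t i).lt_top).ne]
    congr 2
    · ext r
      exact ⟨fun hr => ⟨hr.2, hr.1.2⟩, fun hr => ⟨⟨hr.1.trans hst, hr.2⟩, hr.1⟩⟩
    · ext r
      exact ⟨fun hr => ⟨⟨not_le.1 hr.2, hr.1.1⟩, hr.1.2⟩,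
        fun hr => ⟨⟨hr.1.2, hr.2⟩, not_le.2 hr.1.1⟩⟩
  have h2 : (Am i).real {p | p.1 ≤ t ∧ (p.2 : ℝ) ≤ C i (Function.leftLim x p.1)}
      = (Am i).real {p | p.1 ≤ s ∧ (p.2 : ℝ) ≤ C i (Function.leftLim x p.1)}
        + (Am i).real {p | p.1 ∈ Ioc s t ∧ (p.2 : ℝ) ≤ C i (Function.leftLim x p.1)} := by
    rw [← measureReal_inter_add_sdiff
      (s := {p : ℝ≥0 × ℝ≥0 | p.1 ≤ t ∧ (p.2 : ℝ) ≤ C i (Function.leftLim x p.1)})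
      (t := Prod.fst ⁻¹' Iic s) (measurable_fst measurableSet_Iic)
      ((measure_mono fun (p : ℝ≥0 × ℝ≥0) hp => show p ∈ Iic t ×ˢ Iic K from
        ⟨hp.1, by exact_mod_cast hp.2.trans (h.le_bound i _)⟩).trans_lt
        (h.arrivals_ne_top t i).lt_top).ne]
    congr 2
    · ext r
      exact ⟨fun hr => ⟨hr.2, hr.1.2⟩, fun hr => ⟨⟨hr.1.trans hst, hr.2⟩, hr.1⟩⟩
    · ext r
      exact ⟨fun hr => ⟨⟨not_le.1 hr.2, hr.1.1⟩, hr.1.2⟩,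
        fun hr => ⟨⟨hr.1.2, hr.2⟩, not_le.2 hr.1.1⟩⟩
  rw [h.evolution t i, h.evolution s i, h1, h2]
  ring

theorem IsDrivenPath.departures_Ioc_ne_top (h : IsDrivenPath C K Dm Am x) (s t : ℝ≥0) (i : V) :
    Dm i (Ioc s t) ≠ ∞ :=
  ((measure_mono fun _ hr => hr.2).trans_lt (h.departures_ne_top t i).lt_top).ne

theorem IsDrivenPath.arrivals_Ioc_ne_top (h : IsDrivenPath C K Dm Am x) (s t : ℝ≥0) (i : V) :
    Am i (Ioc s t ×ˢ Iic K) ≠ ∞ :=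
  ((measure_mono (Set.prod_mono (fun _ hr => hr.2) subset_rfl)).trans_lt
    (h.arrivals_ne_top t i).lt_top).ne

theorem IsDrivenPath.abs_sub_le (h : IsDrivenPath C K Dm Am x) {s t : ℝ≥0} (hst : s ≤ t) (i : V) :
    |(x t i : ℝ) - x s i| ≤ (Dm i).real (Ioc s t) + (Am i).real (Ioc s t ×ˢ Iic K) := by
  have h1 : (Dm i).real {r | r ∈ Ioc s t ∧ 0 < Function.leftLim x r i} ≤ (Dm i).real (Ioc s t) :=
    measureReal_mono (fun r hr => hr.1) (h.departures_Ioc_ne_top s t i)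
  have h2 : (Am i).real {p | p.1 ∈ Ioc s t ∧ (p.2 : ℝ) ≤ C i (Function.leftLim x p.1)}
      ≤ (Am i).real (Ioc s t ×ˢ Iic K) :=
    measureReal_mono (fun p hp => ⟨hp.1, by exact_mod_cast hp.2.trans (h.le_bound i _)⟩)
      (h.arrivals_Ioc_ne_top s t i)
  have h3 : 0 ≤ (Dm i).real {r | r ∈ Ioc s t ∧ 0 < Function.leftLim x r i} := measureReal_nonneg
  have h4 : 0 ≤ (Am i).real {p | p.1 ∈ Ioc s t ∧ (p.2 : ℝ) ≤ C i (Function.leftLim x p.1)} :=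
    measureReal_nonneg
  rw [h.increment hst i, abs_le]
  constructor <;> linarith

theorem IsDrivenPath.le_add_arrivals (h : IsDrivenPath C K Dm Am x) (t : ℝ≥0) (i : V) :
    (x t i : ℝ) ≤ x 0 i + (Am i).real (Ioc 0 t ×ˢ Iic K) := by
  have h2 : (Am i).real {p | p.1 ∈ Ioc 0 t ∧ (p.2 : ℝ) ≤ C i (Function.leftLim x p.1)}
      ≤ (Am i).real (Ioc 0 t ×ˢ Iic K) :=
    measureReal_mono (fun p hp => ⟨hp.1, by exact_mod_cast hp.2.trans (h.le_bound i _)⟩)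
      (h.arrivals_Ioc_ne_top 0 t i)
  have h3 : 0 ≤ (Dm i).real {r | r ∈ Ioc 0 t ∧ 0 < Function.leftLim x r i} := measureReal_nonneg
  rw [h.increment (zero_le : 0 ≤ t) i]
  linarith

/-- The endpoint `τ` is included although `f` may jump there: a left limit sees only earlier times.
-/
theorem leftLim_eq_of_eqOn {E : Type*} [TopologicalSpace E] [T2Space E] {f : ℝ≥0 → E} {s τ : ℝ≥0}
    {y : E} (hf : ∀ r, s ≤ r → r < τ → f r = y) {r : ℝ≥0} (hr : r ∈ Ioc s τ) :
    Function.leftLim f r = y := by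
  have : (𝓝[<] r).NeBot := nhdsLT_neBot_of_exists_lt ⟨s, hr.1⟩
  refine leftLim_eq_of_tendsto (tendsto_const_nhds.congr' ?_)
  filter_upwards [Ioo_mem_nhdsLT hr.1] with u hu
  exact (hf u hu.1.le (hu.2.trans_le hr.2)).symm

/-- The increment up to the end of a holding interval. -/
theorem IsDrivenPath.eq_of_constant [Fintype V] (h : IsDrivenPath C K Dm Am x) {s τ : ℝ≥0}
    (hsτ : s ≤ τ) (hconst : ∀ r, s ≤ r → r < τ → x r = x s) (i : V) :
    (x τ i : ℝ) = x s i - (if 0 < x s i then 1 else 0) * (Dm i).real (Ioc s τ)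
      + (Am i).real (Ioc s τ ×ˢ Iic (C i (x s)).toNNReal) := by
  have hl : ∀ r ∈ Ioc s τ, Function.leftLim x r = x s := fun r hr => leftLim_eq_of_eqOn hconst hr
  rw [h.increment hsτ i]
  congr 2
  · split_ifs with h0
    · rw [one_mul]
      congr 1
      ext r
      exact ⟨fun hr => hr.1, fun hr => ⟨hr, by rwa [hl r hr]⟩⟩
    · rw [zero_mul, show {r | r ∈ Ioc s τ ∧ 0 < Function.leftLim x r i} = ∅ from ?_]
      · simp
      · ext r
        simp only [mem_ofPred_eq, mem_empty_iff_false, iff_false, not_and]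
        intro hr
        rwa [hl r hr]
  · ext p
    simp only [mem_ofPred_eq, mem_prod, mem_Iic]
    refine and_congr_right fun hp => ?_
    rw [hl _ hp, Real.le_toNNReal_iff_coe_le (h.nonneg i _)]

/-- The infimum of the times with a different state is itself such a time: otherwise
right-continuity with discrete values would keep the old state a little longer. -/
theorem exists_first_change [Fintype V] (hx : IsCadlag x) {s t : ℝ≥0} (hst : s ≤ t) :
    ∃ τ ∈ Icc s t, (∀ r, s ≤ r → r < τ → x r = x s) ∧ (x τ ≠ x s ∨ τ = t) := by
  by_cases hne : ∃ r ∈ Icc s t, x r ≠ x s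
  · set S := {r | r ∈ Icc s t ∧ x r ≠ x s} with hS
    have hSne : S.Nonempty := hne
    have hbdd : BddBelow S := ⟨s, fun r hr => hr.1.1⟩
    have hmem : sInf S ∈ Icc s t :=
      ⟨le_csInf hSne fun r hr => hr.1.1, (csInf_le hbdd hSne.some_mem).trans hSne.some_mem.1.2⟩
    have hbelow : ∀ r, s ≤ r → r < sInf S → x r = x s := by
      intro r hr hlt
      by_contra hcon
      exact (csInf_le hbdd ⟨⟨hr, hlt.le.trans hmem.2⟩, hcon⟩).not_gt hlt
    refine ⟨sInf S, hmem, hbelow, Or.inl fun heq => ?_⟩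
    have hright := (hx (sInf S)).1 (mem_nhds_discrete.2 (mem_singleton (x (sInf S))))
    rw [Filter.mem_map, mem_nhdsGE_iff_exists_Ico_subset] at hright
    obtain ⟨u, hu, hsub⟩ := hright
    have hle : u ≤ sInf S := by
      refine le_csInf hSne fun r hr => ?_
      by_contra hlt
      rw [not_le] at hlt
      have h1 : x r = x (sInf S) := hsub ⟨csInf_le hbdd hr, hlt⟩
      exact hr.2 (h1.trans heq)
    exact hle.not_gt hu
  · push Not at hne
    exact ⟨t, ⟨hst, le_rfl⟩, fun r hr hrt => hne r ⟨hr, hrt.le⟩, Or.inr rfl⟩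

/-- Up to its first change the path evolves as if frozen. A change moves some integer queue length
and so uses a driving point; it was the only one, hence nothing happens afterwards. -/
theorem IsDrivenPath.eq_of_total_le_one [Fintype V] (h : IsDrivenPath C K Dm Am x) {s t : ℝ≥0}
    (hst : s ≤ t)
    (htot : ∑ i, ((Dm i).real (Ioc s t) + (Am i).real (Ioc s t ×ˢ Iic K)) ≤ 1) (i : V) :
    (x t i : ℝ) = x s i - (if 0 < x s i then 1 else 0) * (Dm i).real (Ioc s t)
      + (Am i).real (Ioc s t ×ˢ Iic (C i (x s)).toNNReal) := by
  obtain ⟨τ, ⟨hsτ, hτt⟩, hconst, hcase⟩ := exists_first_change h.cadlag hst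
  rcases hcase with hne | rfl
  swap
  · exact h.eq_of_constant hst hconst i
  have hIoc : Ioc s t = Ioc s τ ∪ Ioc τ t := (Ioc_union_Ioc_eq_Ioc hsτ hτt).symm
  have hdis : Disjoint (Ioc s τ) (Ioc τ t) := by
    rw [Set.disjoint_left]
    exact fun r hr hr' => hr'.1.not_ge hr.2
  have hDadd : ∀ j, (Dm j).real (Ioc s t) = (Dm j).real (Ioc s τ) + (Dm j).real (Ioc τ t) := by
    intro j
    rw [hIoc]
    exact measureReal_union hdis measurableSet_Ioc (h.departures_Ioc_ne_top s τ j)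
      (h.departures_Ioc_ne_top τ t j)
  have hAadd : ∀ j (c : ℝ≥0), c ≤ K → (Am j).real (Ioc s t ×ˢ Iic c)
      = (Am j).real (Ioc s τ ×ˢ Iic c) + (Am j).real (Ioc τ t ×ˢ Iic c) := by
    intro j c hc
    rw [hIoc, Set.union_prod]
    exact measureReal_union (Disjoint.set_prod_left hdis _ _)
      (measurableSet_Ioc.prod measurableSet_Iic)
      ((measure_mono (Set.prod_mono subset_rfl (Iic_subset_Iic.2 hc))).trans_lt
        (h.arrivals_Ioc_ne_top s τ j).lt_top).ne
      ((measure_mono (Set.prod_mono subset_rfl (Iic_subset_Iic.2 hc))).trans_lt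
        (h.arrivals_Ioc_ne_top τ t j).lt_top).ne
  obtain ⟨j, hj⟩ : ∃ j, x τ j ≠ x s j := by
    by_contra hcon
    push Not at hcon
    exact hne (funext hcon)
  have hone : 1 ≤ (Dm j).real (Ioc s τ) + (Am j).real (Ioc s τ ×ˢ Iic K) := by
    have h1 := h.abs_sub_le hsτ j
    have h2 : (1 : ℝ) ≤ |(x τ j : ℝ) - x s j| := by
      have : (1 : ℤ) ≤ |(x τ j : ℤ) - x s j| := Int.one_le_abs (sub_ne_zero.2 (by exact_mod_cast hj))
      exact_mod_cast this
    linarith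
  have hnn : ∀ (a b : ℝ≥0) (k : V), 0 ≤ (Dm k).real (Ioc a b) + (Am k).real (Ioc a b ×ˢ Iic K) :=
    fun a b k => add_nonneg measureReal_nonneg measureReal_nonneg
  have hrest : ∑ k, ((Dm k).real (Ioc τ t) + (Am k).real (Ioc τ t ×ˢ Iic K)) ≤ 0 := by
    have h1 : ∑ k, ((Dm k).real (Ioc s t) + (Am k).real (Ioc s t ×ˢ Iic K))
        = ∑ k, ((Dm k).real (Ioc s τ) + (Am k).real (Ioc s τ ×ˢ Iic K))
          + ∑ k, ((Dm k).real (Ioc τ t) + (Am k).real (Ioc τ t ×ˢ Iic K)) := by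
      rw [← Finset.sum_add_distrib]
      refine Finset.sum_congr rfl fun k _ => ?_
      rw [hDadd k, hAadd k K le_rfl]
      ring
    have h2 := Finset.single_le_sum (f := fun k => (Dm k).real (Ioc s τ)
      + (Am k).real (Ioc s τ ×ˢ Iic K)) (fun k _ => hnn s τ k) (Finset.mem_univ j)
    linarith
  have hzero : (Dm i).real (Ioc τ t) + (Am i).real (Ioc τ t ×ˢ Iic K) ≤ 0 :=
    (Finset.single_le_sum (f := fun k => (Dm k).real (Ioc τ t)
      + (Am k).real (Ioc τ t ×ˢ Iic K)) (fun k _ => hnn τ t k) (Finset.mem_univ i)).trans hrest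
  have hD0 : (Dm i).real (Ioc τ t) = 0 := by
    have h1 : 0 ≤ (Dm i).real (Ioc τ t) := measureReal_nonneg
    have h2 : 0 ≤ (Am i).real (Ioc τ t ×ˢ Iic K) := measureReal_nonneg
    linarith
  have hCK : (C i (x s)).toNNReal ≤ K := Real.toNNReal_le_iff_le_coe.2 (h.le_bound i _)
  have hA0 : (Am i).real (Ioc τ t ×ˢ Iic (C i (x s)).toNNReal) = 0 := by
    have h1 : (Am i).real (Ioc τ t ×ˢ Iic (C i (x s)).toNNReal)
        ≤ (Am i).real (Ioc τ t ×ˢ Iic K) :=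
      measureReal_mono (Set.prod_mono subset_rfl (Iic_subset_Iic.2 hCK))
        (h.arrivals_Ioc_ne_top τ t i)
    have h2 : 0 ≤ (Am i).real (Ioc τ t ×ˢ Iic (C i (x s)).toNNReal) := measureReal_nonneg
    have h3 : 0 ≤ (Dm i).real (Ioc τ t) := measureReal_nonneg
    linarith
  have hxt : (x t i : ℝ) = x τ i := by
    have := h.abs_sub_le hτt i
    exact sub_eq_zero.1 (abs_nonpos_iff.1 (this.trans hzero))
  rw [hxt, h.eq_of_constant hsτ hconst i, hDadd, hAadd i _ hCK, hD0, hA0, add_zero, add_zero]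

end Path

end JSQ

namespace JSQ

/-! ### One step of the occupancy process -/

section Step

variable {V : Type*} [Fintype V]

/-- The compensated number of arrivals at queues of length `l` minus departures from queues of
length `l + 1` during `(s,t]`, when the queue lengths are frozen at `x`. -/
noncomputable def frozenNoise (lam : ℝ≥0) (C : V → (V → ℕ) → ℝ) (w : V → ℝ) (l : ℕ) (s t : ℝ≥0)
    (x : V → ℕ) (n : (V → Measure ℝ≥0) × (V → Measure (ℝ≥0 × ℝ≥0))) : ℝ :=
  ∑ i, (w i * (if x i = l then 1 else 0)) *
      ((n.2 i).real (Ioc s t ×ˢ Iic (C i x).toNNReal) - lam * (t - s) * C i x)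
    - ∑ i, (w i * (if x i = l + 1 then 1 else 0)) * ((n.1 i).real (Ioc s t) - (t - s))

/-- The rate of change of the weighted fraction of queues of length at least `l + 1`. -/
noncomputable def tailDrift (lam : ℝ≥0) (C : V → (V → ℕ) → ℝ) (w : V → ℝ) (l : ℕ) (x : V → ℕ) :
    ℝ :=
  ∑ i, w i * (lam * (if x i = l then 1 else 0) * C i x - (if x i = l + 1 then 1 else 0))

theorem frozenNoise_add_tailDrift (lam : ℝ≥0) (C : V → (V → ℕ) → ℝ) (w : V → ℝ) (l : ℕ)
    (s t : ℝ≥0) (x : V → ℕ) (n : (V → Measure ℝ≥0) × (V → Measure (ℝ≥0 × ℝ≥0))) :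
    frozenNoise lam C w l s t x n + (t - s) * tailDrift lam C w l x
      = ∑ i, w i * ((if x i = l then 1 else 0) *
          (n.2 i).real (Ioc s t ×ˢ Iic (C i x).toNNReal)
        - (if x i = l + 1 then 1 else 0) * (n.1 i).real (Ioc s t)) := by
  unfold frozenNoise tailDrift
  rw [Finset.mul_sum, ← Finset.sum_sub_distrib, ← Finset.sum_add_distrib]
  exact Finset.sum_congr rfl fun i _ => by ring

theorem level_step {y z l a b : ℕ} (hab : a + b ≤ 1)
    (h : (z : ℝ) = y - (if 0 < y then 1 else 0) * b + a) :
    (if l + 1 ≤ z then 1 else 0 : ℝ) - (if l + 1 ≤ y then 1 else 0)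
      = (if y = l then 1 else 0) * a - (if y = l + 1 then 1 else 0) * b := by
  have hz : z + (if 0 < y then 1 else 0) * b = y + a := by
    have : (z : ℝ) + (if 0 < y then 1 else 0) * b = y + a := by linarith
    exact_mod_cast this
  have hcases : (a = 0 ∧ b = 0) ∨ (a = 1 ∧ b = 0) ∨ (a = 0 ∧ b = 1) := by omega
  rcases hcases with ⟨rfl, rfl⟩ | ⟨rfl, rfl⟩ | ⟨rfl, rfl⟩ <;> split_ifs at hz ⊢ <;> simp <;> omega

/-- Let `n` be the number of driving points in the cell. The frozen step is exact for `n ≤ 1`; for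
`n ≥ 2` each server contributes an error of at most `1 + n`, below `2 * (n ^ 2 - n)`. This
expression vanishes for `n ≤ 1`, and for a Poisson count its mean is of second order in the length
of the cell. -/
theorem IsDrivenPath.abs_tailMass_step_le {C : V → (V → ℕ) → ℝ} {K : ℝ≥0} {Dm : V → Measure ℝ≥0}
    {Am : V → Measure (ℝ≥0 × ℝ≥0)} {x : ℝ≥0 → V → ℕ} (h : IsDrivenPath C K Dm Am x)
    (lam : ℝ≥0) {w : V → ℝ} (hw : ∀ i, 0 ≤ w i) (l : ℕ) {s t : ℝ≥0} (hst : s ≤ t) :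
    |tailMass w (l + 1) (x t) - tailMass w (l + 1) (x s)
        - (frozenNoise lam C w l s t (x s) (Dm, Am) + (t - s) * tailDrift lam C w l (x s))|
      ≤ (∑ i, w i) * (2 * ((∑ i, ((Dm i).real (Ioc s t) + (Am i).real (Ioc s t ×ˢ Iic K))) ^ 2
        - ∑ i, ((Dm i).real (Ioc s t) + (Am i).real (Ioc s t ×ˢ Iic K)))) := by
  choose b hb using fun i => h.departures_nat i (Ioc s t) measurableSet_Ioc
  choose a' ha' using fun i => h.arrivals_nat i (Ioc s t ×ˢ Iic K)
    (measurableSet_Ioc.prod measurableSet_Iic)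
  choose a ha using fun i => h.arrivals_nat i (Ioc s t ×ˢ Iic (C i (x s)).toNNReal)
    (measurableSet_Ioc.prod measurableSet_Iic)
  have haa' : ∀ i, a i ≤ a' i := by
    intro i
    have hCK : (C i (x s)).toNNReal ≤ K := Real.toNNReal_le_iff_le_coe.2 (h.le_bound i _)
    have : (Am i).real (Ioc s t ×ˢ Iic (C i (x s)).toNNReal) ≤ (Am i).real (Ioc s t ×ˢ Iic K) :=
      measureReal_mono (Set.prod_mono subset_rfl (Iic_subset_Iic.2 hCK))
        (h.arrivals_Ioc_ne_top s t i)
    rw [ha, ha'] at this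
    exact_mod_cast this
  set n : ℕ := ∑ i, (b i + a' i) with hn
  have hsum : ∑ i, ((Dm i).real (Ioc s t) + (Am i).real (Ioc s t ×ˢ Iic K)) = n := by
    simp only [hb, ha', hn]
    push_cast
    rfl
  have hle : ∀ i, a i + b i ≤ n := fun i =>
    (by have := haa' i; omega : a i + b i ≤ b i + a' i).trans
      (Finset.single_le_sum (f := fun i => b i + a' i) (fun _ _ => zero_le) (Finset.mem_univ i))
  rw [frozenNoise_add_tailDrift, hsum]
  have hrw : tailMass w (l + 1) (x t) - tailMass w (l + 1) (x s)
      - ∑ i, w i * ((if x s i = l then 1 else 0) *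
          ((Dm, Am).2 i).real (Ioc s t ×ˢ Iic (C i (x s)).toNNReal)
        - (if x s i = l + 1 then 1 else 0) * ((Dm, Am).1 i).real (Ioc s t))
      = ∑ i, w i * ((if l + 1 ≤ x t i then 1 else 0 : ℝ) - (if l + 1 ≤ x s i then 1 else 0)
        - ((if x s i = l then 1 else 0) * a i - (if x s i = l + 1 then 1 else 0) * b i)) := by
    unfold tailMass
    simp only [ha, hb]
    rw [← Finset.sum_sub_distrib, ← Finset.sum_sub_distrib]
    exact Finset.sum_congr rfl fun i _ => by ring
  rw [hrw, Finset.sum_mul]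
  refine (Finset.abs_sum_le_sum_abs _ _).trans (Finset.sum_le_sum fun i _ => ?_)
  rw [abs_mul, abs_of_nonneg (hw i)]
  refine mul_le_mul_of_nonneg_left ?_ (hw i)
  rcases le_or_gt n 1 with h1 | h1
  · have hstep := h.eq_of_total_le_one hst (by rw [hsum]; exact_mod_cast h1) i
    rw [hb, ha] at hstep
    rw [level_step ((hle i).trans h1) hstep, sub_self, abs_zero]
    have : (n : ℝ) ≤ (n : ℝ) ^ 2 := by exact_mod_cast Nat.le_self_pow two_ne_zero n
    linarith
  · have h2 : (2 : ℝ) ≤ n := by exact_mod_cast h1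
    have h3 : (a i : ℝ) + b i ≤ n := by exact_mod_cast hle i
    have h4 : (0 : ℝ) ≤ a i := Nat.cast_nonneg _
    have h5 : (0 : ℝ) ≤ b i := Nat.cast_nonneg _
    have h6 : 1 + (n : ℝ) ≤ 2 * ((n : ℝ) ^ 2 - n) := by nlinarith
    refine le_trans ?_ h6
    rw [abs_le]
    split_ifs <;> constructor <;> linarith

end Step

/-! ### Second moments of sums of independent compensated counts -/

section Moments

variable {Ω E V : Type*} [MeasurableSpace Ω] [MeasurableSpace E] [Fintype V]
  {M : V → Ω → Measure E} {ν : Measure E} {μ : Measure Ω} [IsProbabilityMeasure μ]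

theorem measurable_real_apply {B : Set E} (hB : MeasurableSet B) :
    Measurable fun m : Measure E => m.real B :=
  (Measure.measurable_coe hB).ennreal_toReal

theorem memLp_sum_compensated (hM : ∀ i, IsPoissonRandomMeasure (M i) ν μ) {B : V → Set E}
    (hB : ∀ i, MeasurableSet (B i)) {r : V → ℝ≥0} (hr : ∀ i, ν (B i) = r i) (c : V → ℝ) :
    MemLp (fun ω => ∑ i, c i * ((M i ω).real (B i) - r i)) 2 μ :=
  memLp_finsetSum _ fun i _ =>
    (((hM i).memLp_real (hB i) (hr i)).sub (memLp_const _)).const_mul _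

theorem integral_sum_compensated (hM : ∀ i, IsPoissonRandomMeasure (M i) ν μ) {B : V → Set E}
    (hB : ∀ i, MeasurableSet (B i)) {r : V → ℝ≥0} (hr : ∀ i, ν (B i) = r i) (c : V → ℝ) :
    ∫ ω, ∑ i, c i * ((M i ω).real (B i) - r i) ∂μ = 0 := by
  have hi : ∀ i, Integrable (fun ω => (M i ω).real (B i)) μ := fun i =>
    ((hM i).memLp_real (hB i) (hr i)).integrable one_le_two
  rw [integral_finsetSum (f := fun i ω => c i * ((M i ω).real (B i) - r i)) _
    fun i _ => ((hi i).sub (integrable_const _)).const_mul _]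
  refine Finset.sum_eq_zero fun i _ => ?_
  rw [integral_const_mul, integral_sub (hi i) (integrable_const _),
    (hM i).integral_real (hB i) (hr i)]
  simp

theorem integral_sum_compensated_sq (hM : ∀ i, IsPoissonRandomMeasure (M i) ν μ)
    (hind : iIndepFun M μ) {B : V → Set E} (hB : ∀ i, MeasurableSet (B i)) {r : V → ℝ≥0}
    (hr : ∀ i, ν (B i) = r i) (c : V → ℝ) :
    ∫ ω, (∑ i, c i * ((M i ω).real (B i) - r i)) ^ 2 ∂μ = ∑ i, c i ^ 2 * r i := by
  have h1 := variance_of_integral_eq_zero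
    (memLp_sum_compensated hM hB hr c).aestronglyMeasurable.aemeasurable
    (integral_sum_compensated hM hB hr c)
  rw [← h1]
  have h2 : (fun ω => ∑ i, c i * ((M i ω).real (B i) - r i))
      = ∑ i, fun ω => c i * ((M i ω).real (B i) - r i) := by
    funext ω
    simp
  rw [h2, IndepFun.variance_sum]
  · refine Finset.sum_congr rfl fun i _ => ?_
    rw [variance_const_mul, variance_sub_const ((hM i).memLp_real (hB i)
      (hr i)).aestronglyMeasurable, (hM i).variance_real (hB i) (hr i)]
  · exact fun i _ => (((hM i).memLp_real (hB i) (hr i)).sub (memLp_const _)).const_mul _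
  · intro i _ j _ hij
    exact (hind.indepFun hij).comp
      (φ := fun m : Measure E => c i * (m.real (B i) - r i))
      (ψ := fun m : Measure E => c j * (m.real (B j) - r j))
      (((measurable_real_apply (hB i)).sub_const _).const_mul _)
      (((measurable_real_apply (hB j)).sub_const _).const_mul _)

end Moments

/-! ### Orthogonality of noise increments -/

section MartingaleIncrement

variable {Ω E S : Type*} {𝒢 : MeasurableSpace Ω} [mΩ : MeasurableSpace Ω] [MeasurableSpace E]
  [MeasurableSpace S] [Countable S] [MeasurableSingletonClass S] {μ : Measure Ω}
  [IsProbabilityMeasure μ]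

/-- The second moment of a sum grows by at most `c` when a term is added which, given the past, is
centred with second moment at most `c`. -/
theorem integral_add_sq_le_of_indep (h𝒢 : 𝒢 ≤ mΩ) {N : Ω → E} (hN : Measurable N)
    (hind : Indep 𝒢 (MeasurableSpace.comap N inferInstance) μ) {x : Ω → S} (hx : Measurable[𝒢] x)
    {Y : Ω → ℝ} (hY : Measurable[𝒢] Y) (hY2 : MemLp Y 2 μ) {g : S → E → ℝ}
    (hg : ∀ y, Measurable (g y)) (hg2 : MemLp (fun ω => g (x ω) (N ω)) 2 μ)
    (hmean : ∀ y, ∫ ω, g y (N ω) ∂μ = 0) {c : ℝ} (hc : ∀ y, ∫ ω, g y (N ω) ^ 2 ∂μ ≤ c) :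
    ∫ ω, (Y ω + g (x ω) (N ω)) ^ 2 ∂μ ≤ ∫ ω, Y ω ^ 2 ∂μ + c := by
  have hZ : Measurable[𝒢] fun ω => (Y ω, x ω) := hY.prodMk hx
  have hZ' : Measurable fun ω => (Y ω, x ω) := hZ.mono h𝒢 le_rfl
  have hindep : IndepFun (fun ω => (Y ω, x ω)) N μ :=
    indep_of_indep_of_le_left hind hZ.comap_le
  have hmap := (indepFun_iff_map_prod_eq_prod_map_map hZ'.aemeasurable hN.aemeasurable).1 hindep
  -- The state space is countable, so measurability in the noise for each fixed state is joint
  -- measurability.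
  have hG : Measurable fun p : (ℝ × S) × E => g p.1.2 p.2 :=
    (measurable_from_prod_countable_right (f := fun q : S × E => g q.1 q.2) hg).comp
      ((measurable_snd.comp measurable_fst).prodMk measurable_snd)
  have hpair : Measurable fun ω => ((Y ω, x ω), N ω) := hZ'.prodMk hN
  have hinst : IsProbabilityMeasure (μ.map N) := Measure.isProbabilityMeasure_map hN.aemeasurable
  have hinst' : IsProbabilityMeasure (μ.map fun ω => (Y ω, x ω)) :=
    Measure.isProbabilityMeasure_map hZ'.aemeasurable
  -- By independence the noise can be integrated first, with the past `(Y, x)` held fixed; there `g`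
  -- is centred.
  have hcross : ∫ ω, Y ω * g (x ω) (N ω) ∂μ = 0 := by
    have hF : Measurable fun p : (ℝ × S) × E => p.1.1 * g p.1.2 p.2 :=
      (measurable_fst.comp measurable_fst).mul hG
    have hint : Integrable (fun p : (ℝ × S) × E => p.1.1 * g p.1.2 p.2)
        ((μ.map fun ω => (Y ω, x ω)).prod (μ.map N)) := by
      rw [← hmap, integrable_map_measure hF.aestronglyMeasurable hpair.aemeasurable]
      exact hY2.integrable_mul hg2
    calc ∫ ω, Y ω * g (x ω) (N ω) ∂μ
        = ∫ p, p.1.1 * g p.1.2 p.2 ∂(μ.map fun ω => ((Y ω, x ω), N ω)) :=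
          (integral_map hpair.aemeasurable hF.aestronglyMeasurable).symm
      _ = ∫ z, ∫ n, z.1 * g z.2 n ∂(μ.map N) ∂(μ.map fun ω => (Y ω, x ω)) := by
          rw [hmap, integral_prod _ hint]
      _ = ∫ z : ℝ × S, 0 ∂(μ.map fun ω => (Y ω, x ω)) := by
          refine integral_congr_ae (Eventually.of_forall fun z => ?_)
          simp only
          rw [integral_const_mul, integral_map hN.aemeasurable (hg _).aestronglyMeasurable,
            hmean, mul_zero]
      _ = 0 := by simp
  have hsq : ∫ ω, g (x ω) (N ω) ^ 2 ∂μ ≤ c := by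
    have hF : Measurable fun p : (ℝ × S) × E => g p.1.2 p.2 ^ 2 := hG.pow_const 2
    have hint : Integrable (fun p : (ℝ × S) × E => g p.1.2 p.2 ^ 2)
        ((μ.map fun ω => (Y ω, x ω)).prod (μ.map N)) := by
      rw [← hmap, integrable_map_measure hF.aestronglyMeasurable hpair.aemeasurable]
      exact hg2.integrable_sq
    calc ∫ ω, g (x ω) (N ω) ^ 2 ∂μ
        = ∫ p, g p.1.2 p.2 ^ 2 ∂(μ.map fun ω => ((Y ω, x ω), N ω)) :=
          (integral_map hpair.aemeasurable hF.aestronglyMeasurable).symm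
      _ = ∫ z, ∫ n, g z.2 n ^ 2 ∂(μ.map N) ∂(μ.map fun ω => (Y ω, x ω)) := by
          rw [hmap, integral_prod _ hint]
      _ ≤ ∫ z : ℝ × S, c ∂(μ.map fun ω => (Y ω, x ω)) := by
          refine integral_mono_of_nonneg
            (Eventually.of_forall fun z => integral_nonneg fun n => sq_nonneg _)
            (integrable_const _) (Eventually.of_forall fun z => ?_)
          simp only
          rw [integral_map hN.aemeasurable ((hg _).pow_const 2).aestronglyMeasurable]
          exact hc _
      _ = c := by simp
  have hexp : ∀ ω, (Y ω + g (x ω) (N ω)) ^ 2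
      = Y ω ^ 2 + 2 * (Y ω * g (x ω) (N ω)) + g (x ω) (N ω) ^ 2 := fun ω => by ring
  simp_rw [hexp]
  have hi1 : Integrable (fun ω => 2 * (Y ω * g (x ω) (N ω))) μ :=
    (hY2.integrable_mul hg2).const_mul 2
  have hi2 : Integrable (fun ω => Y ω ^ 2 + 2 * (Y ω * g (x ω) (N ω))) μ :=
    hY2.integrable_sq.add hi1
  rw [integral_add hi2 hg2.integrable_sq,
    integral_add hY2.integrable_sq hi1, integral_const_mul, hcross]
  linarith

end MartingaleIncrement

end JSQ

namespace JSQ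

/-! ### The queue-length process on a time grid -/

section Grid

set_option linter.unusedSectionVars false

theorem measurable_measure_restrict {E : Type*} [MeasurableSpace E] {S : Set E}
    (hS : MeasurableSet S) : Measurable fun m : Measure E => m.restrict S := by
  refine Measure.measurable_of_measurable_coe _ fun s hs => ?_
  simp only [Measure.restrict_apply hs]
  exact Measure.measurable_coe (hs.inter hS)

variable {V : Type*} [Fintype V] [DecidableEq V] {G : SimpleGraph V} [DecidableRel G.Adj]
  {lam : ℝ≥0} {d : ℕ} {rule : V → V → (V → ℕ) → ℝ} {Ω : Type*} [mΩ : MeasurableSpace Ω]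
  {μ : Measure Ω} [IsProbabilityMeasure μ] {ℱ : Filtration ℝ≥0 mΩ} {D : V → Ω → Measure ℝ≥0}
  {A : V → Ω → Measure (ℝ≥0 × ℝ≥0)} {X : ℝ≥0 → Ω → V → ℕ} {K : ℝ≥0}

/-- Finiteness at all integer times is a countable conjunction and implies finiteness at all times,
outside one null set. -/
theorem IsJSQProcess.ae_isDrivenPath (hX : IsJSQProcess G lam d rule μ ℱ D A X)
    (hC : ∀ i x, arrivalIntensity G d rule i x ∈ Icc 0 (K : ℝ)) :
    ∀ᵐ ω ∂μ, IsDrivenPath (arrivalIntensity G d rule) K (fun i => D i ω) (fun i => A i ω)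
      (fun t => X t ω) := by
  have hD : ∀ᵐ ω ∂μ, ∀ (n : ℕ) i, D i ω (Iic (n : ℝ≥0)) ≠ ∞ :=
    ae_all_iff.2 fun n => ae_all_iff.2 fun i =>
      (hX.departures i).ae_ne_top measurableSet_Iic (lebesgue_Iic _)
  have hA : ∀ᵐ ω ∂μ, ∀ (n : ℕ) i, A i ω (Iic (n : ℝ≥0) ×ˢ Iic K) ≠ ∞ :=
    ae_all_iff.2 fun n => ae_all_iff.2 fun i =>
      (hX.arrivals i).ae_ne_top (measurableSet_Iic.prod measurableSet_Iic)
        (intensity_Iic_prod_Iic lam n K)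
  filter_upwards [hD, hA, hX.evolution] with ω h1 h2 h3
  refine ⟨fun i y => (hC i y).1, fun i y => (hC i y).2, hX.cadlag ω, fun t i => ?_, fun t i => ?_,
    fun i B hB => (hX.departures i).exists_real_eq ω hB,
    fun i B hB => (hX.arrivals i).exists_real_eq ω hB, h3⟩
  · obtain ⟨n, hn⟩ := exists_nat_ge t
    exact ((measure_mono (Iic_subset_Iic.2 hn)).trans_lt (h1 n i).lt_top).ne
  · obtain ⟨n, hn⟩ := exists_nat_ge t
    exact ((measure_mono (Set.prod_mono (Iic_subset_Iic.2 hn) subset_rfl)).trans_lt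
      (h2 n i).lt_top).ne

/-- The number of departure points and of arrival points below level `K` during `(s,t]`. -/
noncomputable def totalCount (D : V → Ω → Measure ℝ≥0) (A : V → Ω → Measure (ℝ≥0 × ℝ≥0)) (K : ℝ≥0)
    (s t : ℝ≥0) (ω : Ω) : ℝ :=
  ∑ i, ((D i ω).real (Ioc s t) + (A i ω).real (Ioc s t ×ˢ Iic K))

theorem IsJSQProcess.memLp_totalCount (hX : IsJSQProcess G lam d rule μ ℱ D A X) (s t : ℝ≥0) :
    MemLp (totalCount D A K s t) 2 μ :=
  memLp_finsetSum _ fun i _ =>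
    ((hX.departures i).memLp_real measurableSet_Ioc (lebesgue_Ioc s t)).add
      ((hX.arrivals i).memLp_real (measurableSet_Ioc.prod measurableSet_Iic)
        (intensity_Ioc_prod_Iic lam s t K))

theorem IsJSQProcess.integral_totalCount (hX : IsJSQProcess G lam d rule μ ℱ D A X) (s t : ℝ≥0) :
    ∫ ω, totalCount D A K s t ω ∂μ = Fintype.card V * (1 + lam * K) * (t - s : ℝ≥0) := by
  have h1 : ∀ i, Integrable (fun ω => (D i ω).real (Ioc s t)) μ := fun i =>
    ((hX.departures i).memLp_real measurableSet_Ioc (lebesgue_Ioc s t)).integrable one_le_two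
  have h2 : ∀ i, Integrable (fun ω => (A i ω).real (Ioc s t ×ˢ Iic K)) μ := fun i =>
    ((hX.arrivals i).memLp_real (measurableSet_Ioc.prod measurableSet_Iic)
        (intensity_Ioc_prod_Iic lam s t K)).integrable one_le_two
  unfold totalCount
  rw [integral_finsetSum (f := fun i ω => (D i ω).real (Ioc s t)
    + (A i ω).real (Ioc s t ×ˢ Iic K)) _ fun i _ => (h1 i).add (h2 i)]
  simp_rw [fun i => integral_add (h1 i) (h2 i),
    fun i => (hX.departures i).integral_real measurableSet_Ioc (lebesgue_Ioc s t),
    fun i => (hX.arrivals i).integral_real (measurableSet_Ioc.prod measurableSet_Iic)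
        (intensity_Ioc_prod_Iic lam s t K)]
  simp only [Finset.sum_const, Finset.card_univ, nsmul_eq_mul]
  push_cast
  ring

theorem IsJSQProcess.variance_totalCount (hX : IsJSQProcess G lam d rule μ ℱ D A X) (s t : ℝ≥0) :
    variance (totalCount D A K s t) μ = Fintype.card V * (1 + lam * K) * (t - s : ℝ≥0) := by
  have h1 : ∀ i, MemLp (fun ω => (D i ω).real (Ioc s t)) 2 μ := fun i =>
    (hX.departures i).memLp_real measurableSet_Ioc (lebesgue_Ioc s t)
  have h2 : ∀ i, MemLp (fun ω => (A i ω).real (Ioc s t ×ˢ Iic K)) 2 μ := fun i =>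
    (hX.arrivals i).memLp_real (measurableSet_Ioc.prod measurableSet_Iic)
        (intensity_Ioc_prod_Iic lam s t K)
  have hsplit : totalCount D A K s t = (∑ i, fun ω => (D i ω).real (Ioc s t))
      + ∑ i, fun ω => (A i ω).real (Ioc s t ×ˢ Iic K) := by
    funext ω
    simp [totalCount, Finset.sum_add_distrib]
  have hind : IndepFun (∑ i, fun ω => (D i ω).real (Ioc s t))
      (∑ i, fun ω => (A i ω).real (Ioc s t ×ˢ Iic K)) μ := by
    have := hX.indep_departures_arrivals.comp
      (φ := fun m : V → Measure ℝ≥0 => ∑ i, (m i).real (Ioc s t))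
      (ψ := fun m : V → Measure (ℝ≥0 × ℝ≥0) => ∑ i, (m i).real (Ioc s t ×ˢ Iic K))
      (Finset.measurable_fun_sum _ fun i _ =>
        (measurable_real_apply measurableSet_Ioc).comp (measurable_pi_apply i))
      (Finset.measurable_fun_sum _ fun i _ =>
        (measurable_real_apply (measurableSet_Ioc.prod measurableSet_Iic)).comp
          (measurable_pi_apply i))
    convert! this using 1 <;> · funext ω; simp
  have hv1 : variance (∑ i, fun ω => (D i ω).real (Ioc s t)) μ
      = ∑ i : V, ((t - s : ℝ≥0) : ℝ) := by
    rw [IndepFun.variance_sum (fun i _ => h1 i) fun i _ j _ hij =>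
      (hX.indep_departures.indepFun hij).comp (measurable_real_apply measurableSet_Ioc)
        (measurable_real_apply measurableSet_Ioc)]
    exact Finset.sum_congr rfl fun i _ =>
      (hX.departures i).variance_real measurableSet_Ioc (lebesgue_Ioc s t)
  have hv2 : variance (∑ i, fun ω => (A i ω).real (Ioc s t ×ˢ Iic K)) μ
      = ∑ i : V, ((lam * (t - s) * K : ℝ≥0) : ℝ) := by
    rw [IndepFun.variance_sum (fun i _ => h2 i) fun i _ j _ hij =>
      (hX.indep_arrivals.indepFun hij).comp
        (measurable_real_apply (measurableSet_Ioc.prod measurableSet_Iic))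
        (measurable_real_apply (measurableSet_Ioc.prod measurableSet_Iic))]
    exact Finset.sum_congr rfl fun i _ =>
      (hX.arrivals i).variance_real (measurableSet_Ioc.prod measurableSet_Iic)
        (intensity_Ioc_prod_Iic lam s t K)
  rw [hsplit, hind.variance_add (memLp_finsetSum' _ fun i _ => h1 i)
    (memLp_finsetSum' _ fun i _ => h2 i), hv1, hv2]
  simp only [Finset.sum_const, Finset.card_univ, nsmul_eq_mul]
  push_cast
  ring

/-- The variance of a sum of independent Poisson counts equals its mean, so the second factorial
moment is the square of the mean and is quadratic in the length of the cell. -/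
theorem IsJSQProcess.integral_totalCount_sq_sub (hX : IsJSQProcess G lam d rule μ ℱ D A X)
    (s t : ℝ≥0) :
    ∫ ω, (totalCount D A K s t ω ^ 2 - totalCount D A K s t ω) ∂μ
      = (Fintype.card V * (1 + lam * K) * (t - s : ℝ≥0)) ^ 2 := by
  have hm := hX.memLp_totalCount (K := K) s t
  have hv := hX.variance_totalCount (K := K) s t
  rw [variance_eq_sub hm] at hv
  simp only [Pi.pow_apply] at hv
  rw [integral_sub hm.integrable_sq (hm.integrable one_le_two)]
  rw [hX.integral_totalCount s t] at hv ⊢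
  linarith

theorem measurable_frozenNoise (lam : ℝ≥0) (C : V → (V → ℕ) → ℝ) (w : V → ℝ) (l : ℕ) (s t : ℝ≥0)
    (y : V → ℕ) : Measurable (frozenNoise lam C w l s t y) := by
  refine Measurable.sub ?_ ?_
  · refine Finset.measurable_fun_sum _ fun i _ => Measurable.const_mul (Measurable.sub_const ?_ _) _
    exact (measurable_real_apply (measurableSet_Ioc.prod measurableSet_Iic)).comp
      ((measurable_pi_apply i).comp measurable_snd)
  · refine Finset.measurable_fun_sum _ fun i _ => Measurable.const_mul (Measurable.sub_const ?_ _) _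
    exact (measurable_real_apply measurableSet_Ioc).comp
      ((measurable_pi_apply i).comp measurable_fst)

/-- The noise of a cell reads only driving points after `s`, which is the part that `indep_future`
makes independent of `ℱ s`. -/
theorem frozenNoise_restrict_Ioi (lam : ℝ≥0) (C : V → (V → ℕ) → ℝ) (w : V → ℝ) (l : ℕ)
    (s t : ℝ≥0) (y : V → ℕ) (n : V → Measure ℝ≥0) (m : V → Measure (ℝ≥0 × ℝ≥0)) :
    frozenNoise lam C w l s t y
      (fun i => (n i).restrict (Ioi s), fun i => (m i).restrict (Ioi s ×ˢ univ))
      = frozenNoise lam C w l s t y (n, m) := by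
  unfold frozenNoise
  have h1 : ∀ c : ℝ≥0, Ioc s t ×ˢ Iic c ∩ Ioi s ×ˢ univ = Ioc s t ×ˢ Iic c := fun c =>
    inter_eq_left.2 (Set.prod_mono (fun _ h => h.1) (subset_univ _))
  have h2 : Ioc s t ∩ Ioi s = Ioc s t := inter_eq_left.2 fun _ h => h.1
  simp only [measureReal_restrict_apply measurableSet_Ioc,
    measureReal_restrict_apply (measurableSet_Ioc.prod measurableSet_Iic), h1, h2]

/-- The noise of a cell reads only driving points up to `t`, whence its adaptedness. -/
theorem frozenNoise_restrict_Iic (lam : ℝ≥0) (C : V → (V → ℕ) → ℝ) (w : V → ℝ) (l : ℕ)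
    (s t : ℝ≥0) (y : V → ℕ) (n : V → Measure ℝ≥0) (m : V → Measure (ℝ≥0 × ℝ≥0)) :
    frozenNoise lam C w l s t y
      (fun i => (n i).restrict (Iic t), fun i => (m i).restrict (Iic t ×ˢ univ))
      = frozenNoise lam C w l s t y (n, m) := by
  unfold frozenNoise
  have h1 : ∀ c : ℝ≥0, Ioc s t ×ˢ Iic c ∩ Iic t ×ˢ univ = Ioc s t ×ˢ Iic c := fun c =>
    inter_eq_left.2 (Set.prod_mono (fun _ h => h.2) (subset_univ _))
  have h2 : Ioc s t ∩ Iic t = Ioc s t := inter_eq_left.2 fun _ h => h.2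
  simp only [measureReal_restrict_apply measurableSet_Ioc,
    measureReal_restrict_apply (measurableSet_Ioc.prod measurableSet_Iic), h1, h2]

/-- The frozen noise along the process. -/
noncomputable def stepNoise (lam : ℝ≥0) (C : V → (V → ℕ) → ℝ) (D : V → Ω → Measure ℝ≥0)
    (A : V → Ω → Measure (ℝ≥0 × ℝ≥0)) (X : ℝ≥0 → Ω → V → ℕ) (w : V → ℝ) (l : ℕ) (s t : ℝ≥0)
    (ω : Ω) : ℝ :=
  frozenNoise lam C w l s t (X s ω) (fun i => D i ω, fun i => A i ω)

theorem IsJSQProcess.measurable_stepNoise (hX : IsJSQProcess G lam d rule μ ℱ D A X) (w : V → ℝ)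
    (l : ℕ) {s t : ℝ≥0} (hst : s ≤ t) :
    Measurable[ℱ t] (stepNoise lam (arrivalIntensity G d rule) D A X w l s t) := by
  have h1 : Measurable fun p : (V → ℕ) × ((V → Measure ℝ≥0) × (V → Measure (ℝ≥0 × ℝ≥0))) =>
      frozenNoise lam (arrivalIntensity G d rule) w l s t p.1 p.2 :=
    measurable_from_prod_countable_right fun y => measurable_frozenNoise _ _ _ _ _ _ y
  have h2 : Measurable[ℱ t] fun ω => (X s ω, (fun i => (D i ω).restrict (Iic t),
      fun i => (A i ω).restrict (Iic t ×ˢ univ))) := by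
    refine Measurable.prodMk ((hX.adapted s).mono (ℱ.mono hst) le_rfl) (Measurable.prodMk ?_ ?_)
    · exact @measurable_pi_lambda _ _ _ (ℱ t) _ _ fun i => hX.adapted_departures t i
    · exact @measurable_pi_lambda _ _ _ (ℱ t) _ _ fun i => hX.adapted_arrivals t i
  have h3 := h1.comp h2
  convert! h3 using 1
  funext ω
  exact (frozenNoise_restrict_Iic _ _ _ _ _ _ _ _ _).symm

/-- The box whose points are counted is random through the state; the deterministic box of height
`K` dominates it. -/
theorem IsJSQProcess.memLp_stepNoise (hX : IsJSQProcess G lam d rule μ ℱ D A X)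
    (hC : ∀ i x, arrivalIntensity G d rule i x ∈ Icc 0 (K : ℝ)) (w : V → ℝ)
    (l : ℕ) {s t : ℝ≥0} (hst : s ≤ t) :
    MemLp (stepNoise lam (arrivalIntensity G d rule) D A X w l s t) 2 μ := by
  have hts : (0 : ℝ) ≤ t - s := sub_nonneg.2 (by exact_mod_cast hst)
  have hdom : MemLp (fun ω => ∑ i, |w i| * ((A i ω).real (Ioc s t ×ˢ Iic K)
      + lam * (t - s) * K) + ∑ i, |w i| * ((D i ω).real (Ioc s t) + (t - s))) 2 μ := by
    refine MemLp.add ?_ ?_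
    · exact memLp_finsetSum _ fun i _ => (((hX.arrivals i).memLp_real
        (measurableSet_Ioc.prod measurableSet_Iic) (intensity_Ioc_prod_Iic lam s t K)).add
          (memLp_const _)).const_mul _
    · exact memLp_finsetSum _ fun i _ => (((hX.departures i).memLp_real measurableSet_Ioc
        (lebesgue_Ioc s t)).add (memLp_const _)).const_mul _
  refine hdom.mono' (((hX.measurable_stepNoise w l hst).mono (ℱ.le t)
    le_rfl).aestronglyMeasurable) ?_
  filter_upwards [hX.ae_isDrivenPath hC] with ω hω
  refine (abs_sub _ _).trans (add_le_add ?_ ?_)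
  · refine (Finset.abs_sum_le_sum_abs _ _).trans (Finset.sum_le_sum fun i _ => ?_)
    rw [abs_mul, abs_mul]
    have hCi := hC i (X s ω)
    have h1 : (A i ω).real (Ioc s t ×ˢ Iic (arrivalIntensity G d rule i (X s ω)).toNNReal)
        ≤ (A i ω).real (Ioc s t ×ˢ Iic K) :=
      measureReal_mono (Set.prod_mono subset_rfl
        (Iic_subset_Iic.2 (Real.toNNReal_le_iff_le_coe.2 hCi.2))) (hω.arrivals_Ioc_ne_top s t i)
    have h2 : lam * (t - s) * arrivalIntensity G d rule i (X s ω) ≤ lam * (t - s) * (K : ℝ) :=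
      mul_le_mul_of_nonneg_left hCi.2 (by positivity)
    have h3 : 0 ≤ lam * (t - s) * arrivalIntensity G d rule i (X s ω) :=
      mul_nonneg (by positivity) hCi.1
    have h4 : 0 ≤ (A i ω).real
      (Ioc s t ×ˢ Iic (arrivalIntensity G d rule i (X s ω)).toNNReal) := measureReal_nonneg
    refine mul_le_mul ?_ ?_ (abs_nonneg _) (abs_nonneg _)
    · refine mul_le_of_le_one_right (abs_nonneg _) ?_
      split_ifs <;> simp
    · rw [abs_le]
      constructor <;> linarith
  · refine (Finset.abs_sum_le_sum_abs _ _).trans (Finset.sum_le_sum fun i _ => ?_)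
    rw [abs_mul, abs_mul]
    have h4 : 0 ≤ (D i ω).real (Ioc s t) := measureReal_nonneg
    refine mul_le_mul ?_ ?_ (abs_nonneg _) (abs_nonneg _)
    · refine mul_le_of_le_one_right (abs_nonneg _) ?_
      split_ifs <;> simp
    · rw [abs_le]
      constructor <;> linarith

theorem integrable_sq_of_memLp {f : Ω → ℝ} (hf : MemLp f 2 μ) : Integrable (fun ω => f ω ^ 2) μ :=
  hf.integrable_sq

theorem IsJSQProcess.frozenNoise_moments (hX : IsJSQProcess G lam d rule μ ℱ D A X)
    (hC : ∀ i x, arrivalIntensity G d rule i x ∈ Icc 0 (K : ℝ)) (w : V → ℝ)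
    (l : ℕ) {s t : ℝ≥0} (hst : s ≤ t) (y : V → ℕ) :
    ∫ ω, frozenNoise lam (arrivalIntensity G d rule) w l s t y (fun i => D i ω, fun i => A i ω) ∂μ
      = 0 ∧
    ∫ ω, frozenNoise lam (arrivalIntensity G d rule) w l s t y
        (fun i => D i ω, fun i => A i ω) ^ 2 ∂μ
      ≤ 2 * (lam * K + 1) * (t - s) * ∑ i, w i ^ 2 := by
  set C := arrivalIntensity G d rule with hCdef
  have hts : (0 : ℝ) ≤ t - s := sub_nonneg.2 (by exact_mod_cast hst)
  have hrA : ∀ i, ((lam * (t - s) * (C i y).toNNReal : ℝ≥0) : ℝ) = lam * (t - s) * C i y := by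
    intro i
    rw [NNReal.coe_mul, NNReal.coe_mul, NNReal.coe_sub hst, Real.coe_toNNReal _ (hC i y).1]
  have hrD : ((t - s : ℝ≥0) : ℝ) = t - s := NNReal.coe_sub hst
  have hBA : ∀ i, MeasurableSet (Ioc s t ×ˢ Iic (C i y).toNNReal) := fun i =>
    measurableSet_Ioc.prod measurableSet_Iic
  have hνA := fun i => intensity_Ioc_prod_Iic lam s t (C i y).toNNReal
  have hBD : ∀ _ : V, MeasurableSet (Ioc s t) := fun _ => measurableSet_Ioc
  have hνD := fun _ : V => lebesgue_Ioc s t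
  set a : V → ℝ := fun i => w i * (if y i = l then 1 else 0) with ha
  set b : V → ℝ := fun i => w i * (if y i = l + 1 then 1 else 0) with hb
  have mA := memLp_sum_compensated hX.arrivals hBA hνA a
  have mD := memLp_sum_compensated hX.departures hBD hνD b
  have iA := integral_sum_compensated hX.arrivals hBA hνA a
  have iD := integral_sum_compensated hX.departures hBD hνD b
  have sA := integral_sum_compensated_sq hX.arrivals hX.indep_arrivals hBA hνA a
  have sD := integral_sum_compensated_sq hX.departures hX.indep_departures hBD hνD b
  simp only [hrA] at mA iA sA
  simp only [hrD] at mD iD sD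
  unfold frozenNoise
  constructor
  · rw [integral_sub (mA.integrable one_le_two) (mD.integrable one_le_two), iA, iD, sub_zero]
  -- Arrival and departure noise are separated by `(a - b) ^ 2 ≤ 2 * a ^ 2 + 2 * b ^ 2`, so their
  -- mutual independence is not needed here.
  · have hle : ∀ ω, (∑ i, a i * ((A i ω).real (Ioc s t ×ˢ Iic (C i y).toNNReal)
          - lam * (t - s) * C i y) - ∑ i, b i * ((D i ω).real (Ioc s t) - (t - s))) ^ 2
        ≤ 2 * (∑ i, a i * ((A i ω).real (Ioc s t ×ˢ Iic (C i y).toNNReal)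
          - lam * (t - s) * C i y)) ^ 2
          + 2 * (∑ i, b i * ((D i ω).real (Ioc s t) - (t - s))) ^ 2 := fun ω => by
      nlinarith [sq_nonneg ((∑ i, a i * ((A i ω).real (Ioc s t ×ˢ Iic (C i y).toNNReal)
          - lam * (t - s) * C i y)) + ∑ i, b i * ((D i ω).real (Ioc s t) - (t - s)))]
    have jA := (integrable_sq_of_memLp mA).const_mul 2
    have jD := (integrable_sq_of_memLp mD).const_mul 2
    refine (integral_mono_of_nonneg (Eventually.of_forall fun ω => sq_nonneg _) (jA.add jD)
      (Eventually.of_forall hle)).trans ?_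
    rw [integral_add' jA jD, integral_const_mul, integral_const_mul, sA, sD]
    rw [Finset.mul_sum, Finset.mul_sum, ← Finset.sum_add_distrib, Finset.mul_sum]
    refine Finset.sum_le_sum fun i _ => ?_
    have h1 : a i ^ 2 ≤ w i ^ 2 := by
      simp only [ha]
      split_ifs <;> simp [sq_nonneg]
    have h2 : b i ^ 2 ≤ w i ^ 2 := by
      simp only [hb]
      split_ifs <;> simp [sq_nonneg]
    have h3 : lam * (t - s) * C i y ≤ lam * (t - s) * (K : ℝ) :=
      mul_le_mul_of_nonneg_left (hC i y).2 (by positivity)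
    have h4 : a i ^ 2 * (lam * (t - s) * C i y) ≤ w i ^ 2 * (lam * (t - s) * (K : ℝ)) :=
      mul_le_mul h1 h3 (mul_nonneg (by positivity) (hC i y).1) (sq_nonneg _)
    have h5 : b i ^ 2 * (t - s) ≤ w i ^ 2 * (t - s) := mul_le_mul_of_nonneg_right h2 hts
    linarith

/-- The martingale part of the evolution on the grid `0, h, 2h, …`. -/
noncomputable def gridNoise (lam : ℝ≥0) (C : V → (V → ℕ) → ℝ) (D : V → Ω → Measure ℝ≥0)
    (A : V → Ω → Measure (ℝ≥0 × ℝ≥0)) (X : ℝ≥0 → Ω → V → ℕ) (w : V → ℝ) (l : ℕ) (h : ℝ≥0) (k : ℕ)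
    (ω : Ω) : ℝ :=
  ∑ j ∈ Finset.range k, stepNoise lam C D A X w l (j * h) ((j + 1 : ℕ) * h) ω

/-- The three claims go through the induction together: adaptedness and square integrability of the
past are what `integral_add_sq_le_of_indep` requires for the next increment. -/
theorem IsJSQProcess.gridNoise_bound (hX : IsJSQProcess G lam d rule μ ℱ D A X)
    (hC : ∀ i x, arrivalIntensity G d rule i x ∈ Icc 0 (K : ℝ)) (w : V → ℝ)
    (l : ℕ) (h : ℝ≥0) (k : ℕ) :
    Measurable[ℱ (k * h)] (gridNoise lam (arrivalIntensity G d rule) D A X w l h k) ∧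
    MemLp (gridNoise lam (arrivalIntensity G d rule) D A X w l h k) 2 μ ∧
    ∫ ω, gridNoise lam (arrivalIntensity G d rule) D A X w l h k ω ^ 2 ∂μ
      ≤ k * (2 * (lam * K + 1) * h * ∑ i, w i ^ 2) := by
  induction k with
  | zero =>
    have h0 : gridNoise lam (arrivalIntensity G d rule) D A X w l h 0 = fun _ => 0 := by
      funext ω; simp [gridNoise]
    rw [h0]
    refine ⟨measurable_const, memLp_const 0, by simp⟩
  | succ k ih =>
    obtain ⟨ih1, ih2, ih3⟩ := ih
    set C := arrivalIntensity G d rule with hCdef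
    have hle : (k : ℝ≥0) * h ≤ (k + 1 : ℕ) * h := by gcongr; simp
    have hsucc : gridNoise lam C D A X w l h (k + 1)
        = fun ω => gridNoise lam C D A X w l h k ω
          + stepNoise lam C D A X w l (k * h) ((k + 1 : ℕ) * h) ω := by
      funext ω
      simp only [gridNoise, Finset.sum_range_succ]
    rw [hsucc]
    have hm := hX.measurable_stepNoise w l hle
    have hm2 := hX.memLp_stepNoise hC w l hle
    refine ⟨(ih1.mono (ℱ.mono hle) le_rfl).add hm, ih2.add hm2, ?_⟩
    have hN : Measurable fun ω => ((fun i => (D i ω).restrict (Ioi (k * h : ℝ≥0)),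
        fun i => (A i ω).restrict (Ioi (k * h : ℝ≥0) ×ˢ univ)) :
        (V → Measure ℝ≥0) × (V → Measure (ℝ≥0 × ℝ≥0))) := by
      refine Measurable.prodMk (measurable_pi_lambda _ fun i => ?_)
        (measurable_pi_lambda _ fun i => ?_)
      · exact (measurable_measure_restrict measurableSet_Ioi).comp (hX.departures i).measurable
      · exact (measurable_measure_restrict (measurableSet_Ioi.prod MeasurableSet.univ)).comp
          (hX.arrivals i).measurable
    have hmom := hX.frozenNoise_moments hC w l hle
    have key := integral_add_sq_le_of_indep (ℱ.le (k * h)) hN (hX.indep_future (k * h))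
      (hX.adapted (k * h)) ih1 ih2
      (g := frozenNoise lam C w l (k * h) ((k + 1 : ℕ) * h))
      (fun y => measurable_frozenNoise lam C w l _ _ y)
      (by simp only [frozenNoise_restrict_Ioi]; exact hm2)
      (fun y => by simp only [frozenNoise_restrict_Ioi]; exact (hmom y).1)
      (fun y => by simp only [frozenNoise_restrict_Ioi]; exact (hmom y).2)
    simp only [frozenNoise_restrict_Ioi] at key
    refine key.trans ?_
    have : (((k + 1 : ℕ) * h : ℝ≥0) : ℝ) - ((k * h : ℝ≥0) : ℝ) = h := by push_cast; ring
    rw [this]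
    push_cast
    linarith

end Grid

end JSQ

namespace JSQ

/-! ### Approximate evolution on a grid and the initial law of large numbers -/

section Dynkin

set_option linter.unusedSectionVars false

theorem integral_abs_le_sqrt {Ω : Type*} [MeasurableSpace Ω] {μ : Measure Ω}
    [IsProbabilityMeasure μ] {f : Ω → ℝ} (hf : MemLp f 2 μ) :
    ∫ ω, |f ω| ∂μ ≤ √(∫ ω, f ω ^ 2 ∂μ) := by
  have h := variance_nonneg |f| μ
  rw [variance_eq_sub hf.abs] at h
  simp only [Pi.pow_apply, Pi.abs_apply, sq_abs] at h
  exact Real.le_sqrt_of_sq_le (by linarith)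

variable {V : Type*} [Fintype V] [DecidableEq V] {G : SimpleGraph V} [DecidableRel G.Adj]
  {lam : ℝ≥0} {d : ℕ} {rule : V → V → (V → ℕ) → ℝ} {Ω : Type*} [mΩ : MeasurableSpace Ω]
  {μ : Measure Ω} [IsProbabilityMeasure μ] {ℱ : Filtration ℝ≥0 mΩ} {D : V → Ω → Measure ℝ≥0}
  {A : V → Ω → Measure (ℝ≥0 × ℝ≥0)} {X : ℝ≥0 → Ω → V → ℕ} {K : ℝ≥0}

/-- On a fine grid, the weighted fraction of long queues is its initial value plus the accumulated
drift, up to a small error in mean. -/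
theorem IsJSQProcess.integral_abs_sub_sum_tailDrift_le (hX : IsJSQProcess G lam d rule μ ℱ D A X)
    (hC : ∀ i x, arrivalIntensity G d rule i x ∈ Icc 0 (K : ℝ)) {w : V → ℝ} (hw : ∀ i, 0 ≤ w i)
    (l : ℕ) (h : ℝ≥0) (k : ℕ) :
    ∫ ω, |tailMass w (l + 1) (X (k * h) ω) - tailMass w (l + 1) (X 0 ω)
        - ∑ j ∈ Finset.range k,
          h * tailDrift lam (arrivalIntensity G d rule) w l (X (j * h) ω)| ∂μ
      ≤ √(k * (2 * (lam * K + 1) * h * ∑ i, w i ^ 2))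
        + k * ((∑ i, w i) * (2 * (Fintype.card V * (1 + lam * K) * h) ^ 2)) := by
  set C := arrivalIntensity G d rule with hCdef
  obtain ⟨-, hN2, hN⟩ := hX.gridNoise_bound hC w l h k
  set R : ℕ → Ω → ℝ := fun j ω => (∑ i, w i) * (2 *
    (totalCount D A K (j * h) ((j + 1 : ℕ) * h) ω ^ 2
      - totalCount D A K (j * h) ((j + 1 : ℕ) * h) ω)) with hR
  have hsub : ∀ j : ℕ, ((j + 1 : ℕ) * h - j * h : ℝ≥0) = h := fun j => by
    push_cast
    rw [add_mul, one_mul, add_tsub_cancel_left]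
  have hsubR : ∀ j : ℕ, (((j + 1 : ℕ) * h : ℝ≥0) : ℝ) - ((j * h : ℝ≥0) : ℝ) = h := fun j => by
    push_cast; ring
  have hle : ∀ j : ℕ, (j : ℝ≥0) * h ≤ (j + 1 : ℕ) * h := fun j => by gcongr; simp
  have hRint : ∀ j, Integrable (R j) μ := fun j =>
    (((hX.memLp_totalCount _ _).integrable_sq.sub
      ((hX.memLp_totalCount _ _).integrable one_le_two)).const_mul 2).const_mul _
  have hRval : ∀ j, ∫ ω, R j ω ∂μ
      = (∑ i, w i) * (2 * (Fintype.card V * (1 + lam * K) * h) ^ 2) := by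
    intro j
    simp only [hR]
    rw [integral_const_mul, integral_const_mul, hX.integral_totalCount_sq_sub, hsub]
  have hpath : ∀ᵐ ω ∂μ, |tailMass w (l + 1) (X (k * h) ω) - tailMass w (l + 1) (X 0 ω)
        - ∑ j ∈ Finset.range k, h * tailDrift lam C w l (X (j * h) ω)|
      ≤ |gridNoise lam C D A X w l h k ω| + ∑ j ∈ Finset.range k, R j ω := by
    filter_upwards [hX.ae_isDrivenPath hC] with ω hω
    have htel := Finset.sum_range_sub (fun j : ℕ => tailMass w (l + 1) (X (j * h) ω)) k
    simp only [Nat.cast_zero, zero_mul] at htel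
    rw [← htel, ← Finset.sum_sub_distrib]
    have hstep : ∀ j : ℕ, |tailMass w (l + 1) (X ((j + 1 : ℕ) * h) ω)
          - tailMass w (l + 1) (X (j * h) ω)
          - h * tailDrift lam C w l (X (j * h) ω)
          - stepNoise lam C D A X w l (j * h) ((j + 1 : ℕ) * h) ω| ≤ R j ω := by
      intro j
      have := hω.abs_tailMass_step_le lam hw l (hle j)
      rw [hsubR] at this
      refine le_trans (le_of_eq ?_) this
      rw [stepNoise]
      congr 1
      ring
    calc _ = |gridNoise lam C D A X w l h k ω + ∑ j ∈ Finset.range k,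
          (tailMass w (l + 1) (X ((j + 1 : ℕ) * h) ω)
          - tailMass w (l + 1) (X (j * h) ω)
          - h * tailDrift lam C w l (X (j * h) ω)
          - stepNoise lam C D A X w l (j * h) ((j + 1 : ℕ) * h) ω)| := by
          rw [gridNoise, ← Finset.sum_add_distrib]
          congr 1
          exact Finset.sum_congr rfl fun j _ => by ring
      _ ≤ _ := (abs_add_le _ _).trans (add_le_add le_rfl
          ((Finset.abs_sum_le_sum_abs _ _).trans (Finset.sum_le_sum fun j _ => hstep j)))
  have hSint : Integrable (fun ω => ∑ j ∈ Finset.range k, R j ω) μ :=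
    integrable_finsetSum _ fun j _ => hRint j
  refine (integral_mono_of_nonneg (Eventually.of_forall fun ω => abs_nonneg _)
    (((hN2.integrable one_le_two).abs).add hSint) hpath).trans ?_
  rw [integral_add' (hN2.integrable one_le_two).abs hSint,
    integral_finsetSum _ fun j _ => hRint j]
  simp_rw [hRval]
  rw [Finset.sum_const, Finset.card_range, nsmul_eq_mul]
  exact add_le_add ((integral_abs_le_sqrt hN2).trans (Real.sqrt_le_sqrt hN)) le_rfl

theorem abs_tailMass_le {V : Type*} [Fintype V] (w : V → ℝ) (m : ℕ) (x : V → ℕ) :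
    |tailMass w m x| ≤ ∑ i, |w i| := by
  refine (Finset.abs_sum_le_sum_abs _ _).trans (Finset.sum_le_sum fun i _ => ?_)
  rw [abs_mul]
  refine mul_le_of_le_one_right (abs_nonneg _) ?_
  split_ifs <;> simp

/-- The law of large numbers for the initial queue lengths. -/
theorem integral_abs_tailMass_sub_le {Y : V → Ω → ℕ} (hY : ∀ i, Measurable (Y i))
    (hind : iIndepFun Y μ) (w : V → ℝ) (m : ℕ) {a : ℝ} (ha : a ∈ Icc (0 : ℝ) 1)
    (htail : ∀ i, μ.real {ω | m ≤ Y i ω} = a) :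
    ∫ ω, |tailMass w m (fun i => Y i ω) - a| ∂μ ≤ √(∑ i, w i ^ 2) + |∑ i, w i - 1| := by
  set Z : V → Ω → ℝ := fun i ω => if m ≤ Y i ω then 1 else 0 with hZ
  have hφ : Measurable fun n : ℕ => (if m ≤ n then 1 else 0 : ℝ) := Measurable.of_discrete
  have hZm : ∀ i, Measurable (Z i) := fun i => hφ.comp (hY i)
  have hZ2 : ∀ i, MemLp (Z i) 2 μ := fun i =>
    MemLp.of_bound (hZm i).aestronglyMeasurable 1 (Eventually.of_forall fun ω => by
      simp only [hZ]; split_ifs <;> simp)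
  have hZi : ∀ i, ∫ ω, Z i ω ∂μ = a := by
    intro i
    rw [← htail i]
    have : Z i = indicator {ω | m ≤ Y i ω} 1 := by
      funext ω
      simp [hZ, indicator_apply]
    rw [this, integral_indicator_one (show MeasurableSet {ω | m ≤ Y i ω} from
      hY i measurableSet_Ici)]
  have hvar : variance (∑ i, fun ω => w i * Z i ω) μ ≤ ∑ i, w i ^ 2 := by
    rw [IndepFun.variance_sum (fun i _ => (hZ2 i).const_mul _) fun i _ j _ hij =>
      (hind.indepFun hij).comp (hφ.const_mul (w i)) (hφ.const_mul (w j))]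
    refine Finset.sum_le_sum fun i _ => ?_
    rw [variance_const_mul]
    refine mul_le_of_le_one_right (sq_nonneg _) ?_
    refine (variance_le_expectation_sq (hZm i).aestronglyMeasurable).trans ?_
    have : ∫ ω, (Z i ^ 2) ω ∂μ = ∫ ω, Z i ω ∂μ := by
      congr 1
      funext ω
      simp only [hZ, Pi.pow_apply]
      split_ifs <;> simp
    rw [this, hZi]
    exact ha.2
  set S : Ω → ℝ := fun ω => ∑ i, w i * Z i ω with hS
  have hSeq : (∑ i, fun ω => w i * Z i ω) = S := by funext ω; simp [hS]
  have hS2 : MemLp S 2 μ := memLp_finsetSum _ fun i _ => (hZ2 i).const_mul _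
  have hSmean : ∫ ω, S ω ∂μ = (∑ i, w i) * a := by
    simp only [hS]
    rw [integral_finsetSum _ fun i _ => ((hZ2 i).integrable one_le_two).const_mul _,
      Finset.sum_mul]
    exact Finset.sum_congr rfl fun i _ => by rw [integral_const_mul, hZi]
  have hcent : MemLp (fun ω => S ω - (∑ i, w i) * a) 2 μ := hS2.sub (memLp_const _)
  have h1 : ∫ ω, |S ω - (∑ i, w i) * a| ∂μ ≤ √(∑ i, w i ^ 2) := by
    refine (integral_abs_le_sqrt hcent).trans (Real.sqrt_le_sqrt ?_)
    rw [← hSmean, ← variance_eq_integral hS2.aestronglyMeasurable.aemeasurable, ← hSeq]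
    exact hvar
  have h2 : ∀ ω, |tailMass w m (fun i => Y i ω) - a|
      ≤ |S ω - (∑ i, w i) * a| + |∑ i, w i - 1| := by
    intro ω
    -- The total mass of `w` is only close to 1, which leaves a bias besides the fluctuation.
    have : tailMass w m (fun i => Y i ω) - a
        = (S ω - (∑ i, w i) * a) + (∑ i, w i - 1) * a := by
      simp only [tailMass, hS, hZ]
      ring
    rw [this]
    refine (abs_add_le _ _).trans (add_le_add le_rfl ?_)
    rw [abs_mul, abs_of_nonneg ha.1]
    exact mul_le_of_le_one_right (abs_nonneg _) ha.2
  have hint := (hcent.integrable one_le_two).abs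
  refine (integral_mono_of_nonneg (Eventually.of_forall fun ω => abs_nonneg _)
    (hint.add (integrable_const _)) (Eventually.of_forall h2)).trans ?_
  rw [integral_add' hint (integrable_const _)]
  simpa using h1

end Dynkin

end JSQ

namespace JSQ

/-! ### Spread weights and closure of the drift estimate -/

section Closure

set_option linter.unusedSectionVars false

variable {V : Type*} [Fintype V]

/-- Nonnegative weights of total mass close to `1` which are spread over many servers. -/
structure IsSpreadWeight (η ρ : ℝ) (w : V → ℝ) : Prop where
  nonneg : ∀ i, 0 ≤ w i
  abs_sum_sub_one_le : |∑ i, w i - 1| ≤ η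
  sum_sq_le : ∑ i, w i ^ 2 ≤ ρ

theorem sum_sq_le_of_le {w : V → ℝ} (hw : ∀ i, 0 ≤ w i) {c : ℝ} (hc : ∀ i, w i ≤ c) :
    ∑ i, w i ^ 2 ≤ c * ∑ i, w i := by
  rw [Finset.mul_sum]
  exact Finset.sum_le_sum fun i _ => by
    rw [sq]; exact mul_le_mul_of_nonneg_right (hc i) (hw i)

variable [DecidableEq V] {G : SimpleGraph V} [DecidableRel G.Adj]

/-- Large degrees and near-regularity of the graph. -/
structure IsNearRegular (G : SimpleGraph V) [DecidableRel G.Adj] (δ η : ℝ) : Prop where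
  pos : 0 < δ
  le_degree : ∀ j, δ ≤ G.degree j
  abs_sum_inWeight_sub_one_le : ∀ i, |∑ j, inWeight G i j - 1| ≤ η
  le_one : η ≤ 1

theorem IsNearRegular.nonneg [Nonempty V] {δ η : ℝ} (h : IsNearRegular G δ η) : 0 ≤ η :=
  (abs_nonneg _).trans (h.abs_sum_inWeight_sub_one_le (Classical.arbitrary V))

theorem IsNearRegular.sum_inWeight_le {δ η : ℝ} (h : IsNearRegular G δ η) (i : V) :
    ∑ j, inWeight G i j ≤ 2 := by
  linarith [(abs_le.1 (h.abs_sum_inWeight_sub_one_le i)).2, h.le_one]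

theorem inWeight_nonneg (i j : V) : 0 ≤ inWeight G i j := by
  unfold inWeight; split_ifs <;> positivity

theorem outWeight_nonneg (i j : V) : 0 ≤ outWeight G i j := by
  unfold outWeight; split_ifs <;> positivity

/-- Every single weight is at most `1 / δ`, so the sum of squares is at most `1 / δ` times the total
mass. Diverging degrees and asymptotic regularity enter the probabilistic part through such bounds.
-/
theorem IsNearRegular.isSpreadWeight_inWeight {δ η : ℝ} (h : IsNearRegular G δ η) (i : V) :
    IsSpreadWeight η (2 / δ) (inWeight G i) := by
  refine ⟨inWeight_nonneg i, h.abs_sum_inWeight_sub_one_le i, ?_⟩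
  have hδ := h.pos
  have hle : ∀ j, inWeight G i j ≤ 1 / δ := by
    intro j
    unfold inWeight
    split_ifs
    · exact one_div_le_one_div_of_le h.pos (h.le_degree j)
    · positivity
  refine (sum_sq_le_of_le (inWeight_nonneg i) hle).trans ?_
  calc 1 / δ * ∑ j, inWeight G i j ≤ 1 / δ * 2 :=
        mul_le_mul_of_nonneg_left (h.sum_inWeight_le i) (by positivity)
    _ = 2 / δ := by ring

theorem IsNearRegular.isSpreadWeight_outWeight [Nonempty V] {δ η : ℝ} (h : IsNearRegular G δ η)
    (i : V) : IsSpreadWeight η (2 / δ) (outWeight G i) := by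
  have hδ := h.pos
  have hd : (0 : ℝ) < G.degree i := hδ.trans_le (h.le_degree i)
  have hsum : ∑ j, outWeight G i j = 1 := by
    have := sum_neighborFinset_div G (fun _ => (1 : ℝ)) i
    simp only [Finset.sum_const, nsmul_eq_mul, mul_one, G.card_neighborFinset_eq_degree] at this
    rw [← this, div_self hd.ne']
  refine ⟨outWeight_nonneg i, by rw [hsum]; simpa using h.nonneg, ?_⟩
  have hle : ∀ j, outWeight G i j ≤ 1 / δ := by
    intro j
    unfold outWeight
    split_ifs
    · exact one_div_le_one_div_of_le h.pos (h.le_degree i)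
    · positivity
  refine (sum_sq_le_of_le (outWeight_nonneg i) hle).trans ?_
  rw [hsum, mul_one]
  gcongr
  norm_num

/-- A degree is less than the number of vertices, so the uniform weight is at most `1 / δ` as well.
-/
theorem IsNearRegular.isSpreadWeight_const [Nonempty V] {δ η : ℝ} (h : IsNearRegular G δ η) :
    IsSpreadWeight η (2 / δ) fun _ : V => 1 / (Fintype.card V : ℝ) := by
  have hN : (0 : ℝ) < Fintype.card V := by exact_mod_cast Fintype.card_pos
  have hδ := h.pos
  have hsum : ∑ _ : V, 1 / (Fintype.card V : ℝ) = 1 := by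
    rw [Finset.sum_const, Finset.card_univ, nsmul_eq_mul, mul_one_div, div_self hN.ne']
  refine ⟨fun _ => by positivity, by rw [hsum]; simpa using h.nonneg, ?_⟩
  have hle : δ ≤ Fintype.card V := (h.le_degree (Classical.arbitrary V)).trans (by
    exact_mod_cast (G.degree_lt_card_verts _).le)
  refine (sum_sq_le_of_le (c := 1 / δ) (fun _ => by positivity) fun _ =>
    one_div_le_one_div_of_le h.pos hle).trans ?_
  rw [hsum, mul_one]
  gcongr
  norm_num

/-- The drift of the weighted fractions is close to the mean-field rate. -/
theorem abs_tailDrift_sub_meanField_le {e : ℕ} {rule : V → V → (V → ℕ) → ℝ} (lam : ℝ≥0)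
    {w : V → ℝ} (hw : ∀ i, 0 ≤ w i) (l : ℕ) (x : V → ℕ) {q : ℕ → ℝ}
    (hq : ∀ i, q i ∈ Icc (0 : ℝ) 1) {Φ : V → ℝ}
    (hΦ : ∀ i, x i = l → |arrivalIntensity G (e + 2) rule i x - limitIntensity e (q l) (q (l + 1))|
      ≤ Φ i) (hΦ0 : ∀ i, 0 ≤ Φ i) :
    |tailDrift lam (arrivalIntensity G (e + 2) rule) w l x - meanField lam (e + 2) q l|
      ≤ lam * ∑ i, w i * Φ i + lam * (e + 2) * tailErr w l (q l) (q (l + 1)) x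
        + tailErr w (l + 1) (q (l + 1)) (q (l + 2)) x := by
  set B := limitIntensity e (q l) (q (l + 1)) with hB
  set C := arrivalIntensity G (e + 2) rule with hC
  have hind : ∀ m i, (if x i = m then 1 else 0 : ℝ)
      = (if m ≤ x i then 1 else 0) - (if m + 1 ≤ x i then 1 else 0) := by
    intro m i
    rcases lt_trichotomy (x i) m with h | h | h
    · simp [h.ne, h.not_ge, show ¬ m + 1 ≤ x i by omega]
    · simp [h]
    · simp [h.ne', h.le, Nat.succ_le_of_lt h]
  have hlev : ∀ m, ∑ i, w i * (if x i = m then 1 else 0 : ℝ)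
      = tailMass w m x - tailMass w (m + 1) x := by
    intro m
    simp only [hind, mul_sub, Finset.sum_sub_distrib]
    rfl
  have hmf : meanField lam (e + 2) q l
      = lam * B * (q l - q (l + 1)) - (q (l + 1) - q (l + 2)) := by
    rw [meanField, ← sub_mul_limitIntensity e (q l) (q (l + 1))]
    ring
  -- Replacing every intensity by the common value `B` leaves only tail masses at the levels `l`, `l
  -- + 1` and `l + 2`, since the mass at exactly one level is a difference of two tails.
  have hdr : tailDrift lam C w l x
      = lam * ∑ i, w i * ((if x i = l then 1 else 0) * (C i x - B))
        + lam * B * (tailMass w l x - tailMass w (l + 1) x)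
        - (tailMass w (l + 1) x - tailMass w (l + 2) x) := by
    rw [← hlev l, ← hlev (l + 1), tailDrift, Finset.mul_sum, Finset.mul_sum,
      ← Finset.sum_add_distrib, ← Finset.sum_sub_distrib]
    exact Finset.sum_congr rfl fun i _ => by ring
  have hsplit : tailDrift lam C w l x - meanField lam (e + 2) q l
      = lam * ∑ i, w i * ((if x i = l then 1 else 0) * (C i x - B))
        + lam * B * ((tailMass w l x - q l) - (tailMass w (l + 1) x - q (l + 1)))
        - ((tailMass w (l + 1) x - q (l + 1)) - (tailMass w (l + 2) x - q (l + 2))) := by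
    rw [hdr, hmf]; ring
  have hBle : |B| ≤ e + 2 := abs_limitIntensity_le e (hq l) (hq (l + 1))
  have h1 : |∑ i, w i * ((if x i = l then 1 else 0) * (C i x - B))| ≤ ∑ i, w i * Φ i := by
    refine (Finset.abs_sum_le_sum_abs _ _).trans (Finset.sum_le_sum fun i _ => ?_)
    rw [abs_mul, abs_of_nonneg (hw i)]
    refine mul_le_mul_of_nonneg_left ?_ (hw i)
    split_ifs with hi
    · rw [one_mul]; exact hΦ i hi
    · simpa using hΦ0 i
  rw [hsplit]
  refine (abs_sub _ _).trans (add_le_add ((abs_add_le _ _).trans (add_le_add ?_ ?_)) (abs_sub _ _))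
  · rw [abs_mul, NNReal.abs_eq]
    exact mul_le_mul_of_nonneg_left h1 lam.coe_nonneg
  · rw [abs_mul, abs_mul, NNReal.abs_eq]
    exact mul_le_mul (mul_le_mul_of_nonneg_left hBle lam.coe_nonneg) (abs_sub _ _) (abs_nonneg _)
      (by positivity)

/-- The rate at which the errors of the weighted fractions can grow. -/
noncomputable def growthRate (lam : ℝ≥0) (e : ℕ) : ℝ :=
  16 * lam * (e + 1) ^ 2 + 2 * lam * (e + 2) + 2

/-- The error hypothesis must cover all spread weights and all levels: even for the uniform weight
the drift involves neighbourhood averages and averages around neighbours. The law of the state is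
arbitrary, with no independence between servers. -/
theorem integral_abs_tailDrift_sub_meanField_le [Nonempty V] {e : ℕ}
    {rule : V → V → (V → ℕ) → ℝ} (lam : ℝ≥0) {δ η : ℝ} (hG : IsNearRegular G δ η)
    (hdeg : ∀ j, 2 * (e + 2) ≤ G.degree j) (ν : Measure (V → ℕ)) [IsProbabilityMeasure ν]
    {q : ℕ → ℝ} (hq : ∀ i, q i ∈ Icc (0 : ℝ) 1) {ε : ℝ}
    (hε : ∀ w : V → ℝ, IsSpreadWeight η (2 / δ) w → ∀ m, ∫ x, |tailMass w m x - q m| ∂ν ≤ ε)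
    {w : V → ℝ} (hw : IsSpreadWeight η (2 / δ) w) (l : ℕ) :
    ∫ x, |tailDrift lam (arrivalIntensity G (e + 2) rule) w l x - meanField lam (e + 2) q l| ∂ν
      ≤ growthRate lam e * ε + 18 * lam * (e + 1) ^ 3 / δ := by
  have hδ := hG.pos
  have hi1 : ∀ (w : V → ℝ) (m : ℕ), Integrable (fun x => |tailMass w m x - q m|) ν := fun w m =>
    Integrable.of_bound Measurable.of_discrete.aestronglyMeasurable (∑ i, |w i| + 1)
      (Eventually.of_forall fun x => by
        rw [Real.norm_eq_abs, abs_abs]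
        refine (abs_sub _ _).trans (add_le_add (abs_tailMass_le w m x) ?_)
        rw [abs_of_nonneg (hq m).1]
        exact (hq m).2)
  have hi2 : ∀ (w : V → ℝ) (m : ℕ), Integrable (tailErr w m (q m) (q (m + 1))) ν := fun w m =>
    (hi1 w m).add (hi1 w (m + 1))
  have hE : ∀ (w : V → ℝ), IsSpreadWeight η (2 / δ) w → ∀ m : ℕ,
      ∫ x, tailErr w m (q m) (q (m + 1)) x ∂ν ≤ 2 * ε := by
    intro w hw m
    unfold tailErr
    rw [integral_add (hi1 w m) (hi1 w (m + 1))]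
    linarith [hε w hw m, hε w hw (m + 1)]
  have hε0 : 0 ≤ ε := (integral_nonneg fun x => abs_nonneg _).trans (hε w hw 0)
  set Φ : V → (V → ℕ) → ℝ := fun i x =>
    (e + 1) * (tailErr (outWeight G i) l (q l) (q (l + 1)) x
        + tailErr (inWeight G i) l (q l) (q (l + 1)) x)
      + (e + 1) ^ 2 * ∑ j, inWeight G i j * tailErr (outWeight G j) l (q l) (q (l + 1)) x
      + 9 * (e + 1) ^ 3 / δ with hΦ
  have hiS : ∀ i, Integrable (fun x => ∑ j, inWeight G i j *
      tailErr (outWeight G j) l (q l) (q (l + 1)) x) ν := fun i =>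
    integrable_finsetSum _ fun j _ => (hi2 _ l).const_mul _
  have hiA : ∀ i, Integrable (fun x => (e + 1 : ℝ) * (tailErr (outWeight G i) l (q l) (q (l + 1)) x
        + tailErr (inWeight G i) l (q l) (q (l + 1)) x)) ν := fun i =>
    ((hi2 _ l).add (hi2 _ l)).const_mul _
  have hiΦ : ∀ i, Integrable (Φ i) ν := fun i =>
    ((hiA i).add ((hiS i).const_mul _)).add (integrable_const _)
  -- Each `tailErr` has mean at most `2 * ε`. Two of them, and a further sum of in-weight mass at
  -- most 2, give `8 * (e + 1) ^ 2 * ε`; averaging with `w`, again of mass at most 2, yields the 16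
  -- in `growthRate`.
  have hEΦ : ∀ i, ∫ x, Φ i x ∂ν ≤ 8 * (e + 1) ^ 2 * ε + 9 * (e + 1) ^ 3 / δ := by
    intro i
    have hval : ∫ x, Φ i x ∂ν = (e + 1) * (∫ x, tailErr (outWeight G i) l (q l) (q (l + 1)) x ∂ν
        + ∫ x, tailErr (inWeight G i) l (q l) (q (l + 1)) x ∂ν)
        + (e + 1) ^ 2 * ∑ j, inWeight G i j *
          ∫ x, tailErr (outWeight G j) l (q l) (q (l + 1)) x ∂ν + 9 * (e + 1) ^ 3 / δ := by
      have hiB : Integrable (fun x => (e + 1 : ℝ) ^ 2 * ∑ j, inWeight G i j *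
          tailErr (outWeight G j) l (q l) (q (l + 1)) x) ν := (hiS i).const_mul _
      have hiAB : Integrable (fun x => (e + 1 : ℝ) *
          (tailErr (outWeight G i) l (q l) (q (l + 1)) x
            + tailErr (inWeight G i) l (q l) (q (l + 1)) x) + (e + 1 : ℝ) ^ 2 *
          ∑ j, inWeight G i j * tailErr (outWeight G j) l (q l) (q (l + 1)) x) ν := (hiA i).add hiB
      simp only [hΦ]
      rw [integral_add hiAB (integrable_const _), integral_add (hiA i) hiB,
        integral_const_mul, integral_const_mul, integral_add (hi2 _ l) (hi2 _ l),
        integral_finsetSum _ fun j _ => (hi2 _ l).const_mul _]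
      simp only [integral_const_mul, integral_const, probReal_univ, one_smul]
    have h1 := hE _ (hG.isSpreadWeight_outWeight i) l
    have h2 := hE _ (hG.isSpreadWeight_inWeight i) l
    have h3 : ∑ j, inWeight G i j * ∫ x, tailErr (outWeight G j) l (q l) (q (l + 1)) x ∂ν
        ≤ 2 * (2 * ε) := by
      refine (Finset.sum_le_sum fun j _ => mul_le_mul_of_nonneg_left
        (hE _ (hG.isSpreadWeight_outWeight j) l) (inWeight_nonneg i j)).trans ?_
      rw [← Finset.sum_mul]
      exact mul_le_mul_of_nonneg_right (hG.sum_inWeight_le i) (by positivity)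
    rw [hval]
    have he : (0 : ℝ) ≤ e := Nat.cast_nonneg e
    have h4 : (e + 1 : ℝ) * (∫ x, tailErr (outWeight G i) l (q l) (q (l + 1)) x ∂ν
        + ∫ x, tailErr (inWeight G i) l (q l) (q (l + 1)) x ∂ν) ≤ (e + 1) * (4 * ε) :=
      mul_le_mul_of_nonneg_left (by linarith) (by positivity)
    have h5 := mul_le_mul_of_nonneg_left h3 (by positivity : (0 : ℝ) ≤ (e + 1) ^ 2)
    have h6 : (e + 1 : ℝ) * (4 * ε) ≤ (e + 1) ^ 2 * (4 * ε) :=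
      mul_le_mul_of_nonneg_right (by nlinarith) (by positivity)
    linarith
  have hbound : ∀ x, |tailDrift lam (arrivalIntensity G (e + 2) rule) w l x
      - meanField lam (e + 2) q l|
      ≤ lam * ∑ i, w i * Φ i x + lam * (e + 2) * tailErr w l (q l) (q (l + 1)) x
        + tailErr w (l + 1) (q (l + 1)) (q (l + 2)) x := by
    intro x
    refine abs_tailDrift_sub_meanField_le lam hw.nonneg l x hq (Φ := fun i => Φ i x)
      (fun i hi => ?_) fun i => ?_
    · exact abs_arrivalIntensity_sub_limitIntensity_le G hδ hdeg hG.le_degree i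
        (hG.sum_inWeight_le i) x hi (hq l) (hq (l + 1))
    · have h1 := tailErr_nonneg (outWeight G i) l (q l) (q (l + 1)) x
      have h2 := tailErr_nonneg (inWeight G i) l (q l) (q (l + 1)) x
      have h3 : 0 ≤ ∑ j, inWeight G i j * tailErr (outWeight G j) l (q l) (q (l + 1)) x :=
        Finset.sum_nonneg fun j _ => mul_nonneg (inWeight_nonneg i j) (tailErr_nonneg _ _ _ _ _)
      positivity
  have hiW : Integrable (fun x => lam * ∑ i, w i * Φ i x) ν :=
    (integrable_finsetSum _ fun i _ => (hiΦ i).const_mul _).const_mul _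
  have hiX : Integrable (fun x => lam * (e + 2 : ℝ) * tailErr w l (q l) (q (l + 1)) x) ν :=
    (hi2 w l).const_mul _
  refine (integral_mono_of_nonneg (Eventually.of_forall fun x => abs_nonneg _)
    ((hiW.add hiX).add (hi2 w (l + 1))) (Eventually.of_forall hbound)).trans ?_
  have hval : ∫ x, (lam * ∑ i, w i * Φ i x + lam * (e + 2 : ℝ) * tailErr w l (q l) (q (l + 1)) x
        + tailErr w (l + 1) (q (l + 1)) (q (l + 2)) x) ∂ν
      = lam * ∑ i, w i * ∫ x, Φ i x ∂ν
        + lam * (e + 2) * ∫ x, tailErr w l (q l) (q (l + 1)) x ∂ν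
        + ∫ x, tailErr w (l + 1) (q (l + 1)) (q (l + 2)) x ∂ν := by
    have hiWX : Integrable (fun x => lam * ∑ i, w i * Φ i x
        + lam * (e + 2 : ℝ) * tailErr w l (q l) (q (l + 1)) x) ν := hiW.add hiX
    rw [integral_add hiWX (hi2 w (l + 1)), integral_add hiW hiX, integral_const_mul,
      integral_const_mul, integral_finsetSum _ fun i _ => (hiΦ i).const_mul _]
    simp only [integral_const_mul]
  refine hval.le.trans ?_
  have hsumw : ∑ i, w i ≤ 2 := by
    linarith [(abs_le.1 hw.abs_sum_sub_one_le).2, hG.le_one]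
  have h1 : ∑ i, w i * ∫ x, Φ i x ∂ν ≤ 2 * (8 * (e + 1) ^ 2 * ε + 9 * (e + 1) ^ 3 / δ) := by
    refine (Finset.sum_le_sum fun i _ => mul_le_mul_of_nonneg_left (hEΦ i) (hw.nonneg i)).trans ?_
    rw [← Finset.sum_mul]
    exact mul_le_mul_of_nonneg_right hsumw (by positivity)
  have h2 := mul_le_mul_of_nonneg_left h1 lam.coe_nonneg
  have h3 := mul_le_mul_of_nonneg_left (hE w hw l) (by positivity : (0 : ℝ) ≤ lam * (e + 2))
  have h4 := hE w hw (l + 1)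
  unfold growthRate
  have h5 : 18 * (lam : ℝ) * (e + 1) ^ 3 / δ = 2 * lam * (9 * (e + 1) ^ 3 / δ) := by ring
  rw [h5]
  linarith

end Closure

/-! ### Gronwall's inequality, uniformly over spread weights -/

section Gronwall

set_option linter.unusedSectionVars false

variable {V : Type*} [Fintype V] [DecidableEq V] [Nonempty V] {G : SimpleGraph V}
  [DecidableRel G.Adj] {lam : ℝ≥0} {e : ℕ} {rule : V → V → (V → ℕ) → ℝ} {Ω : Type*}
  [mΩ : MeasurableSpace Ω] {μ : Measure Ω} [IsProbabilityMeasure μ] {ℱ : Filtration ℝ≥0 mΩ}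
  {D : V → Ω → Measure ℝ≥0} {A : V → Ω → Measure (ℝ≥0 × ℝ≥0)} {X : ℝ≥0 → Ω → V → ℕ}

theorem IsJSQProcess.measurable {d : ℕ} (hX : IsJSQProcess G lam d rule μ ℱ D A X) (t : ℝ≥0) :
    Measurable (X t) := (hX.adapted t).mono (ℱ.le t) le_rfl

/-- A bound on the arrival intensities. -/
def intensityBound (e : ℕ) : ℝ≥0 := 2 * e + 3

theorem arrivalIntensity_mem_Icc_intensityBound {δ η : ℝ} (hG : IsNearRegular G δ η)
    (hdeg : ∀ j, 2 * (e + 2) ≤ G.degree j) (i : V) (x : V → ℕ) :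
    arrivalIntensity G (e + 2) rule i x ∈ Icc 0 (intensityBound e : ℝ) := by
  have h := arrivalIntensity_mem_Icc G (rule := rule) (fun j => by have := hdeg j; omega) i x
    (e := e)
  refine ⟨h.1, h.2.trans ?_⟩
  have h1 := hG.sum_inWeight_le i
  unfold inWeight at h1
  have h2 := mul_le_mul_of_nonneg_left h1 (by positivity : (0 : ℝ) ≤ e + 1)
  simp only [intensityBound]
  push_cast
  linarith

/-- The mean error at time `t`, on the grid of mesh `h`, before Gronwall's inequality. -/
noncomputable def gridError (V : Type*) [Fintype V] (lam : ℝ≥0) (e : ℕ) (δ η : ℝ) (t h : ℝ) : ℝ :=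
  √(2 * t * (lam * intensityBound e + 1) * (2 / δ)) + √(2 / δ) + η
    + t * (18 * lam * (e + 1) ^ 3 / δ)
    + t * h * (4 * (Fintype.card V * (1 + lam * intensityBound e)) ^ 2
      + (2 * lam * (e + 2) + 2) * (lam + 1))

/-- The error at step `k` is at most `α + h * L` times the sum of the earlier error bounds, where
`α` collects the initial, noise, sampling and discretisation errors. The sequence `α * (1 + h * L) ^
k` solves this recursion with equality. -/
theorem IsJSQProcess.integral_abs_tailMass_grid_le
    (hX : IsJSQProcess G lam (e + 2) rule μ ℱ D A X) {δ η : ℝ} (hG : IsNearRegular G δ η)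
    (hdeg : ∀ j, 2 * (e + 2) ≤ G.degree j) {u : ℝ → ℕ → ℝ} (hu : IsMeanFieldFlow lam (e + 2) u)
    (hindep : iIndepFun (fun i ω => X 0 ω i) μ)
    (htail : ∀ i j, μ.real {ω | j ≤ X 0 ω i} = u 0 j) (t h : ℝ≥0) (k : ℕ) (hk : k * h ≤ t)
    {w : V → ℝ} (hw : IsSpreadWeight η (2 / δ) w) (m : ℕ) :
    ∫ ω, |tailMass w m (X (k * h) ω) - u (k * h) m| ∂μ
      ≤ gridError V lam e δ η t h * (1 + h * growthRate lam e) ^ k := by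
  have hδ := hG.pos
  have hη := hG.nonneg
  set L := growthRate lam e with hL
  have hL0 : 0 ≤ L := by simp only [hL, growthRate]; positivity
  set α := gridError V lam e δ η t h with hα
  have hα0 : 0 ≤ α := by simp only [hα, gridError]; positivity
  have hC := arrivalIntensity_mem_Icc_intensityBound (rule := rule) hG hdeg
  set C := arrivalIntensity G (e + 2) rule with hCdef
  -- The weight and the level are generalised: the step for `w` at level `l + 1` uses all earlier
  -- times, neighbourhood weights and adjacent levels.
  induction k using Nat.strong_induction_on generalizing w m with
  | _ k ih =>
  have hone : (1 : ℝ) ≤ (1 + h * L) ^ k := one_le_pow₀ (by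
    have : 0 ≤ h * L := by positivity
    linarith)
  have hkt : (k : ℝ) * h ≤ t := by exact_mod_cast hk
  cases m with
  | zero =>
    -- At level 0 the tail mass is the total mass of `w` and the limit is 1.
    have h0 : ∀ ω, |tailMass w 0 (X (k * h) ω) - u (k * h) 0| ≤ η := by
      intro ω
      rw [hu.zero _ (by positivity)]
      simpa [tailMass] using hw.abs_sum_sub_one_le
    have hηα : η ≤ α := by
      have : 0 ≤ α - η := by simp only [hα, gridError]; ring_nf; positivity
      linarith
    calc _ ≤ ∫ _, η ∂μ := integral_mono_of_nonneg (Eventually.of_forall fun ω => abs_nonneg _)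
          (integrable_const _) (Eventually.of_forall h0)
      _ = η := by simp
      _ ≤ α := hηα
      _ ≤ α * (1 + h * L) ^ k := le_mul_of_one_le_right hα0 hone
  | succ l =>
    have hbdd : ∀ (f : (V → ℕ) → ℝ) (c : ℝ) (s : ℝ≥0), (∀ x, |f x| ≤ c) →
        Integrable (fun ω => f (X s ω)) μ := fun f c s hf =>
      Integrable.of_bound ((Measurable.of_discrete (f := f)).comp
        (hX.measurable s)).aestronglyMeasurable c (Eventually.of_forall fun ω => hf _)
    have hiT := fun s => hbdd (tailMass w (l + 1)) _ s (abs_tailMass_le w (l + 1))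
    have hiD := fun s => hbdd (tailDrift lam C w l) (∑ i, w i * (lam * intensityBound e + 1)) s
      fun x => by
        refine (Finset.abs_sum_le_sum_abs _ _).trans (Finset.sum_le_sum fun i _ => ?_)
        rw [abs_mul, abs_of_nonneg (hw.nonneg i)]
        refine mul_le_mul_of_nonneg_left ?_ (hw.nonneg i)
        have h1 := mul_le_mul_of_nonneg_left (hC i x).2 lam.coe_nonneg
        have h2 := mul_nonneg lam.coe_nonneg (hC i x).1
        rw [abs_le]
        split_ifs <;> constructor <;> simp <;> linarith
    have hjk : ∀ j ∈ Finset.range k, (j : ℝ≥0) * h ≤ t := fun j hj =>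
      le_trans (by gcongr; exact (Finset.mem_range.1 hj).le) hk
    have hdrift : ∀ j ∈ Finset.range k,
        ∫ ω, |tailDrift lam C w l (X (j * h) ω) - meanField lam (e + 2) (u (j * h)) l| ∂μ
          ≤ L * (α * (1 + h * L) ^ j) + 18 * lam * (e + 1) ^ 3 / δ := by
      intro j hj
      have hXm := hX.measurable (j * h)
      have hprob : IsProbabilityMeasure (μ.map (X (j * h))) :=
        Measure.isProbabilityMeasure_map hXm.aemeasurable
      have hmap : ∀ f : (V → ℕ) → ℝ, ∫ x, f x ∂(μ.map (X (j * h))) = ∫ ω, f (X (j * h) ω) ∂μ :=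
        fun f => integral_map hXm.aemeasurable Measurable.of_discrete.aestronglyMeasurable
      have := integral_abs_tailDrift_sub_meanField_le (rule := rule) lam hG hdeg
        (μ.map (X (j * h))) (hu.mem (j * h) (by positivity)) (ε := α * (1 + h * L) ^ j)
        (fun w' hw' m' => by
          rw [hmap]
          exact ih j (Finset.mem_range.1 hj) (hjk j hj) hw' m') hw l
      rwa [hmap] at this
    set F : ℕ → Ω → ℝ := fun j ω =>
      |tailDrift lam C w l (X (j * h) ω) - meanField lam (e + 2) (u (j * h)) l| with hF
    set Y : Ω → ℝ := fun ω => |tailMass w (l + 1) (X (k * h) ω) - tailMass w (l + 1) (X 0 ω)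
        - ∑ j ∈ Finset.range k, h * tailDrift lam C w l (X (j * h) ω)| with hY
    set Z : Ω → ℝ := fun ω => |tailMass w (l + 1) (X 0 ω) - u 0 (l + 1)| with hZ
    set c : ℝ := (2 * lam * (e + 2) + 2) * (lam + 1) with hc
    -- `Y` contains the noise and the cells with several points, `Z` the initial error, `F` the
    -- drift error, and `c * h ^ 2` the Euler error of the limit flow per step.
    have hpath : ∀ ω, |tailMass w (l + 1) (X (k * h) ω) - u (k * h) (l + 1)|
        ≤ Y ω + Z ω + (∑ j ∈ Finset.range k, h * F j ω + k * (c * h ^ 2)) := by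
      intro ω
      have htel := Finset.sum_range_sub (fun j : ℕ => u (j * h) (l + 1)) k
      simp only [Nat.cast_zero, zero_mul] at htel
      have hsplit : tailMass w (l + 1) (X (k * h) ω) - u (k * h) (l + 1)
          = (tailMass w (l + 1) (X (k * h) ω) - tailMass w (l + 1) (X 0 ω)
            - ∑ j ∈ Finset.range k, h * tailDrift lam C w l (X (j * h) ω))
            + (tailMass w (l + 1) (X 0 ω) - u 0 (l + 1))
            + ∑ j ∈ Finset.range k,
              (h * (tailDrift lam C w l (X (j * h) ω) - meanField lam (e + 2) (u (j * h)) l)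
                - (u ((j + 1 : ℕ) * h) (l + 1) - u (j * h) (l + 1)
                  - h * meanField lam (e + 2) (u (j * h)) l)) := by
        have : ∑ j ∈ Finset.range k,
              (h * (tailDrift lam C w l (X (j * h) ω) - meanField lam (e + 2) (u (j * h)) l)
                - (u ((j + 1 : ℕ) * h) (l + 1) - u (j * h) (l + 1)
                  - h * meanField lam (e + 2) (u (j * h)) l))
            = ∑ j ∈ Finset.range k, h * tailDrift lam C w l (X (j * h) ω)
              - ∑ j ∈ Finset.range k, (u ((j + 1 : ℕ) * h) (l + 1) - u (j * h) (l + 1)) := by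
          rw [← Finset.sum_sub_distrib]
          exact Finset.sum_congr rfl fun j _ => by ring
        rw [this, htel]
        ring
      rw [hsplit]
      refine (abs_add_le _ _).trans (add_le_add (abs_add_le _ _) ?_)
      have hterm : ∀ j ∈ Finset.range k,
          |h * (tailDrift lam C w l (X (j * h) ω) - meanField lam (e + 2) (u (j * h)) l)
                - (u ((j + 1 : ℕ) * h) (l + 1) - u (j * h) (l + 1)
                  - h * meanField lam (e + 2) (u (j * h)) l)| ≤ h * F j ω + c * h ^ 2 := by
        intro j _
        refine (abs_sub _ _).trans (add_le_add ?_ ?_)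
        · rw [abs_mul, NNReal.abs_eq]
        · have := hu.abs_euler_le lam.coe_nonneg (t := j * h) (h := h) (by positivity)
            h.coe_nonneg l
          have h2 : ((j + 1 : ℕ) : ℝ) * h = j * h + h := by push_cast; ring
          rw [h2]
          push_cast at this
          exact this
      refine (Finset.abs_sum_le_sum_abs _ _).trans ((Finset.sum_le_sum hterm).trans (le_of_eq ?_))
      rw [Finset.sum_add_distrib, Finset.sum_const, Finset.card_range, nsmul_eq_mul]
    have hiF : ∀ j, Integrable (F j) μ := fun j => ((hiD _).sub (integrable_const _)).abs
    have hiY : Integrable Y μ :=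
      (((hiT _).sub (hiT _)).sub (integrable_finsetSum _ fun j _ => (hiD _).const_mul _)).abs
    have hiZ : Integrable Z μ := ((hiT _).sub (integrable_const _)).abs
    have hiS : Integrable (fun ω => ∑ j ∈ Finset.range k, h * F j ω) μ :=
      integrable_finsetSum _ fun j _ => (hiF j).const_mul _
    have hiYZ : Integrable (fun ω => Y ω + Z ω) μ := hiY.add hiZ
    have hiS' : Integrable (fun ω => ∑ j ∈ Finset.range k, h * F j ω + k * (c * h ^ 2)) μ :=
      hiS.add (integrable_const _)
    refine (integral_mono_of_nonneg (Eventually.of_forall fun ω => abs_nonneg _)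
      (hiYZ.add hiS') (Eventually.of_forall hpath)).trans ?_
    rw [integral_add' hiYZ hiS', integral_add hiY hiZ, integral_add hiS (integrable_const _),
      integral_finsetSum _ fun j _ => (hiF j).const_mul _]
    simp only [integral_const_mul, integral_const, probReal_univ, one_smul]
    have hsumw : ∑ i, w i ≤ 2 := by
      linarith [(abs_le.1 hw.abs_sum_sub_one_le).2, hG.le_one]
    have hEY : ∫ ω, Y ω ∂μ ≤ √(2 * t * (lam * intensityBound e + 1) * (2 / δ))
        + t * h * (4 * (Fintype.card V * (1 + lam * intensityBound e)) ^ 2) := by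
      refine (hX.integral_abs_sub_sum_tailDrift_le hC hw.nonneg l h k).trans (add_le_add ?_ ?_)
      · refine Real.sqrt_le_sqrt ?_
        calc k * (2 * (lam * intensityBound e + 1) * h * ∑ i, w i ^ 2)
            = (k * h) * (2 * (lam * intensityBound e + 1) * ∑ i, w i ^ 2) := by ring
          _ ≤ t * (2 * (lam * intensityBound e + 1) * (2 / δ)) := by
            have := hw.sum_sq_le
            gcongr
          _ = _ := by ring
      · calc (k : ℝ) * ((∑ i, w i)
              * (2 * ((Fintype.card V : ℝ) * (1 + lam * intensityBound e) * (h : ℝ)) ^ 2))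
            ≤ (k : ℝ) * (2 * (2 * ((Fintype.card V : ℝ) * (1 + lam * intensityBound e)
              * (h : ℝ)) ^ 2)) := by gcongr
          _ = ((k : ℝ) * h) * h * (4 * (Fintype.card V * (1 + lam * intensityBound e)) ^ 2) := by ring
          _ ≤ _ := by gcongr
    have hEZ : ∫ ω, Z ω ∂μ ≤ √(2 / δ) + η := by
      refine (integral_abs_tailMass_sub_le (fun i => (measurable_pi_apply i).comp (hX.measurable 0))
        hindep w (l + 1) (hu.mem 0 le_rfl _) fun i => htail i _).trans ?_
      exact add_le_add (Real.sqrt_le_sqrt hw.sum_sq_le) hw.abs_sum_sub_one_le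
    have hES : ∑ j ∈ Finset.range k, h * ∫ ω, F j ω ∂μ
        ≤ α * ((1 + h * L) ^ k - 1) + t * (18 * lam * (e + 1) ^ 3 / δ) := by
      calc _ ≤ ∑ j ∈ Finset.range k, h * (L * (α * (1 + h * L) ^ j)
            + 18 * lam * (e + 1) ^ 3 / δ) :=
            Finset.sum_le_sum fun j hj => mul_le_mul_of_nonneg_left (hdrift j hj) h.coe_nonneg
        _ = α * ((∑ j ∈ Finset.range k, (1 + h * L) ^ j) * ((1 + h * L) - 1))
            + (k * h) * (18 * lam * (e + 1) ^ 3 / δ) := by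
            simp only [mul_add, Finset.sum_add_distrib, Finset.sum_const, Finset.card_range,
              nsmul_eq_mul, Finset.sum_mul, Finset.mul_sum]
            congr 1
            · exact Finset.sum_congr rfl fun j _ => by ring
            · ring
        _ ≤ _ := by
            rw [geom_sum_mul]
            gcongr
    have hEC : k * (c * (h : ℝ) ^ 2) ≤ t * h * c := by
      calc k * (c * (h : ℝ) ^ 2) = (k * h) * h * c := by ring
        _ ≤ _ := by gcongr
    have hαeq : α = √(2 * t * (lam * intensityBound e + 1) * (2 / δ)) + √(2 / δ) + η
        + t * (18 * lam * (e + 1) ^ 3 / δ)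
        + (t * h * (4 * (Fintype.card V * (1 + lam * intensityBound e)) ^ 2) + t * h * c) := by
      simp only [hα, gridError, hc]
      ring
    linarith

/-- The mean error of the weighted fractions at time `t`. -/
theorem IsJSQProcess.integral_abs_tailMass_sub_le
    (hX : IsJSQProcess G lam (e + 2) rule μ ℱ D A X) {δ η : ℝ} (hG : IsNearRegular G δ η)
    (hdeg : ∀ j, 2 * (e + 2) ≤ G.degree j) {u : ℝ → ℕ → ℝ} (hu : IsMeanFieldFlow lam (e + 2) u)
    (hindep : iIndepFun (fun i ω => X 0 ω i) μ)
    (htail : ∀ i j, μ.real {ω | j ≤ X 0 ω i} = u 0 j) (t : ℝ≥0)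
    {w : V → ℝ} (hw : IsSpreadWeight η (2 / δ) w) (m : ℕ) :
    ∫ ω, |tailMass w m (X t ω) - u t m| ∂μ
      ≤ gridError V lam e δ η t 0 * Real.exp (t * growthRate lam e) := by
  have hL0 : 0 ≤ growthRate lam e := by unfold growthRate; positivity
  have hη := hG.nonneg
  have hδ := hG.pos
  -- The mesh tends to 0 with the graph fixed. In `gridError` the number of servers occurs only in a
  -- term with a factor `h`, so the limit depends on the graph through `δ` and `η` alone.
  have hlim : Tendsto (fun n : ℕ => gridError V lam e δ η t (t / (n + 1 : ℕ))
      * Real.exp (t * growthRate lam e)) atTop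
      (𝓝 (gridError V lam e δ η t 0 * Real.exp (t * growthRate lam e))) := by
    refine Tendsto.mul_const _ ?_
    have h1 : Tendsto (fun n : ℕ => (t : ℝ) / (n + 1 : ℕ)) atTop (𝓝 0) :=
      (tendsto_const_div_atTop_nhds_zero_nat (t : ℝ)).comp (tendsto_add_atTop_nat 1)
    have h2 : Continuous (gridError V lam e δ η t) := by unfold gridError; fun_prop
    exact (h2.tendsto 0).comp h1
  refine ge_of_tendsto' hlim fun n => ?_
  have hn : ((n + 1 : ℕ) : ℝ≥0) * (t / (n + 1 : ℕ)) = t := by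
    field_simp
  have hnR : ((n + 1 : ℕ) : ℝ) * (t / (n + 1 : ℕ) : ℝ≥0) = t := by exact_mod_cast hn
  have key := hX.integral_abs_tailMass_grid_le hG hdeg hu hindep htail t (t / (n + 1 : ℕ)) (n + 1)
    hn.le hw m
  rw [hn, hnR] at key
  refine key.trans ?_
  rw [NNReal.coe_div, NNReal.coe_natCast]
  refine mul_le_mul_of_nonneg_left ?_ (by unfold gridError; positivity)
  rw [NNReal.coe_div, NNReal.coe_natCast] at hnR
  calc (1 + (t : ℝ) / (n + 1 : ℕ) * growthRate lam e) ^ (n + 1)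
      ≤ Real.exp ((t : ℝ) / (n + 1 : ℕ) * growthRate lam e) ^ (n + 1) := by
        refine pow_le_pow_left₀ (by positivity) ?_ _
        rw [add_comm]
        exact Real.add_one_le_exp _
    _ = Real.exp (t * growthRate lam e) := by
        rw [← Real.exp_nat_mul, ← mul_assoc, hnR]

end Gronwall

end JSQ

namespace JSQ

/-! ### Convergence in `ℓ¹` at fixed times -/

section Tails

theorem hasSum_ite_add_le (L x : ℕ) :
    HasSum (fun l : ℕ => if l + L + 1 ≤ x then (1 : ℝ) else 0) ((x - L : ℕ) : ℝ) := by
  have h : ∀ l ∉ Finset.range (x - L), (if l + L + 1 ≤ x then (1 : ℝ) else 0) = 0 := by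
    intro l hl
    rw [if_neg]
    simp only [Finset.mem_range] at hl
    omega
  have hsum : ∑ l ∈ Finset.range (x - L), (if l + L + 1 ≤ x then (1 : ℝ) else 0)
      = ((x - L : ℕ) : ℝ) := by
    rw [Finset.sum_congr rfl fun l hl => if_pos (by simp only [Finset.mem_range] at hl; omega)]
    simp
  exact hsum ▸ hasSum_sum_of_ne_finset_zero h

/-- The excess over `L` is the sum of the indicators of the levels above `L`. Sum and integral are
exchanged in `ℝ≥0∞`, so integrability is a conclusion. -/
theorem integral_excess {Ω : Type*} [MeasurableSpace Ω] {μ : Measure Ω} [IsProbabilityMeasure μ]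
    {Y : Ω → ℕ} (hY : Measurable Y) (L : ℕ)
    (hs : Summable fun l : ℕ => μ.real {ω | l + L + 1 ≤ Y ω}) :
    Integrable (fun ω => ((Y ω - L : ℕ) : ℝ)) μ ∧
      ∫ ω, ((Y ω - L : ℕ) : ℝ) ∂μ = ∑' l : ℕ, μ.real {ω | l + L + 1 ≤ Y ω} := by
  have hmeas : ∀ l : ℕ, MeasurableSet {ω | l + L + 1 ≤ Y ω} := fun l => hY measurableSet_Ici
  have hpt : ∀ ω, ENNReal.ofReal ((Y ω - L : ℕ) : ℝ)
      = ∑' l : ℕ, {ω | l + L + 1 ≤ Y ω}.indicator (fun _ => (1 : ℝ≥0∞)) ω := by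
    intro ω
    rw [← (hasSum_ite_add_le L (Y ω)).tsum_eq,
      ENNReal.ofReal_tsum_of_nonneg (fun l => by split_ifs <;> norm_num)
        (hasSum_ite_add_le L (Y ω)).summable]
    refine tsum_congr fun l => ?_
    simp only [Set.indicator_apply, mem_ofPred_eq]
    split_ifs <;> simp
  have hlin : ∫⁻ ω, ENNReal.ofReal ((Y ω - L : ℕ) : ℝ) ∂μ
      = ENNReal.ofReal (∑' l : ℕ, μ.real {ω | l + L + 1 ≤ Y ω}) := by
    simp_rw [hpt]
    rw [lintegral_tsum fun l => (measurable_const.indicator (hmeas l)).aemeasurable,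
      ENNReal.ofReal_tsum_of_nonneg (fun l => measureReal_nonneg) hs]
    refine tsum_congr fun l => ?_
    rw [lintegral_indicator (hmeas l), setLIntegral_const, one_mul, ofReal_measureReal]
  have hm : Measurable fun ω => ((Y ω - L : ℕ) : ℝ) :=
    (Measurable.of_discrete (f := fun n : ℕ => ((n - L : ℕ) : ℝ))).comp hY
  have hint : Integrable (fun ω => ((Y ω - L : ℕ) : ℝ)) μ := by
    refine ⟨hm.aestronglyMeasurable, ?_⟩
    rw [hasFiniteIntegral_iff_ofReal (Eventually.of_forall fun ω => Nat.cast_nonneg _), hlin]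
    exact ENNReal.ofReal_lt_top
  refine ⟨hint, ?_⟩
  rw [integral_eq_lintegral_of_nonneg_ae (Eventually.of_forall fun ω => Nat.cast_nonneg _)
    hm.aestronglyMeasurable, hlin, ENNReal.toReal_ofReal (tsum_nonneg fun l => measureReal_nonneg)]

theorem OccupancySpace.summable (q : OccupancySpace) : Summable fun i => q.1 i :=
  (lp_one_summable_abs q.1).of_abs

theorem OccupancySpace.dist_le_add_tsum (p q : OccupancySpace) (M : ℕ) :
    dist p q ≤ ∑ l ∈ Finset.range M, |p.1 l - q.1 l|
      + ∑' l : ℕ, p.1 (l + M) + ∑' l : ℕ, q.1 (l + M) := by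
  have hp : Summable fun l : ℕ => p.1 (l + M) := (summable_nat_add_iff M).2 p.summable
  have hq : Summable fun l : ℕ => q.1 (l + M) := (summable_nat_add_iff M).2 q.summable
  have hs := OccupancySpace.summable_abs_sub p q
  rw [OccupancySpace.dist_eq_tsum, ← hs.sum_add_tsum_nat_add M, add_assoc, ← hp.tsum_add hq]
  refine add_le_add_right (Summable.tsum_le_tsum (fun l => ?_) ((summable_nat_add_iff M).2 hs)
    (hp.add hq)) _
  exact (abs_sub _ _).trans
    (by rw [abs_of_nonneg (p.2.2.2 (l + M)).1, abs_of_nonneg (q.2.2.2 (l + M)).1])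

theorem occupancy_apply {V : Type*} [Fintype V] [Nonempty V] (x : V → ℕ) (l : ℕ) :
    (occupancy x).1 l = tailMass (fun _ => 1 / (Fintype.card V : ℝ)) l x := by
  change ((Finset.univ.filter fun i => l ≤ x i).card : ℝ) / Fintype.card V = _
  unfold tailMass
  rw [← Finset.mul_sum, Finset.sum_boole]
  ring

/-- The `ℓ¹` distance is controlled by the entries up to `L` and the excess over level `L`. -/
theorem dist_occupancy_le {V : Type*} [Fintype V] [Nonempty V] (x : V → ℕ) (q : OccupancySpace)
    (L : ℕ) :
    dist (occupancy x) q ≤ ∑ l ∈ Finset.range (L + 1),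
        |tailMass (fun _ => 1 / (Fintype.card V : ℝ)) l x - q.1 l|
      + ∑ i, 1 / (Fintype.card V : ℝ) * ((x i - L : ℕ) : ℝ) + ∑' l : ℕ, q.1 (l + L + 1) := by
  have htail : HasSum
      (fun l : ℕ => tailMass (fun _ => 1 / (Fintype.card V : ℝ)) (l + L + 1) x)
      (∑ i, 1 / (Fintype.card V : ℝ) * ((x i - L : ℕ) : ℝ)) :=
    hasSum_sum fun i _ => (hasSum_ite_add_le L (x i)).mul_left _
  rw [← htail.tsum_eq]
  simp_rw [← occupancy_apply]
  exact OccupancySpace.dist_le_add_tsum _ q (L + 1)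

/-- A queue that changes by `k` alters at most `k` tail indicators, each of weight `1 / N`. -/
theorem dist_occupancy_occupancy_le {V : Type*} [Fintype V] [Nonempty V] (x y : V → ℕ) :
    dist (occupancy x) (occupancy y)
      ≤ (∑ i, |(x i : ℝ) - y i|) / Fintype.card V := by
  refine OccupancySpace.dist_le fun m => ?_
  have hN : (0 : ℝ) < Fintype.card V := by exact_mod_cast Fintype.card_pos
  have hocc : ∀ (x : V → ℕ) l, (occupancy x).1 l
      = (∑ i, if l ≤ x i then (1 : ℝ) else 0) / Fintype.card V := by
    intro x l
    rw [occupancy_apply, tailMass, ← Finset.mul_sum]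
    ring
  have hcount : ∀ a b : ℕ, ∑ l ∈ Finset.range m,
      |(if l + 1 ≤ a then (1 : ℝ) else 0) - if l + 1 ≤ b then 1 else 0| ≤ |(a : ℝ) - b| := by
    have key : ∀ a b : ℕ, a ≤ b → ∑ l ∈ Finset.range m,
        |(if l + 1 ≤ a then (1 : ℝ) else 0) - if l + 1 ≤ b then 1 else 0| ≤ |(a : ℝ) - b| := by
      intro a b hab
      calc _ = ∑ l ∈ Finset.range m, if l ∈ Finset.Ico a b then (1 : ℝ) else 0 := by
            refine Finset.sum_congr rfl fun l _ => ?_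
            by_cases h1 : l + 1 ≤ a <;> by_cases h2 : l + 1 ≤ b <;>
              simp [h1, h2] <;> omega
        _ ≤ ((Finset.Ico a b).card : ℝ) := by
            rw [Finset.sum_boole]
            exact_mod_cast Finset.card_le_card fun l hl => (Finset.mem_filter.1 hl).2
        _ = |(a : ℝ) - b| := by
            rw [Nat.card_Ico, abs_sub_comm, abs_of_nonneg (by simpa using hab), Nat.cast_sub hab]
    intro a b
    rcases le_total a b with h | h
    · exact key a b h
    · rw [abs_sub_comm (a : ℝ)]
      refine le_trans (le_of_eq (Finset.sum_congr rfl fun l _ => abs_sub_comm _ _)) (key b a h)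
  calc ∑ l ∈ Finset.range m, |(occupancy x).1 (l + 1) - (occupancy y).1 (l + 1)|
      ≤ ∑ l ∈ Finset.range m, (∑ i, |(if l + 1 ≤ x i then (1 : ℝ) else 0)
          - if l + 1 ≤ y i then 1 else 0|) / Fintype.card V := by
        refine Finset.sum_le_sum fun l _ => ?_
        rw [hocc, hocc, ← sub_div, abs_div, abs_of_pos hN, ← Finset.sum_sub_distrib]
        gcongr
        exact Finset.abs_sum_le_sum_abs _ _
    _ = (∑ i, ∑ l ∈ Finset.range m, |(if l + 1 ≤ x i then (1 : ℝ) else 0)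
          - if l + 1 ≤ y i then 1 else 0|) / Fintype.card V := by
        rw [← Finset.sum_div, Finset.sum_comm]
    _ ≤ _ := by
        gcongr with i
        exact hcount _ _

/-- To exceed `L + L`, either `y` or `a` must exceed `L`, and `a - L ≤ a ^ 2 / L`. Thus a second
moment of the arrivals suffices, with a gain `1 / L`. -/
theorem excess_add_le {x y : ℕ} {a : ℝ} (h : (x : ℝ) ≤ y + a) {L : ℕ} (hL : 0 < L) :
    ((x - (L + L) : ℕ) : ℝ) ≤ ((y - L : ℕ) : ℝ) + a ^ 2 / L := by
  have hL' : (0 : ℝ) < L := by exact_mod_cast hL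
  have h1 : a - L ≤ a ^ 2 / L := by
    rw [le_div_iff₀ hL']
    nlinarith [sq_nonneg (a - L)]
  have h2 : (y : ℝ) - L ≤ ((y - L : ℕ) : ℝ) := by
    have : y ≤ (y - L) + L := by omega
    have : (y : ℝ) ≤ ((y - L : ℕ) : ℝ) + L := by exact_mod_cast this
    linarith
  rcases le_total x (L + L) with hx | hx
  · rw [Nat.sub_eq_zero_of_le hx]
    simp only [Nat.cast_zero]
    positivity
  · rw [Nat.cast_sub hx]
    push_cast
    linarith

end Tails

section FixedTime

set_option linter.unusedSectionVars false

variable {V : Type*} [Fintype V] [DecidableEq V] [Nonempty V] {G : SimpleGraph V}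
  [DecidableRel G.Adj] {lam : ℝ≥0} {e : ℕ} {rule : V → V → (V → ℕ) → ℝ} {Ω : Type*}
  [mΩ : MeasurableSpace Ω] {μ : Measure Ω} [IsProbabilityMeasure μ] {ℱ : Filtration ℝ≥0 mΩ}
  {D : V → Ω → Measure ℝ≥0} {A : V → Ω → Measure (ℝ≥0 × ℝ≥0)} {X : ℝ≥0 → Ω → V → ℕ}

/-- Truncation at level `2L`: entries up to there are tail masses of the uniform weight. The rest is
bounded by the initial excess over `L`, by the Poisson number of possible arrivals, and by the tail
of the limit. -/
theorem IsJSQProcess.integral_dist_occupancy_le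
    (hX : IsJSQProcess G lam (e + 2) rule μ ℱ D A X) {δ η : ℝ} (hG : IsNearRegular G δ η)
    (hdeg : ∀ j, 2 * (e + 2) ≤ G.degree j) {q₀ : OccupancySpace} {q : ℝ≥0 → OccupancySpace}
    (hq : IsSupermarketSolution lam (e + 2) q₀ q)
    (hindep : iIndepFun (fun i ω => X 0 ω i) μ)
    (htail : ∀ i j, μ.real {ω | j ≤ X 0 ω i} = q₀.1 j) (t : ℝ≥0) {L : ℕ} (hL : 0 < L) :
    Integrable (fun ω => dist (occupancy (X t ω)) (q t)) μ ∧
    ∫ ω, dist (occupancy (X t ω)) (q t) ∂μ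
      ≤ (L + L + 1) * (gridError V lam e δ η t 0 * Real.exp (t * growthRate lam e))
        + (∑' l : ℕ, q₀.1 (l + L + 1)
          + ((lam * (t * intensityBound e)) ^ 2 + lam * (t * intensityBound e)) / L)
        + ∑' l : ℕ, (q t).1 (l + (L + L) + 1) := by
  set N : ℝ := (Fintype.card V : ℝ) with hN
  have hNpos : 0 < N := by simp only [hN]; exact_mod_cast Fintype.card_pos
  set K := intensityBound e with hK
  set a : V → Ω → ℝ := fun i ω => (A i ω).real (Ioc 0 t ×ˢ Iic K) with ha
  have hC := arrivalIntensity_mem_Icc_intensityBound (rule := rule) hG hdeg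
  have hint : (lam • lebesgue.prod lebesgue) (Ioc 0 t ×ˢ Iic K) = (lam * (t * K) : ℝ≥0) := by
    rw [intensity_Ioc_prod_Iic, tsub_zero]
    try congr 1
    try ring
  have hms : MeasurableSet (Ioc (0 : ℝ≥0) t ×ˢ Iic K) := measurableSet_Ioc.prod measurableSet_Iic
  have ha2 : ∀ i, Integrable (fun ω => a i ω ^ 2) μ := fun i =>
    ((hX.arrivals i).memLp_real hms hint).integrable_sq
  have hEa2 : ∀ i, ∫ ω, a i ω ^ 2 ∂μ = ((lam * (t * K)) ^ 2 + lam * (t * K) : ℝ) := by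
    intro i
    simpa using (hX.arrivals i).integral_real_sq hms hint
  have hex : ∀ i, Integrable (fun ω => ((X 0 ω i - L : ℕ) : ℝ)) μ ∧
      ∫ ω, ((X 0 ω i - L : ℕ) : ℝ) ∂μ = ∑' l : ℕ, q₀.1 (l + L + 1) := by
    intro i
    have := integral_excess (μ := μ) ((measurable_pi_apply i).comp (hX.measurable 0)) L
      (by simp only [Function.comp_apply, htail]; exact (summable_nat_add_iff (L + 1)).2 q₀.summable)
    simpa only [Function.comp_apply, htail] using this
  have hiT : ∀ l, Integrable
      (fun ω => |tailMass (fun _ => 1 / N) l (X t ω) - (q t).1 l|) μ := by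
    intro l
    refine Integrable.of_bound
      ((Measurable.of_discrete (f := fun x : V → ℕ => |tailMass (fun _ => 1 / N) l x - (q t).1 l|)).comp
        (hX.measurable t)).aestronglyMeasurable (1 + |(q t).1 l|) (Eventually.of_forall fun ω => ?_)
    rw [Real.norm_eq_abs, abs_abs]
    refine (abs_sub _ _).trans (add_le_add_left ?_ _)
    have h1 := abs_tailMass_le (fun _ : V => 1 / N) l (X t ω)
    refine h1.trans (le_of_eq ?_)
    simp [Finset.sum_const, Finset.card_univ, ← hN, abs_of_pos hNpos, hNpos.ne']
  set R : Ω → ℝ := fun ω => ∑ l ∈ Finset.range (L + L + 1),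
      |tailMass (fun _ => 1 / N) l (X t ω) - (q t).1 l|
      + ∑ i, 1 / N * (((X 0 ω i - L : ℕ) : ℝ) + a i ω ^ 2 / L)
      + ∑' l : ℕ, (q t).1 (l + (L + L) + 1) with hR
  have hi1 : Integrable (fun ω => ∑ l ∈ Finset.range (L + L + 1),
      |tailMass (fun _ => 1 / N) l (X t ω) - (q t).1 l|) μ := integrable_finsetSum _ fun l _ => hiT l
  have hi2' : ∀ i, Integrable (fun ω => ((X 0 ω i - L : ℕ) : ℝ) + a i ω ^ 2 / L) μ := fun i =>
    (hex i).1.add ((ha2 i).div_const _)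
  have hi2 : Integrable (fun ω => ∑ i, 1 / N * (((X 0 ω i - L : ℕ) : ℝ) + a i ω ^ 2 / L)) μ :=
    integrable_finsetSum _ fun i _ => (hi2' i).const_mul _
  have hi12 : Integrable (fun ω => ∑ l ∈ Finset.range (L + L + 1),
      |tailMass (fun _ => 1 / N) l (X t ω) - (q t).1 l|
      + ∑ i, 1 / N * (((X 0 ω i - L : ℕ) : ℝ) + a i ω ^ 2 / L)) μ := hi1.add hi2
  have hiR : Integrable R μ := hi12.add (integrable_const _)
  have hle : ∀ᵐ ω ∂μ, dist (occupancy (X t ω)) (q t) ≤ R ω := by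
    filter_upwards [hX.ae_isDrivenPath hC] with ω hω
    refine (dist_occupancy_le (X t ω) (q t) (L + L)).trans ?_
    simp only [hR]
    refine add_le_add_left (add_le_add_right (Finset.sum_le_sum fun i _ => ?_) _) _
    exact mul_le_mul_of_nonneg_left
      (excess_add_le (hω.le_add_arrivals t i) hL) (by positivity)
  have hmd : AEStronglyMeasurable (fun ω => dist (occupancy (X t ω)) (q t)) μ :=
    ((Measurable.of_discrete (f := fun x : V → ℕ => dist (occupancy x) (q t))).comp
        (hX.measurable t)).aestronglyMeasurable
  refine ⟨hiR.mono' hmd (hle.mono fun ω h => by rwa [Real.norm_of_nonneg dist_nonneg]), ?_⟩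
  refine (integral_mono_of_nonneg (Eventually.of_forall fun ω => dist_nonneg) hiR hle).trans ?_
  simp only [hR]
  rw [integral_add hi12 (integrable_const _), integral_add hi1 hi2,
    integral_finsetSum _ fun l _ => hiT l, integral_finsetSum _ fun i _ => (hi2' i).const_mul _]
  simp only [integral_const_mul, integral_const, probReal_univ, one_smul]
  refine add_le_add_left (add_le_add ?_ (le_of_eq ?_)) _
  · have hflow := hq.isMeanFieldFlow
    refine (Finset.sum_le_card_nsmul _ _ (gridError V lam e δ η t 0
      * Real.exp (t * growthRate lam e)) fun l _ => ?_).trans (le_of_eq ?_)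
    · have := hX.integral_abs_tailMass_sub_le hG hdeg hflow hindep
        (fun i j => by rw [htail]; simp [hq.1]) t hG.isSpreadWeight_const l
      simpa using this
    · rw [Finset.card_range, nsmul_eq_mul]
      push_cast
      ring
  · have : ∀ i, ∫ ω, (((X 0 ω i - L : ℕ) : ℝ) + a i ω ^ 2 / L) ∂μ
        = ∑' l : ℕ, q₀.1 (l + L + 1) + ((lam * (t * K)) ^ 2 + lam * (t * K)) / L := by
      intro i
      rw [integral_add (hex i).1 ((ha2 i).div_const _), (hex i).2, integral_div, hEa2]
    simp only [this, Finset.sum_const, Finset.card_univ, nsmul_eq_mul, ← hN]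
    field_simp

end FixedTime

end JSQ

namespace JSQ

/-! ### Convergence along a sequence of graphs -/

section Sequence

set_option linter.unusedSectionVars false

variable {lam : ℝ≥0} {e : ℕ} {G : ∀ n : ℕ, SimpleGraph (Fin (n + 1))}
  [∀ n, DecidableRel (G n).Adj]

/-- The deviation of the graph from regularity. -/
noncomputable def irregularity {V : Type*} [Fintype V] (G : SimpleGraph V) [DecidableRel G.Adj] :
    ℝ := ⨆ i : V, |(∑ j, if G.Adj j i then 1 / (G.degree j : ℝ) else 0) - 1|

theorem eventually_isNearRegular (hmin : Tendsto (fun n => (G n).minDegree) atTop atTop)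
    (hreg : Tendsto (fun n => irregularity (G n)) atTop (𝓝 0)) (e : ℕ) :
    ∀ᶠ n in atTop, IsNearRegular (G n) (G n).minDegree (irregularity (G n)) ∧
      ∀ j, 2 * (e + 2) ≤ (G n).degree j := by
  filter_upwards [hmin.eventually_ge_atTop (2 * (e + 2)), hreg.eventually_le_const one_pos]
    with n h1 h2
  refine ⟨⟨?_, fun j => ?_, fun i => ?_, h2⟩, fun j => h1.trans ((G n).minDegree_le_degree j)⟩
  · exact_mod_cast (show 0 < 2 * (e + 2) by omega).trans_le h1
  · exact_mod_cast (G n).minDegree_le_degree j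
  · exact le_ciSup (f := fun i : Fin (n + 1) =>
      |(∑ j, if (G n).Adj j i then 1 / ((G n).degree j : ℝ) else 0) - 1|)
      (Set.finite_range _).bddAbove i

theorem tendsto_gridError (hmin : Tendsto (fun n => (G n).minDegree) atTop atTop)
    (hreg : Tendsto (fun n => irregularity (G n)) atTop (𝓝 0)) (lam : ℝ≥0) (e : ℕ) (t : ℝ) :
    Tendsto (fun n => gridError (Fin (n + 1)) lam e (G n).minDegree (irregularity (G n)) t 0)
      atTop (𝓝 0) := by
  have hd : Tendsto (fun n => ((G n).minDegree : ℝ)) atTop atTop :=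
    tendsto_natCast_atTop_atTop.comp hmin
  have h2 : Tendsto (fun n => 2 / ((G n).minDegree : ℝ)) atTop (𝓝 0) := hd.const_div_atTop 2
  have h3 := (h2.const_mul (2 * t * (lam * intensityBound e + 1))).sqrt
  have h4 := (hd.const_div_atTop (18 * lam * (e + 1) ^ 3)).const_mul t
  have := ((h3.add h2.sqrt).add hreg).add h4
  simp only [mul_zero, Real.sqrt_zero, add_zero] at this
  refine this.congr fun n => ?_
  simp [gridError]

variable {rule : ∀ n : ℕ, Fin (n + 1) → Fin (n + 1) → (Fin (n + 1) → ℕ) → ℝ}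
  {Ω : ℕ → Type*} [mΩ : ∀ n, MeasurableSpace (Ω n)]
  {μ : ∀ n, Measure (Ω n)} [∀ n, IsProbabilityMeasure (μ n)] {ℱ : ∀ n, Filtration ℝ≥0 (mΩ n)}
  {D : ∀ n, Fin (n + 1) → Ω n → Measure ℝ≥0} {A : ∀ n, Fin (n + 1) → Ω n → Measure (ℝ≥0 × ℝ≥0)}
  {X : ∀ n, ℝ≥0 → Ω n → Fin (n + 1) → ℕ} {q₀ : OccupancySpace} {q : ℝ≥0 → OccupancySpace}

theorem tendsto_integral_dist_occupancy
    (hmin : Tendsto (fun n => (G n).minDegree) atTop atTop)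
    (hreg : Tendsto (fun n => irregularity (G n)) atTop (𝓝 0))
    (hX : ∀ n, IsJSQProcess (G n) lam (e + 2) (rule n) (μ n) (ℱ n) (D n) (A n) (X n))
    (hindep : ∀ n, iIndepFun (fun i ω => X n 0 ω i) (μ n))
    (htail : ∀ n i j, (μ n).real {ω | j ≤ X n 0 ω i} = q₀.1 j)
    (hq : IsSupermarketSolution lam (e + 2) q₀ q) (t : ℝ≥0) :
    Tendsto (fun n => ∫ ω, dist (occupancy (X n t ω)) (q t) ∂μ n) atTop (𝓝 0) := by
  refine tendsto_order.2 ⟨fun a ha => Eventually.of_forall fun n =>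
    ha.trans_le (integral_nonneg fun ω => dist_nonneg), fun ε hε => ?_⟩
  have hlim : Tendsto (fun L : ℕ => (∑' l : ℕ, q₀.1 (l + L + 1)
      + ((lam * (t * intensityBound e)) ^ 2 + lam * (t * intensityBound e)) / (L : ℝ))
        + ∑' l : ℕ, (q t).1 (l + (L + L) + 1)) atTop (𝓝 0) := by
    have h1 : Tendsto (fun L : ℕ => ∑' l : ℕ, q₀.1 (l + L + 1)) atTop (𝓝 0) :=
      (tendsto_sum_nat_add fun i => q₀.1 i).comp (tendsto_add_atTop_nat 1)
    have h2 : Tendsto (fun L : ℕ => ∑' l : ℕ, (q t).1 (l + (L + L) + 1)) atTop (𝓝 0) :=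
      ((tendsto_sum_nat_add fun i => (q t).1 i).comp (tendsto_add_atTop_nat 1)).comp
        (tendsto_atTop_mono (fun L : ℕ => Nat.le_add_left L L) tendsto_id)
    have h3 := tendsto_const_div_atTop_nhds_zero_nat
      ((lam * (t * intensityBound e)) ^ 2 + lam * (t * intensityBound e) : ℝ)
    simpa using (h1.add h3).add h2
  -- The truncation level is fixed before the graph grows.
  obtain ⟨L, hL, hL0⟩ := ((hlim.eventually_lt_const hε).and (eventually_gt_atTop 0)).exists
  have hg : Tendsto (fun n => (L + L + 1) *
      (gridError (Fin (n + 1)) lam e (G n).minDegree (irregularity (G n)) t 0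
        * Real.exp (t * growthRate lam e))) atTop (𝓝 0) := by
    simpa using ((tendsto_gridError hmin hreg lam e t).mul_const
      (Real.exp (t * growthRate lam e))).const_mul ((L : ℝ) + L + 1)
  filter_upwards [eventually_isNearRegular hmin hreg e,
    hg.eventually_lt_const (sub_pos.2 hL)] with n h1 h2
  refine ((hX n).integral_dist_occupancy_le h1.1 h1.2 hq (hindep n) (htail n) t hL0).2.trans_lt ?_
  rw [add_assoc]
  linarith

theorem totalCount_mono {V Ω : Type*} [Fintype V] {D : V → Ω → Measure ℝ≥0}
    {A : V → Ω → Measure (ℝ≥0 × ℝ≥0)} {K : ℝ≥0} {C : V → (V → ℕ) → ℝ} {x : ℝ≥0 → V → ℕ} {ω : Ω}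
    (h : IsDrivenPath C K (fun i => D i ω) (fun i => A i ω) x) (s : ℝ≥0) {t u : ℝ≥0} (htu : t ≤ u) :
    totalCount D A K s t ω ≤ totalCount D A K s u ω :=
  Finset.sum_le_sum fun i _ => add_le_add
    (measureReal_mono (Ioc_subset_Ioc_right htu) (h.departures_Ioc_ne_top s u i))
    (measureReal_mono (Set.prod_mono (Ioc_subset_Ioc_right htu) subset_rfl)
      (h.arrivals_Ioc_ne_top s u i))

theorem dist_occupancy_le_totalCount {V Ω : Type*} [Fintype V] [Nonempty V]
    {D : V → Ω → Measure ℝ≥0}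
    {A : V → Ω → Measure (ℝ≥0 × ℝ≥0)} {K : ℝ≥0} {C : V → (V → ℕ) → ℝ} {x : ℝ≥0 → V → ℕ} {ω : Ω}
    (h : IsDrivenPath C K (fun i => D i ω) (fun i => A i ω) x) {s t : ℝ≥0} (hst : s ≤ t) :
    dist (occupancy (x t)) (occupancy (x s)) ≤ totalCount D A K s t ω / Fintype.card V := by
  refine (dist_occupancy_occupancy_le _ _).trans ?_
  gcongr
  exact Finset.sum_le_sum fun i _ => h.abs_sub_le hst i

theorem exists_grid_point {h s : ℝ≥0} (hh : 0 < h) :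
    ∃ k : ℕ, k * h ≤ s ∧ s ≤ (k + 1) * h ∧ k = ⌊s / h⌋₊ := by
  refine ⟨⌊s / h⌋₊, ?_, ?_, rfl⟩
  · rw [← le_div_iff₀ hh]
    exact Nat.floor_le zero_le
  · rw [← div_le_iff₀ hh]
    exact (Nat.lt_floor_add_one _).le

/-- Uniformity in time from finitely many grid times. Within a cell the occupancy state moves by at
most the number of driving points divided by the number of servers, which concentrates near a
multiple of `h`; the limit is Lipschitz. -/
theorem tendsto_measure_le_edist_occupancyPath
    (hmin : Tendsto (fun n => (G n).minDegree) atTop atTop)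
    (hreg : Tendsto (fun n => irregularity (G n)) atTop (𝓝 0))
    (hX : ∀ n, IsJSQProcess (G n) lam (e + 2) (rule n) (μ n) (ℱ n) (D n) (A n) (X n))
    (hindep : ∀ n, iIndepFun (fun i ω => X n 0 ω i) (μ n))
    (htail : ∀ n i j, (μ n).real {ω | j ≤ X n 0 ω i} = q₀.1 j) {q : C(ℝ≥0, OccupancySpace)}
    (hq : IsSupermarketSolution lam (e + 2) q₀ q) (T : ℝ≥0) {ε : ℝ} (hε : 0 < ε) :
    Tendsto (fun n => (μ n).real {ω | ENNReal.ofReal ε < edist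
      (occupancyPath T (fun t => X n t ω) ((hX n).cadlag ω)) (continuousPath T q)})
      atTop (𝓝 0) := by
  set K := intensityBound e with hK
  -- The mean number of points per server and cell is at most `ε / 8`, leaving a deviation `ε / 8`
  -- for Chebyshev below the threshold `ε / 4` of `Q`. The second bound limits the motion of `q`
  -- within a cell.
  obtain ⟨h, hh0, hh⟩ : ∃ h : ℝ≥0, 0 < h ∧ (1 + lam * K) * (h : ℝ) ≤ ε / 8
      ∧ (lam + 1) * (h : ℝ) ≤ ε / 4 := by
    have hlim1 : Tendsto (fun x : ℝ => (1 + lam * K) * x) (𝓝[>] 0) (𝓝 0) := by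
      have : Continuous fun x : ℝ => (1 + lam * K) * x := by fun_prop
      simpa using (this.tendsto 0).mono_left nhdsWithin_le_nhds
    have hlim2 : Tendsto (fun x : ℝ => (lam + 1) * x) (𝓝[>] 0) (𝓝 0) := by
      have : Continuous fun x : ℝ => (lam + 1) * x := by fun_prop
      simpa using (this.tendsto 0).mono_left nhdsWithin_le_nhds
    obtain ⟨x, hx1, hx2, hx0⟩ := ((hlim1.eventually_le_const (show 0 < ε / 8 by linarith)).and
      ((hlim2.eventually_le_const (show 0 < ε / 4 by linarith)).and self_mem_nhdsWithin)).exists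
    exact ⟨⟨x, le_of_lt hx0⟩, hx0, hx1, hx2⟩
  set m := ⌊T / h⌋₊ with hm
  set P : ∀ n, ℕ → Set (Ω n) := fun n k =>
    {ω | ε / 4 ≤ dist (occupancy (X n (k * h) ω)) (q (k * h))} with hP
  set Q : ∀ n, ℕ → Set (Ω n) := fun n k =>
    {ω | ε / 4 ≤ totalCount (D n) (A n) K (k * h) ((k + 1) * h) ω / (n + 1 : ℕ)} with hQ
  have hPlim : ∀ k, Tendsto (fun n => (μ n).real (P n k)) atTop (𝓝 0) := by
    intro k
    have hlim := (tendsto_integral_dist_occupancy hmin hreg hX hindep htail hq (k * h)).const_mul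
      (4 / ε)
    rw [mul_zero] at hlim
    refine tendsto_of_tendsto_of_tendsto_of_le_of_le' tendsto_const_nhds hlim
      (Eventually.of_forall fun n => measureReal_nonneg) ?_
    filter_upwards [eventually_isNearRegular hmin hreg e] with n h1
    have hi := ((hX n).integral_dist_occupancy_le h1.1 h1.2 hq (hindep n) (htail n) (k * h)
      one_pos).1
    have := mul_meas_ge_le_integral_of_nonneg (Eventually.of_forall fun ω => dist_nonneg) hi (ε / 4)
    calc _ = 4 / ε * (ε / 4 * (μ n).real (P n k)) := by field_simp
      _ ≤ _ := by gcongr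
  have hQlim : ∀ k, Tendsto (fun n => (μ n).real (Q n k)) atTop (𝓝 0) := by
    intro k
    have hlim : Tendsto (fun n : ℕ => (1 + lam * K) * h * (64 / ε ^ 2) / ((n + 1 : ℕ) : ℝ))
        atTop (𝓝 0) :=
      (tendsto_const_div_atTop_nhds_zero_nat _).comp (tendsto_add_atTop_nat 1)
    refine tendsto_of_tendsto_of_tendsto_of_le_of_le tendsto_const_nhds hlim
      (fun n => measureReal_nonneg) fun n => ?_
    have hmem := (hX n).memLp_totalCount (K := K) (k * h) ((k + 1) * h)
    have hmean := (hX n).integral_totalCount (K := K) (k * h) ((k + 1) * h)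
    have hvar := (hX n).variance_totalCount (K := K) (k * h) ((k + 1) * h)
    have hsub : ((k : ℝ≥0) + 1) * h - k * h = h := by
      rw [add_mul, one_mul, add_tsub_cancel_left]
    rw [hsub, Fintype.card_fin] at hmean hvar
    have hn : (0 : ℝ) < (n + 1 : ℕ) := by positivity
    have hc : 0 < (n + 1 : ℕ) * (ε / 8) := by positivity
    have hcheb := meas_ge_le_variance_div_sq hmem hc
    rw [hmean, hvar] at hcheb
    have hsubset : Q n k ⊆ {ω | (n + 1 : ℕ) * (ε / 8)
        ≤ |totalCount (D n) (A n) K (k * h) ((k + 1) * h) ω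
          - (n + 1 : ℕ) * (1 + lam * K) * h|} := by
      intro ω hω
      have h1 : ε / 4 ≤ totalCount (D n) (A n) K (k * h) ((k + 1) * h) ω / (n + 1 : ℕ) := hω
      rw [le_div_iff₀ hn] at h1
      refine le_trans ?_ (le_abs_self (totalCount (D n) (A n) K (k * h) ((k + 1) * h) ω
        - (n + 1 : ℕ) * (1 + lam * K) * h))
      have h2 := mul_le_mul_of_nonneg_left hh.1 hn.le
      linarith
    calc (μ n).real (Q n k)
        ≤ (ENNReal.ofReal ((n + 1 : ℕ) * (1 + lam * K) * h / ((n + 1 : ℕ) * (ε / 8)) ^ 2)).toReal :=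
          ENNReal.toReal_mono ENNReal.ofReal_ne_top ((measure_mono hsubset).trans hcheb)
      _ = (1 + lam * K) * h * (64 / ε ^ 2) / ((n + 1 : ℕ) : ℝ) := by
          rw [ENNReal.toReal_ofReal (by positivity)]
          field_simp
          norm_num
  have hsum : Tendsto (fun n => ∑ k ∈ Finset.range (m + 1),
      ((μ n).real (P n k) + (μ n).real (Q n k))) atTop (𝓝 0) := by
    simpa using tendsto_finsetSum (Finset.range (m + 1)) fun k _ => (hPlim k).add (hQlim k)
  refine tendsto_of_tendsto_of_tendsto_of_le_of_le' tendsto_const_nhds hsum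
    (Eventually.of_forall fun n => measureReal_nonneg) ?_
  filter_upwards [eventually_isNearRegular hmin hreg e] with n h1
  have hC := arrivalIntensity_mem_Icc_intensityBound (rule := rule n) h1.1 h1.2
  have hbound : (μ n).real (⋃ k ∈ Finset.range (m + 1), (P n k ∪ Q n k))
      ≤ ∑ k ∈ Finset.range (m + 1), ((μ n).real (P n k) + (μ n).real (Q n k)) :=
    (measureReal_biUnion_finset_le _ _).trans
      (Finset.sum_le_sum fun k _ => measureReal_union_le _ _)
  refine le_trans (ENNReal.toReal_mono (measure_ne_top _ _) (measure_mono_ae ?_)) hbound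
  filter_upwards [(hX n).ae_isDrivenPath hC] with ω hω hbad
  by_contra hnot
  refine not_le.2 (show ENNReal.ofReal ε < edist _ _ from hbad) ?_
  -- The identity time change bounds the Skorokhod distance by the uniform one.
  refine iInf_le_of_le (OrderIso.refl _) (max_le (by simp) (iSup_le fun t => ?_))
  obtain ⟨s, hs⟩ := t
  change edist (occupancy (X n s ω)) (q s) ≤ _
  rw [edist_dist]
  refine ENNReal.ofReal_le_ofReal ?_
  obtain ⟨k, hk1, hk2, hk⟩ := exists_grid_point (s := s) hh0
  have hkm : k ∈ Finset.range (m + 1) := by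
    rw [Finset.mem_range, Nat.lt_succ_iff, hk]
    exact Nat.floor_mono (div_le_div_of_nonneg_right hs.2 hh0.le)
  have hnk : ω ∉ P n k ∪ Q n k := fun hmem => hnot (mem_biUnion hkm hmem)
  have hPk : dist (occupancy (X n (k * h) ω)) (q (k * h)) < ε / 4 :=
    not_le.1 fun hc => hnk (Or.inl hc)
  have hQk : totalCount (D n) (A n) K (k * h) ((k + 1) * h) ω / (n + 1 : ℕ) < ε / 4 :=
    not_le.1 fun hc => hnk (Or.inr hc)
  have hosc : dist (occupancy (X n s ω)) (occupancy (X n (k * h) ω)) < ε / 4 := by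
    refine (dist_occupancy_le_totalCount hω hk1).trans_lt (lt_of_le_of_lt ?_ hQk)
    rw [Fintype.card_fin]
    gcongr
    exact totalCount_mono hω _ hk2
  have hqd : dist (q (k * h)) (q s) ≤ ε / 4 := by
    refine (hq.dist_le _ _).trans (le_trans ?_ hh.2)
    gcongr
    rw [dist_comm, NNReal.dist_eq, abs_of_nonneg (sub_nonneg.2 (by exact_mod_cast hk1))]
    have : (s : ℝ) ≤ (k + 1) * h := by exact_mod_cast hk2
    push_cast
    linarith
  have h3 := dist_triangle4 (occupancy (X n s ω)) (occupancy (X n (k * h) ω)) (q (k * h)) (q s)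
  linarith

end Sequence

end JSQ

namespace JSQ

/-! ### Measurability of the occupancy path in the Skorokhod space -/

section TimeChange

/-- A sum of tent functions of half-width `δ`, shifting each `j ∈ J` to `s j`. -/
noncomputable def tentShift (J : Finset ℝ) (s : ℝ → ℝ) (δ t : ℝ) : ℝ :=
  t + ∑ j ∈ J, (s j - j) * max 0 (1 - |t - j| / δ)

variable {J : Finset ℝ} {s : ℝ → ℝ} {δ η : ℝ}

/-- Jump times are at least `δ` apart, so the tents of all other points vanish at `j`. -/
theorem tentShift_apply (hδ : 0 < δ) (hgap : ∀ j ∈ J, ∀ k ∈ J, j ≠ k → δ ≤ |j - k|) {j : ℝ}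
    (hj : j ∈ J) : tentShift J s δ j = s j := by
  unfold tentShift
  rw [Finset.sum_eq_single j]
  · simp
  · intro k hk hkj
    rw [max_eq_left, mul_zero]
    have := hgap j hj k hk hkj.symm
    have := (one_le_div hδ).2 this
    linarith
  · exact fun h => absurd hj h

theorem abs_tentShift_sub_le (hδ : 0 < δ) (hs : ∀ j ∈ J, |s j - j| ≤ η) (t : ℝ) :
    |tentShift J s δ t - t| ≤ J.card * η := by
  unfold tentShift
  rw [add_sub_cancel_left, ← nsmul_eq_mul]
  refine (Finset.abs_sum_le_sum_abs _ _).trans (Finset.sum_le_card_nsmul _ _ _ fun j hj => ?_)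
  rw [abs_mul, abs_of_nonneg (le_max_left (0 : ℝ) _)]
  have h1 : max 0 (1 - |t - j| / δ) ≤ 1 := max_le zero_le_one (sub_le_self _ (by positivity))
  exact (mul_le_of_le_one_right (abs_nonneg _) h1).trans (hs j hj)

/-- The perturbation of the identity has Lipschitz constant at most `J.card * η / δ`, which is less
than 1. -/
theorem strictMono_tentShift (hδ : 0 < δ) (hs : ∀ j ∈ J, |s j - j| ≤ η) (hη : J.card * η < δ) :
    StrictMono (tentShift J s δ) := by
  intro t u htu
  have hterm : ∀ j ∈ J, |(s j - j) * max 0 (1 - |u - j| / δ) - (s j - j) * max 0 (1 - |t - j| / δ)|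
      ≤ η * ((u - t) / δ) := by
    intro j hj
    rw [← mul_sub, abs_mul]
    refine mul_le_mul (hs j hj) ?_ (abs_nonneg _) ((abs_nonneg _).trans (hs j hj))
    refine (abs_max_sub_max_le_max _ _ _ _).trans ?_
    rw [sub_self, abs_zero, max_eq_right (abs_nonneg _), sub_sub_sub_cancel_left, ← sub_div,
      abs_div, abs_of_pos hδ]
    gcongr
    refine (abs_abs_sub_abs_le _ _).trans ?_
    rw [sub_sub_sub_cancel_right, abs_sub_comm, abs_of_pos (sub_pos.2 htu)]
  have hsum := (Finset.abs_sum_le_sum_abs _ _).trans (Finset.sum_le_card_nsmul J _ _ hterm)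
  rw [Finset.sum_sub_distrib, nsmul_eq_mul] at hsum
  have h1 : (J.card : ℝ) * (η * ((u - t) / δ)) < u - t := by
    have h2 : (J.card : ℝ) * η / δ < 1 := (div_lt_one hδ).2 hη
    have h3 := mul_lt_mul_of_pos_right h2 (sub_pos.2 htu)
    calc _ = (J.card : ℝ) * η / δ * (u - t) := by ring
      _ < _ := by linarith
  unfold tentShift
  have := neg_le_of_abs_le hsum
  linarith

theorem continuous_tentShift : Continuous (tentShift J s δ) := by
  unfold tentShift
  fun_prop

/-- A strictly increasing time change of `[0,T]` moving finitely many given times slightly. -/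
theorem exists_orderIso_of_shift {T : ℝ≥0} (h0 : (0 : ℝ) ∈ J) (hT : (T : ℝ) ∈ J)
    (hs0 : s 0 = 0) (hsT : s T = T) (hδ : 0 < δ)
    (hgap : ∀ j ∈ J, ∀ k ∈ J, j ≠ k → δ ≤ |j - k|) (hs : ∀ j ∈ J, |s j - j| ≤ η)
    (hη : J.card * η < δ) :
    ∃ φ : Icc (0 : ℝ≥0) T ≃o Icc (0 : ℝ≥0) T, (∀ t, dist (φ t) t ≤ J.card * η) ∧
      ∀ j ∈ J, ∀ t : Icc (0 : ℝ≥0) T, j ≤ t.1 ↔ s j ≤ (φ t).1 := by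
  set Φ := tentShift J s δ with hΦ
  have hmono : StrictMono Φ := strictMono_tentShift hδ hs hη
  have hΦ0 : Φ 0 = 0 := (tentShift_apply hδ hgap h0).trans hs0
  have hΦT : Φ T = T := (tentShift_apply hδ hgap hT).trans hsT
  have hnn : ∀ t : Icc (0 : ℝ≥0) T, 0 ≤ Φ t.1 := fun t => by
    rw [← hΦ0]; exact hmono.monotone t.1.coe_nonneg
  have hle : ∀ t : Icc (0 : ℝ≥0) T, Φ t.1 ≤ T := fun t =>
    (hmono.monotone (by exact_mod_cast t.2.2)).trans hΦT.le
  let f : Icc (0 : ℝ≥0) T → Icc (0 : ℝ≥0) T := fun t => ⟨⟨Φ t.1, hnn t⟩, zero_le, hle t⟩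
  have hf : StrictMono f := fun t u htu => hmono (show (t.1 : ℝ) < u.1 from by exact_mod_cast htu)
  have hsurj : Function.Surjective f := by
    intro y
    have := intermediate_value_Icc T.coe_nonneg
      (continuous_tentShift (J := J) (s := s) (δ := δ)).continuousOn
    have hy : (y.1 : ℝ) ∈ Icc (Φ 0) (Φ T) := by
      rw [hΦ0, hΦT]
      exact ⟨y.1.coe_nonneg, by exact_mod_cast y.2.2⟩
    obtain ⟨t, ht, hty⟩ := this hy
    exact ⟨⟨⟨t, ht.1⟩, zero_le, ht.2⟩, Subtype.ext (NNReal.eq hty)⟩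
  refine ⟨hf.orderIsoOfSurjective f hsurj, fun t => ?_, fun j hj t => ?_⟩
  · exact abs_tentShift_sub_le hδ hs t.1
  · change j ≤ t.1 ↔ s j ≤ Φ t.1
    rw [← tentShift_apply (s := s) hδ hgap hj]
    exact hmono.le_iff_le.symm

end TimeChange

section Jumps

/-- Each time `t` has a neighbourhood on which the path takes one value before `t` and one from `t`
on. By compactness finitely many of these suffice; their centres and endpoints lying in `[0,T]` form
`J`. The condition on `s` and `u` says that they lie in the same left-closed cell. -/
theorem exists_finset_jumps {S : Type*} {x : ℝ → S} (hr : ∀ t, ∀ᶠ s in 𝓝[≥] t, x s = x t)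
    (hl : ∀ t, ∃ l, ∀ᶠ s in 𝓝[<] t, x s = l) (T : ℝ) :
    ∃ J : Finset ℝ, (∀ j ∈ J, j ∈ Icc 0 T) ∧
      ∀ s ∈ Icc 0 T, ∀ u ∈ Icc 0 T, (∀ j ∈ J, j ≤ s ↔ j ≤ u) → x s = x u := by
  have hloc : ∀ t, ∃ a b, a < t ∧ t < b ∧ (∀ s ∈ Ico t b, x s = x t) ∧
      ∃ l, ∀ s ∈ Ico a t, x s = l := by
    intro t
    obtain ⟨b, hb, hb'⟩ := mem_nhdsGE_iff_exists_Ico_subset.1 (hr t)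
    obtain ⟨l, hl⟩ := hl t
    obtain ⟨a, ha, ha'⟩ := mem_nhdsLT_iff_exists_Ioo_subset.1 hl
    obtain ⟨a', h1, h2⟩ := exists_between (show a < t from ha)
    exact ⟨a', b, h2, hb, fun s hs => hb' hs, l, fun s hs => ha' ⟨h1.trans_le hs.1, hs.2⟩⟩
  choose a b ha hb hconst l hl using hloc
  obtain ⟨C, hC⟩ := (isCompact_Icc (a := (0 : ℝ)) (b := T)).elim_finite_subcover
    (fun t => Ioo (a t) (b t)) (fun t => isOpen_Ioo)
    fun t _ => mem_iUnion.2 ⟨t, ha t, hb t⟩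
  classical
  refine ⟨(C ∪ C.image a ∪ C.image b).filter (· ∈ Icc 0 T), fun j hj => (Finset.mem_filter.1 hj).2,
    fun s hs u hu h => ?_⟩
  have h' : ∀ j ∈ C ∪ C.image a ∪ C.image b, j ≤ s ↔ j ≤ u := by
    intro j hj
    by_cases hjT : j ∈ Icc 0 T
    · exact h j (Finset.mem_filter.2 ⟨hj, hjT⟩)
    · rcases not_and_or.1 hjT with h0 | h0
      · exact iff_of_true ((not_le.1 h0).le.trans hs.1) ((not_le.1 h0).le.trans hu.1)
      · exact iff_of_false (fun h1 => h0 (h1.trans hs.2)) fun h1 => h0 (h1.trans hu.2)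
  obtain ⟨c, hc, hsc⟩ := mem_iUnion₂.1 (hC hs)
  have h1 := h' c (by simp [hc])
  have h2 : b c ≤ s ↔ b c ≤ u :=
    h' (b c) (Finset.mem_union_right _ (Finset.mem_image_of_mem _ hc))
  have h3 : a c ≤ s ↔ a c ≤ u :=
    h' (a c) (Finset.mem_union_left _ (Finset.mem_union_right _ (Finset.mem_image_of_mem _ hc)))
  have hub : u < b c := not_le.1 fun h => not_le.2 hsc.2 (h2.2 h)
  by_cases hcs : c ≤ s
  · rw [hconst c s ⟨hcs, hsc.2⟩, hconst c u ⟨h1.1 hcs, hub⟩]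
  · have hcu : u < c := not_le.1 fun h => hcs (h1.2 h)
    rw [hl c s ⟨hsc.1.le, not_le.1 hcs⟩, hl c u ⟨h3.1 hsc.1.le, hcu⟩]

theorem exists_pos_le_abs_sub (J : Finset ℝ) :
    ∃ δ : ℝ, 0 < δ ∧ ∀ j ∈ J, ∀ k ∈ J, j ≠ k → δ ≤ |j - k| := by
  have h : ∀ᶠ δ : ℝ in 𝓝[>] 0, ∀ j ∈ J, ∀ k ∈ J, j ≠ k → δ ≤ |j - k| := by
    refine (Finset.eventually_all J).2 fun j _ => (Finset.eventually_all J).2 fun k _ => ?_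
    by_cases hjk : j = k
    · simp [hjk]
    · filter_upwards [mem_nhdsWithin_of_mem_nhds
        (Iic_mem_nhds (abs_pos.2 (sub_ne_zero.2 hjk)))] with δ hδ _ using hδ
  obtain ⟨δ, h1, h2⟩ := (h.and self_mem_nhdsWithin).exists
  exact ⟨δ, h2, h1⟩

end Jumps

section Discretization

/-- Just before `t` the floor equals `⌈t * r⌉ - 1`; if that ceiling is 0, the path is constant to
the left of `t`. -/
theorem isCadlag_comp_floor {E : Type*} [TopologicalSpace E] {T : ℝ≥0} (r : ℝ≥0) (c : ℕ → E) :
    IsCadlag fun t : Icc (0 : ℝ≥0) T => c ⌊t.1 * r⌋₊ := by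
  intro t
  have hcont : Continuous fun s : Icc (0 : ℝ≥0) T => s.1 * r := by fun_prop
  constructor
  · have h1 : ∀ᶠ s : Icc (0 : ℝ≥0) T in 𝓝[≥] t, s.1 * r < ⌊t.1 * r⌋₊ + 1 :=
      mem_nhdsWithin_of_mem_nhds (hcont.continuousAt.eventually_lt_const (Nat.lt_floor_add_one _))
    refine (tendsto_const_nhds (x := c ⌊t.1 * r⌋₊)).congr' ?_
    filter_upwards [h1, self_mem_nhdsWithin] with s hs hts
    congr 1
    refine ((Nat.floor_eq_iff zero_le).2 ⟨(Nat.floor_le zero_le).trans ?_, hs⟩).symm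
    exact mul_le_mul_left (show t.1 ≤ s.1 from hts) r
  · rcases Nat.eq_zero_or_pos ⌈t.1 * r⌉₊ with h0 | h0
    · refine ⟨c 0, (tendsto_const_nhds (x := c 0)).congr' ?_⟩
      filter_upwards [self_mem_nhdsWithin] with s hs
      have hs' : s.1 * r ≤ t.1 * r := mul_le_mul_left (show s.1 ≤ t.1 from (le_of_lt hs)) r
      have : s.1 * r = 0 := le_antisymm (hs'.trans (Nat.ceil_eq_zero.1 h0)) zero_le
      rw [this, Nat.floor_zero]
    · refine ⟨c (⌈t.1 * r⌉₊ - 1), (tendsto_const_nhds (x := c (⌈t.1 * r⌉₊ - 1))).congr' ?_⟩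
      have hlt : ((⌈t.1 * r⌉₊ - 1 : ℕ) : ℝ≥0) < t.1 * r := Nat.lt_ceil.1 (by omega)
      have hr : 0 < r := by
        rcases eq_or_ne r 0 with h | h
        · simp [h] at hlt
        · exact pos_iff_ne_zero.2 h
      have h1 : ∀ᶠ s : Icc (0 : ℝ≥0) T in 𝓝[<] t, ((⌈t.1 * r⌉₊ - 1 : ℕ) : ℝ≥0) < s.1 * r :=
        mem_nhdsWithin_of_mem_nhds (hcont.continuousAt.eventually_const_lt hlt)
      filter_upwards [h1, self_mem_nhdsWithin] with s hs hst
      congr 1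
      refine ((Nat.floor_eq_iff zero_le).2 ⟨hs.le, ?_⟩).symm
      have h2 : s.1 * r < t.1 * r := mul_lt_mul_of_pos_right (show s.1 < t.1 from hst) hr
      have h3 : ((⌈t.1 * r⌉₊ - 1 : ℕ) : ℝ≥0) + 1 = ⌈t.1 * r⌉₊ := by
        exact_mod_cast Nat.sub_add_cancel h0
      rw [h3]
      exact h2.trans_le (Nat.le_ceil _)

/-- The path which follows the values `y 0, …, y N` on a uniform grid of `[0,T]`. -/
noncomputable def gridPath {E : Type*} [TopologicalSpace E] (T : ℝ≥0) (N : ℕ) (y : Fin (N + 1) → E) :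
    SkorokhodSpace T E :=
  ⟨fun t => y (Fin.ofNat (N + 1) ⌊t.1 * (N / T)⌋₊),
    isCadlag_comp_floor (N / T) fun k => y (Fin.ofNat (N + 1) k)⟩

theorem IsCadlag.eventually_eq_right {S : Type*} [TopologicalSpace S] [DiscreteTopology S]
    {x : ℝ≥0 → S} (hx : IsCadlag x) (t : ℝ) :
    ∀ᶠ s in 𝓝[≥] t, x s.toNNReal = x t.toNNReal := by
  have h1 : Tendsto Real.toNNReal (𝓝[≥] t) (𝓝[≥] t.toNNReal) :=
    tendsto_nhdsWithin_iff.2 ⟨continuous_real_toNNReal.continuousAt.tendsto.mono_left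
      nhdsWithin_le_nhds, eventually_nhdsWithin_of_forall fun s hs => Real.toNNReal_mono hs⟩
  exact ((hx t.toNNReal).1.tendsto.comp h1).eventually_mem (mem_nhds_discrete.2 (mem_singleton _))

theorem IsCadlag.eventually_eq_left {S : Type*} [TopologicalSpace S] [DiscreteTopology S]
    {x : ℝ≥0 → S} (hx : IsCadlag x) (t : ℝ) :
    ∃ l, ∀ᶠ s in 𝓝[<] t, x s.toNNReal = l := by
  rcases le_or_gt t 0 with ht | ht
  · refine ⟨x 0, eventually_nhdsWithin_of_forall fun s hs => ?_⟩
    rw [Real.toNNReal_of_nonpos ((le_of_lt hs).trans ht)]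
  · obtain ⟨l, hl⟩ := (hx t.toNNReal).2
    have h1 : Tendsto Real.toNNReal (𝓝[<] t) (𝓝[<] t.toNNReal) :=
      tendsto_nhdsWithin_iff.2 ⟨continuous_real_toNNReal.continuousAt.tendsto.mono_left
        nhdsWithin_le_nhds, eventually_nhdsWithin_of_forall fun s hs =>
          (Real.toNNReal_lt_toNNReal_iff ht).2 hs⟩
    exact ⟨l, (hl.comp h1).eventually_mem (mem_nhds_discrete.2 (mem_singleton _))⟩

/-- The grid discretizations of a càdlàg path with discrete values converge in the Skorokhod
topology. -/
theorem tendsto_gridPath {S E : Type*} [TopologicalSpace S] [DiscreteTopology S]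
    [PseudoEMetricSpace E] {T : ℝ≥0} (hT : 0 < T) {x : ℝ≥0 → S} (hx : IsCadlag x) (F : S → E)
    (z : SkorokhodSpace T E) (hz : ∀ t, z.1 t = F (x t)) :
    Tendsto (fun n : ℕ => gridPath T (n + 1) fun k => F (x (k * (T / (n + 1 : ℕ))))) atTop
      (𝓝 z) := by
  obtain ⟨J₀, hJ₀, hconst⟩ := exists_finset_jumps hx.eventually_eq_right hx.eventually_eq_left
    (T : ℝ)
  classical
  -- Both endpoints are included so that the time change fixes them.
  set J := insert 0 (insert (T : ℝ) J₀) with hJ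
  have hJT : ∀ j ∈ J, j ∈ Icc 0 (T : ℝ) := by
    intro j hj
    rcases Finset.mem_insert.1 hj with rfl | hj
    · exact ⟨le_rfl, T.coe_nonneg⟩
    rcases Finset.mem_insert.1 hj with rfl | hj
    · exact ⟨T.coe_nonneg, le_rfl⟩
    · exact hJ₀ j hj
  obtain ⟨δ, hδ, hgap⟩ := exists_pos_le_abs_sub J
  have hTR : (0 : ℝ) < T := hT
  have hlim : Tendsto (fun n : ℕ => (J.card : ℝ) * ((T : ℝ) / (n + 1 : ℕ))) atTop (𝓝 0) := by
    simpa using ((tendsto_const_div_atTop_nhds_zero_nat (T : ℝ)).comp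
      (tendsto_add_atTop_nat 1)).const_mul (J.card : ℝ)
  have hedist : ∀ᶠ n : ℕ in atTop,
      edist (gridPath T (n + 1) fun k => F (x (k * (T / (n + 1 : ℕ))))) z
        ≤ ENNReal.ofReal ((J.card : ℝ) * ((T : ℝ) / (n + 1 : ℕ))) := by
    filter_upwards [hlim.eventually_lt_const hδ] with n hn
    have hN : (0 : ℝ) < (n + 1 : ℕ) := by positivity
    set h : ℝ := (T : ℝ) / (n + 1 : ℕ) with hh
    have hh0 : 0 < h := div_pos hTR hN
    -- A jump at `j` becomes visible to the discretised path at the first grid time not before `j`.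
    set s : ℝ → ℝ := fun j => ⌈j / h⌉₊ * h with hs
    have hTh : (T : ℝ) / h = (n + 1 : ℕ) := by
      rw [hh]; field_simp
    have hsj : ∀ j ∈ J, |s j - j| ≤ h := by
      intro j hj
      have h0 : 0 ≤ j / h := div_nonneg (hJT j hj).1 hh0.le
      have h1 : j ≤ s j := by
        have := Nat.le_ceil (j / h)
        rwa [div_le_iff₀ hh0] at this
      have h2 : s j < j + h := by
        have := mul_lt_mul_of_pos_right (Nat.ceil_lt_add_one h0) hh0
        rwa [add_mul, div_mul_cancel₀ _ hh0.ne', one_mul] at this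
      rw [abs_of_nonneg (sub_nonneg.2 h1)]
      linarith
    obtain ⟨φ, hφ1, hφ2⟩ := exists_orderIso_of_shift (J := J) (s := s) (δ := δ) (η := h) (T := T)
      (by simp [hJ]) (by simp [hJ]) (by simp [hs])
      (by
        change (⌈(T : ℝ) / h⌉₊ : ℝ) * h = T
        rw [hTh, Nat.ceil_natCast, hh]
        field_simp) hδ hgap hsj hn
    rw [edist_comm]
    refine iInf_le_of_le φ (max_le (iSup_le fun t => ?_) (iSup_le fun t => ?_))
    · rw [edist_dist]
      exact ENNReal.ofReal_le_ofReal (hφ1 t)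
    -- After the time change the two paths coincide exactly; only the displacement of time
    -- contributes to the distance.
    · refine le_trans (le_of_eq ?_) zero_le
      set k := ⌊(φ t).1 * ((n + 1 : ℕ) / T)⌋₊ with hk
      -- Even at the right end the index stays in range, so `Fin.ofNat` does not wrap around.
      have hkle : k ≤ n + 1 := by
        have h1 : (φ t).1 * ((n + 1 : ℕ) / T) ≤ (n + 1 : ℕ) := by
          calc _ ≤ T * ((n + 1 : ℕ) / T) := mul_le_mul_left (φ t).2.2 _
            _ = (n + 1 : ℕ) := by field_simp
        have h2 := Nat.floor_mono h1
        rwa [Nat.floor_natCast] at h2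
      have hval : (gridPath T (n + 1) fun k => F (x (k * (T / (n + 1 : ℕ))))).1 (φ t)
          = F (x (k * (T / (n + 1 : ℕ)))) := by
        change F (x (((Fin.ofNat (n + 1 + 1) k : Fin (n + 1 + 1)) : ℕ) * (T / (n + 1 : ℕ)))) = _
        rw [Fin.val_ofNat, Nat.mod_eq_of_lt (by omega)]
      rw [hval, hz]
      have hx' : x t = x (k * (T / (n + 1 : ℕ))) := by
        have hkT : ((k : ℝ) * h) ∈ Icc 0 (T : ℝ) := by
          refine ⟨by positivity, ?_⟩
          calc (k : ℝ) * h ≤ (n + 1 : ℕ) * h := by gcongr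
            _ = T := by rw [hh]; field_simp
        have := hconst t.1 ⟨t.1.coe_nonneg, by exact_mod_cast t.2.2⟩ (k * h) hkT fun j hj => ?_
        · rw [Real.toNNReal_coe] at this
          rw [this]
          congr 1
          refine NNReal.eq ?_
          rw [Real.coe_toNNReal _ hkT.1]
          push_cast
          simp [hh]
        · have hjJ : j ∈ J := by simp [hJ, hj]
          rw [hφ2 j hjJ t]
          -- Because `k` is the floor of `φ t / h`, the shifted jump time is at most `φ t` exactly
          -- when it is at most the grid time `k * h`.
          have hkey : (⌈j / h⌉₊ : ℝ) * h ≤ (φ t).1 ↔ ⌈j / h⌉₊ ≤ k := by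
            have h3 : (((φ t).1 * ((n + 1 : ℕ) / T) : ℝ≥0) : ℝ) = (φ t).1 / h := by
              rw [hh, div_div_eq_mul_div, mul_div_assoc]
              push_cast
              rfl
            rw [hk, Nat.le_floor_iff zero_le, ← NNReal.coe_le_coe, ← le_div_iff₀ hh0, h3,
              NNReal.coe_natCast]
          change (⌈j / h⌉₊ : ℝ) * h ≤ (φ t).1 ↔ _
          rw [hkey, Nat.ceil_le, div_le_iff₀ hh0]
      rw [hx', edist_self]
  rw [tendsto_iff_edist_tendsto_0]
  refine tendsto_of_tendsto_of_tendsto_of_le_of_le' tendsto_const_nhds ?_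
    (Eventually.of_forall fun _ => zero_le) hedist
  simpa using ENNReal.tendsto_ofReal hlim

/-- This avoids comparing the Borel σ-algebra with the one generated by evaluations. The path is a
pointwise limit of step paths, each a function of finitely many queue-length vectors; every function
on that countable discrete space is measurable. The horizon 0 is separate, since its grid
degenerates. -/
theorem measurable_occupancyPath {V Ω : Type*} [Fintype V] [Nonempty V] [MeasurableSpace Ω]
    (T : ℝ≥0) {X : ℝ≥0 → Ω → V → ℕ} (hX : ∀ t, Measurable (X t))
    (hc : ∀ ω, IsCadlag fun t => X t ω) :
    Measurable fun ω => occupancyPath T (fun t => X t ω) (hc ω) := by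
  rcases eq_or_ne T 0 with rfl | hT
  · have : (fun ω => occupancyPath 0 (fun t => X t ω) (hc ω)) =
        (fun y => occupancyPath 0 (fun _ => y) (isCadlag_of_continuous continuous_const)) ∘ X 0 := by
      funext ω
      refine Subtype.ext (funext fun t => ?_)
      have : t.1 = 0 := le_antisymm t.2.2 zero_le
      change occupancy (X t.1 ω) = occupancy (X 0 ω)
      rw [this]
    rw [this]
    exact Measurable.of_discrete.comp (hX 0)
  · refine measurable_of_tendsto_metrizable
      (f := fun (n : ℕ) ω => gridPath T (n + 1) fun k =>
        occupancy (X (k * (T / (n + 1 : ℕ))) ω)) (fun n => ?_)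
      (tendsto_pi_nhds.2 fun ω => tendsto_gridPath (pos_iff_ne_zero.2 hT) (hc ω) occupancy _
        fun _ => rfl)
    have hg : Measurable fun y : Fin (n + 1 + 1) → V → ℕ =>
        gridPath T (n + 1) fun k => occupancy (y k) := Measurable.of_discrete
    have hXg : Measurable fun ω (k : Fin (n + 1 + 1)) => X (k * (T / (n + 1 : ℕ))) ω :=
      measurable_pi_iff.2 fun k => hX _
    have := hg.comp hXg
    simp only [Function.comp_def] at this
    exact this

end Discretization

end JSQ

namespace JSQ

/-! ### Convergence in probability to a constant implies convergence in distribution -/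

/-- A bounded continuous test function varies little near `z` and by at most `2 * ‖f‖` elsewhere.
Only its continuity at `z` controls the first part, so no structure of `E` beyond its
pseudo-distance is used. -/
theorem tendstoInDistribution_const {E : Type*} [PseudoEMetricSpace E] [MeasurableSpace E]
    [BorelSpace E] {Ω : ℕ → Type*} [mΩ : ∀ n, MeasurableSpace (Ω n)] {μ : ∀ n, Measure (Ω n)}
    [∀ n, IsProbabilityMeasure (μ n)] {Y : ∀ n, Ω n → E} (hY : ∀ n, Measurable (Y n)) (z : E)
    (h : ∀ ε : ℝ, 0 < ε →
      Tendsto (fun n => (μ n).real {ω | ENNReal.ofReal ε < edist (Y n ω) z}) atTop (𝓝 0)) :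
    TendstoInDistribution Y atTop (fun _ : Unit => z) μ (Measure.dirac ()) := by
  refine ⟨fun n => (hY n).aemeasurable, aemeasurable_const, ?_⟩
  refine ProbabilityMeasure.tendsto_iff_forall_integral_tendsto.2 fun f => ?_
  have hlim : ∫ x, f x ∂((Measure.dirac ()).map fun _ : Unit => z) = f z := by
    rw [integral_map aemeasurable_const f.continuous.measurable.aestronglyMeasurable]
    simp
  have hmap : ∀ n, ∫ x, f x ∂((μ n).map (Y n)) = ∫ ω, f (Y n ω) ∂μ n := fun n =>
    integral_map (hY n).aemeasurable f.continuous.measurable.aestronglyMeasurable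
  simp only [ProbabilityMeasure.coe_mk, hlim, hmap]
  have hfY : ∀ n, Measurable fun ω => f (Y n ω) := fun n => f.continuous.measurable.comp (hY n)
  have hfi : ∀ n, Integrable (fun ω => f (Y n ω)) (μ n) := fun n =>
    Integrable.of_bound (hfY n).aestronglyMeasurable ‖f‖
      (Eventually.of_forall fun ω => f.norm_coe_le_norm _)
  rw [Metric.tendsto_atTop']
  intro a ha
  obtain ⟨r, hr, hball⟩ := EMetric.mem_nhds_iff.1
    (f.continuous.continuousAt.preimage_mem_nhds (Metric.ball_mem_nhds (f z) (half_pos ha)))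
  obtain ⟨ε, hε, hεr⟩ : ∃ ε : ℝ, 0 < ε ∧ ENNReal.ofReal ε < r := by
    obtain ⟨s, hs0, hsr⟩ := ENNReal.lt_iff_exists_nnreal_btwn.1 hr
    exact ⟨s, by exact_mod_cast hs0, by simpa using hsr⟩
  have hB := (h ε hε).const_mul (2 * ‖f‖)
  rw [mul_zero] at hB
  obtain ⟨n₀, hn₀⟩ := eventually_atTop.1 (hB.eventually_lt_const (half_pos ha))
  refine ⟨n₀, fun n hn => ?_⟩
  set B := {ω | ENNReal.ofReal ε < edist (Y n ω) z} with hBdef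
  have hBm : MeasurableSet B := by
    have hset : IsOpen {y : E | ENNReal.ofReal ε < edist y z} :=
      isOpen_lt continuous_const (continuous_id.edist continuous_const)
    exact hY n hset.measurableSet
  have hpt : ∀ ω, |f (Y n ω) - f z| ≤ a / 2 + B.indicator (fun _ => 2 * ‖f‖) ω := by
    intro ω
    by_cases hω : ω ∈ B
    · rw [indicator_of_mem hω]
      have h1 : |f (Y n ω) - f z| ≤ 2 * ‖f‖ := by
        rw [← Real.dist_eq]
        exact f.dist_le_two_norm _ _
      linarith
    · rw [indicator_of_notMem hω, add_zero]
      have h1 : Y n ω ∈ Metric.eball z r := (not_lt.1 hω).trans_lt hεr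
      have h2 : dist (f (Y n ω)) (f z) < a / 2 := hball h1
      rw [Real.dist_eq] at h2
      exact h2.le
  have hind : Integrable (B.indicator fun _ => 2 * ‖f‖) (μ n) :=
    (integrable_const _).indicator hBm
  rw [Real.dist_eq]
  calc |∫ ω, f (Y n ω) ∂μ n - f z| = |∫ ω, (f (Y n ω) - f z) ∂μ n| := by
        rw [integral_sub (hfi n) (integrable_const _)]
        simp
    _ ≤ ∫ ω, |f (Y n ω) - f z| ∂μ n := abs_integral_le_integral_abs
    _ ≤ ∫ ω, (a / 2 + B.indicator (fun _ => 2 * ‖f‖) ω) ∂μ n :=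
        integral_mono_of_nonneg (Eventually.of_forall fun ω => abs_nonneg _)
          ((integrable_const _).add hind) (Eventually.of_forall hpt)
    _ = a / 2 + 2 * ‖f‖ * (μ n).real B := by
        rw [integral_add (integrable_const _) hind, integral_indicator hBm]
        simp
        ring
    _ < a := by
        have := hn₀ n (le_of_lt hn)
        linarith

end JSQ

/-- Weak convergence, in the Skorokhod `J₁` topology on every finite time interval, of the JSQ(`d`)
occupancy processes on the graphs `G n` with `n + 1` servers to the unique solution of the
supermarket equation. -/
theorem theorem1
    (lam : ℝ≥0) (hlam : 0 < lam) (d : ℕ) (hd : 2 ≤ d)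
    -- the graphs, of diverging minimum degree and asymptotically regular
    (G : ∀ n : ℕ, SimpleGraph (Fin (n + 1))) [∀ n, DecidableRel (G n).Adj]
    (hmin : Tendsto (fun n => (G n).minDegree) atTop atTop)
    (hreg : Tendsto (fun n => ⨆ i : Fin (n + 1),
      |(∑ j, if (G n).Adj j i then 1 / ((G n).degree j : ℝ) else 0) - 1|) atTop (𝓝 0))
    -- the arbitrary assignment rules at servers with fewer than `d - 1` neighbours
    (rule : ∀ n : ℕ, Fin (n + 1) → Fin (n + 1) → (Fin (n + 1) → ℕ) → ℝ)
    (hrule : ∀ n j i x, 0 ≤ rule n j i x ∧ rule n j i x ≤ (G n).degree i + 1)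
    -- the queue-length processes
    {Ω : ℕ → Type*} [mΩ : ∀ n, MeasurableSpace (Ω n)]
    (μ : ∀ n, Measure (Ω n)) [∀ n, IsProbabilityMeasure (μ n)]
    (ℱ : ∀ n, Filtration ℝ≥0 (mΩ n))
    (D : ∀ n, Fin (n + 1) → Ω n → Measure ℝ≥0)
    (A : ∀ n, Fin (n + 1) → Ω n → Measure (ℝ≥0 × ℝ≥0))
    (X : ∀ n, ℝ≥0 → Ω n → Fin (n + 1) → ℕ)
    (hX : ∀ n, JSQ.IsJSQProcess (G n) lam d (rule n) (μ n) (ℱ n) (D n) (A n) (X n))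
    -- the i.i.d. initial queue lengths with tail distribution `q₀`
    (q₀ : JSQ.OccupancySpace)
    (hindep : ∀ n, iIndepFun (fun i ω => X n 0 ω i) (μ n))
    (htail : ∀ n i j, (μ n).real {ω | j ≤ X n 0 ω i} = q₀.1 j) :
    ∃ q : C(ℝ≥0, JSQ.OccupancySpace),
      JSQ.IsSupermarketSolution lam d q₀ q ∧
      (∀ p : ℝ≥0 → JSQ.OccupancySpace, JSQ.IsSupermarketSolution lam d q₀ p → p = q) ∧
      ∀ T : ℝ≥0, TendstoInDistribution
        (fun n ω => JSQ.occupancyPath T (fun t => X n t ω) ((hX n).cadlag ω)) atTop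
        (fun _ : Unit => JSQ.continuousPath T q) μ (Measure.dirac ()) := by
  -- `e + 1` is the number of probed neighbours; writing `d = e + 2` avoids truncated subtraction.
  obtain ⟨e, rfl⟩ : ∃ e, d = e + 2 := ⟨d - 2, by omega⟩
  obtain ⟨q, hq⟩ := JSQ.exists_isSupermarketSolution lam (show e + 2 ≠ 0 by omega) q₀
  refine ⟨q, hq, fun p hp => hp.eq hq, fun T => ?_⟩
  exact JSQ.tendstoInDistribution_const
    (fun n => JSQ.measurable_occupancyPath T (hX n).measurable (hX n).cadlag) _
    fun ε hε => JSQ.tendsto_measure_le_edist_occupancyPath hmin hreg hX hindep htail hq T hε
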